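/- Let $k$ be a field. A DG coalgebra over $k$ is a $\mathbb{Z}$-graded coassociative counital $k$-coalgebra $C=\bigoplus_n C_n$ with a differential $d$ of degree $+1$ for which the comultiplication $\Delta$ and the counit are morphisms of complexes; it is positively graded if $C_n=0$ for $n<0$. For DG coalgebras $A,B$, objects of $\mathrm{Chain}(A\otimes B^{op})$ are the DG $A$-$B$-bicomodules; $\mathcal H(A\otimes B^{op})$ is the category of DG bicomodules modulo bicolinear homotopy, $\mathcal D(A\otimes B^{op})$ its localization at the quasi-isomorphisms, and $\mathcal H^+\subset\mathcal H$, $\mathcal D^+\subset\mathcal D$ are the full subcategories of objects isomorphic to left bounded ones (zero in all sufficiently negative degrees). Write $C^e=C\otimes C^{op}$, and identify DG left $C$-comodules with DG $C$-$k$-bicomodules, so that $\mathcal D^+(C)=\mathcal D^+(C\otimes k^{op})$; it carries the shift $M[-1]_n=M_{n+1}$ and the distinguished triangles given by mapping cones. For a left bounded DG $A$-$B$-bicomodule $X$ and a DG coalgebra $E$, let $X\Box_B^R-:\mathcal D^+(B\otimes E^{op})\to\mathcal D^+(A\otimes E^{op})$ denote the total right derived functor of the cotensor product $X\Box_B-:\mathcal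 H^+(B\otimes E^{op})\to\mathcal H^+(A\otimes E^{op})$. Let $C$ and $D$ be positively graded DG coalgebras over $k$ and let $f:C\to D$ be a quasi-isomorphism of DG coalgebras, that is, a morphism of DG coalgebras which induces an isomorphism on cohomology. Let ${}_fC$ be $C$ regarded as a $D$-$C$-bicomodule with left coaction $(f\otimes \mathrm{id})\Delta$ and right coaction $\Delta$, and let $C_f$ be $C$ regarded as a $C$-$D$-bicomodule with left coaction $\Delta$ and right coaction $(\mathrm{id}\otimes f)\Delta$. Then: 1. the derived functor ${}_fC\,\Box_C^R-:\mathcal D^+(C\otimes D^{op})\to\mathcal D^+(D^e)$ exists and ${}_fC\,\Box_C^R\,C_f\cong D$ in $\mathcal D(D^e)$; 2. the derived functor $C_f\,\Box_D^R-:\mathcal D^+(D\otimes C^{op})\to\mathcal D^+(C^e)$ exists and $C_f\,\Box_D^R\,{}_fC\cong C$ in $\mathcal D(C^e)$; 3. the derived functors ${}_fC\,\Box_C^R-:\mathcal D^+(C)\to\mathcal D^+(D)$ and $C_f\,\Box_D^R-:\mathcal D^+(D)\to\mathcal D^+(C)$ exist and are mutually quasi-inverse equivalences, and ${}_fC\,\Box_C^R-$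 commutes with the shifts and preserves distinguished triangles. In particular $\mathcal D^+(C)$ and $\mathcal D^+(D)$ are equivalent as triangulated categories. -/

import Mathlib

universe u

open CategoryTheory TensorProduct

noncomputable section

section TensorLemmas

variable {k : Type*} [Field k] {A X Y E : Type*} [AddCommGroup A] [Module k A] [AddCommGroup X]
  [Module k X] [AddCommGroup Y] [Module k Y] [AddCommGroup E] [Module k E]

lemma tensor_lco_coassoc (δ : A →ₗ[k] A ⊗[k] A) (ρ : X →ₗ[k] A ⊗[k] X)
    (h : (TensorProduct.assoc k A A X).toLinearMap ∘ₗ δ.rTensor X ∘ₗ ρ = ρ.lTensor A ∘ₗ ρ) :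
    (TensorProduct.assoc k A A (X ⊗[k] Y)).toLinearMap ∘ₗ δ.rTensor (X ⊗[k] Y) ∘ₗ
      ((TensorProduct.assoc k A X Y).toLinearMap ∘ₗ ρ.rTensor Y) =
    ((TensorProduct.assoc k A X Y).toLinearMap ∘ₗ ρ.rTensor Y).lTensor A ∘ₗ
      ((TensorProduct.assoc k A X Y).toLinearMap ∘ₗ ρ.rTensor Y) := by
  have h1 : ((TensorProduct.assoc k A A (X ⊗[k] Y)).toLinearMap ∘ₗ δ.rTensor (X ⊗[k] Y)) ∘ₗ
      (TensorProduct.assoc k A X Y).toLinearMap =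
      ((TensorProduct.assoc k A X Y).toLinearMap.lTensor A ∘ₗ
        (TensorProduct.assoc k A (A ⊗[k] X) Y).toLinearMap) ∘ₗ
        ((TensorProduct.assoc k A A X).toLinearMap ∘ₗ δ.rTensor X).rTensor Y := by
    refine TensorProduct.ext_threefold fun a x y => ?_
    simp only [LinearMap.comp_apply, LinearEquiv.coe_coe, TensorProduct.assoc_tmul,
      LinearMap.rTensor_tmul]
    induction δ a using TensorProduct.induction_on with
    | zero => simp
    | tmul b c => simp
    | add b c hb hc => simp only [TensorProduct.add_tmul, map_add, hb, hc]
  have h2 : ((TensorProduct.assoc k A X Y).toLinearMap ∘ₗ ρ.rTensor Y).lTensor A ∘ₗ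
      (TensorProduct.assoc k A X Y).toLinearMap =
      ((TensorProduct.assoc k A X Y).toLinearMap.lTensor A ∘ₗ
        (TensorProduct.assoc k A (A ⊗[k] X) Y).toLinearMap) ∘ₗ (ρ.lTensor A).rTensor Y := by
    ext; simp
  rw [← LinearMap.comp_assoc (ρ.rTensor Y) _ (LinearMap.lTensor A _), h2, ← LinearMap.comp_assoc,
    ← LinearMap.comp_assoc, h1]
  simp only [LinearMap.comp_assoc, ← LinearMap.rTensor_comp, h]

lemma tensor_rco_coassoc (δ : E →ₗ[k] E ⊗[k] E) (ρ : Y →ₗ[k] Y ⊗[k] E)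
    (h : (TensorProduct.assoc k Y E E).toLinearMap ∘ₗ ρ.rTensor E ∘ₗ ρ = δ.lTensor Y ∘ₗ ρ) :
    (TensorProduct.assoc k (X ⊗[k] Y) E E).toLinearMap ∘ₗ
      ((TensorProduct.assoc k X Y E).symm.toLinearMap ∘ₗ ρ.lTensor X).rTensor E ∘ₗ
      ((TensorProduct.assoc k X Y E).symm.toLinearMap ∘ₗ ρ.lTensor X) =
    δ.lTensor (X ⊗[k] Y) ∘ₗ
      ((TensorProduct.assoc k X Y E).symm.toLinearMap ∘ₗ ρ.lTensor X) := by
  have h1 : δ.lTensor (X ⊗[k] Y) ∘ₗ (TensorProduct.assoc k X Y E).symm.toLinearMap =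
      (TensorProduct.assoc k X Y (E ⊗[k] E)).symm.toLinearMap ∘ₗ (δ.lTensor Y).lTensor X := by
    ext; simp
  have h2 : ((TensorProduct.assoc k (X ⊗[k] Y) E E).toLinearMap ∘ₗ
      ((TensorProduct.assoc k X Y E).symm.toLinearMap ∘ₗ ρ.lTensor X).rTensor E) ∘ₗ
      (TensorProduct.assoc k X Y E).symm.toLinearMap =
      (TensorProduct.assoc k X Y (E ⊗[k] E)).symm.toLinearMap ∘ₗ
        ((TensorProduct.assoc k Y E E).toLinearMap ∘ₗ ρ.rTensor E).lTensor X := by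
    ext x y e
    simp only [LinearMap.comp_apply, LinearEquiv.coe_coe, AlgebraTensorModule.curry_apply,
      LinearMap.restrictScalars_self, TensorProduct.curry_apply,
      TensorProduct.assoc_symm_tmul, LinearMap.rTensor_tmul, LinearMap.lTensor_tmul]
    induction ρ y using TensorProduct.induction_on with
    | zero => simp
    | tmul b c => simp
    | add b c hb hc => simp only [TensorProduct.add_tmul, TensorProduct.tmul_add, map_add, hb, hc]
  rw [← LinearMap.comp_assoc (ρ.lTensor X) _ (δ.lTensor _), h1, ← LinearMap.comp_assoc,
    ← LinearMap.comp_assoc, h2]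
  simp only [LinearMap.comp_assoc, ← LinearMap.lTensor_comp, h]

lemma tensor_lco_counit (ε : A →ₗ[k] k) (ρ : X →ₗ[k] A ⊗[k] X)
    (h : ε.rTensor X ∘ₗ ρ = TensorProduct.mk k k X 1) :
    ε.rTensor (X ⊗[k] Y) ∘ₗ ((TensorProduct.assoc k A X Y).toLinearMap ∘ₗ ρ.rTensor Y) =
      TensorProduct.mk k k (X ⊗[k] Y) 1 := by
  have h1 : ε.rTensor (X ⊗[k] Y) ∘ₗ (TensorProduct.assoc k A X Y).toLinearMap =
      (TensorProduct.assoc k k X Y).toLinearMap ∘ₗ (ε.rTensor X).rTensor Y := by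
    ext; simp
  rw [← LinearMap.comp_assoc, h1, LinearMap.comp_assoc, ← LinearMap.rTensor_comp, h]
  ext; simp

lemma tensor_rco_counit (ε : E →ₗ[k] k) (ρ : Y →ₗ[k] Y ⊗[k] E)
    (h : ε.lTensor Y ∘ₗ ρ = (TensorProduct.mk k Y k).flip 1) :
    ε.lTensor (X ⊗[k] Y) ∘ₗ
      ((TensorProduct.assoc k X Y E).symm.toLinearMap ∘ₗ ρ.lTensor X) =
      (TensorProduct.mk k (X ⊗[k] Y) k).flip 1 := by
  have h1 : ε.lTensor (X ⊗[k] Y) ∘ₗ (TensorProduct.assoc k X Y E).symm.toLinearMap =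
      (TensorProduct.assoc k X Y k).symm.toLinearMap ∘ₗ (ε.lTensor Y).lTensor X := by
    ext; simp
  rw [← LinearMap.comp_assoc, h1, LinearMap.comp_assoc, ← LinearMap.lTensor_comp, h]
  ext; simp

lemma tensor_lco_rco (ρ : X →ₗ[k] A ⊗[k] X) (σ : Y →ₗ[k] Y ⊗[k] E) :
    (TensorProduct.assoc k A (X ⊗[k] Y) E).toLinearMap ∘ₗ
      ((TensorProduct.assoc k A X Y).toLinearMap ∘ₗ ρ.rTensor Y).rTensor E ∘ₗ
      ((TensorProduct.assoc k X Y E).symm.toLinearMap ∘ₗ σ.lTensor X) =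
    ((TensorProduct.assoc k X Y E).symm.toLinearMap ∘ₗ σ.lTensor X).lTensor A ∘ₗ
      ((TensorProduct.assoc k A X Y).toLinearMap ∘ₗ ρ.rTensor Y) := by
  have h1 : ((TensorProduct.assoc k A (X ⊗[k] Y) E).toLinearMap ∘ₗ
      ((TensorProduct.assoc k A X Y).toLinearMap ∘ₗ ρ.rTensor Y).rTensor E) ∘ₗ
      (TensorProduct.assoc k X Y E).symm.toLinearMap =
      ((TensorProduct.assoc k X Y E).symm.toLinearMap.lTensor A ∘ₗ
        (TensorProduct.assoc k A X (Y ⊗[k] E)).toLinearMap) ∘ₗ ρ.rTensor (Y ⊗[k] E) := by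
    ext x y e
    simp only [LinearMap.comp_apply, LinearEquiv.coe_coe, AlgebraTensorModule.curry_apply,
      LinearMap.restrictScalars_self, TensorProduct.curry_apply, TensorProduct.assoc_symm_tmul,
      LinearMap.rTensor_tmul]
    induction ρ x using TensorProduct.induction_on with
    | zero => simp
    | tmul b c => simp
    | add b c hb hc => simp only [TensorProduct.add_tmul, map_add, hb, hc]
  have h2 : ((TensorProduct.assoc k X Y E).symm.toLinearMap ∘ₗ σ.lTensor X).lTensor A ∘ₗ
      (TensorProduct.assoc k A X Y).toLinearMap =
      ((TensorProduct.assoc k X Y E).symm.toLinearMap.lTensor A ∘ₗ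
        (TensorProduct.assoc k A X (Y ⊗[k] E)).toLinearMap) ∘ₗ σ.lTensor (A ⊗[k] X) := by
    ext; simp
  rw [← LinearMap.comp_assoc (ρ.rTensor Y) _ (LinearMap.lTensor A _), h2, ← LinearMap.comp_assoc,
    ← LinearMap.comp_assoc, h1]
  simp only [LinearMap.comp_assoc, LinearMap.rTensor_comp_lTensor,
    LinearMap.lTensor_comp_rTensor]

lemma lTensor_injective {K : Submodule k X} : Function.Injective (K.subtype.lTensor A) :=
  Module.Flat.lTensor_preserves_injective_linearMap _ K.injective_subtype

lemma rTensor_injective {K : Submodule k X} : Function.Injective (K.subtype.rTensor A) :=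
  Module.Flat.rTensor_preserves_injective_linearMap _ K.injective_subtype

/-- The corestriction of `g : K → A ⊗ X` to `A ⊗ K`. -/
def restrictL {K : Submodule k X} (g : K →ₗ[k] A ⊗[k] X)
    (h : ∀ x, g x ∈ LinearMap.range (K.subtype.lTensor A)) : K →ₗ[k] A ⊗[k] K :=
  (LinearEquiv.ofInjective _ lTensor_injective).symm.toLinearMap ∘ₗ
    g.codRestrict (LinearMap.range (K.subtype.lTensor A)) h

lemma restrictL_spec {K : Submodule k X} (g : K →ₗ[k] A ⊗[k] X)
    (h : ∀ x, g x ∈ LinearMap.range (K.subtype.lTensor A)) :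
    K.subtype.lTensor A ∘ₗ restrictL g h = g := by
  ext x
  exact congrArg Subtype.val ((LinearEquiv.ofInjective _
    (lTensor_injective (A := A) (K := K))).apply_symm_apply ⟨g x, h x⟩)

/-- The corestriction of `g : K → X ⊗ A` to `K ⊗ A`. -/
def restrictR {K : Submodule k X} (g : K →ₗ[k] X ⊗[k] A)
    (h : ∀ x, g x ∈ LinearMap.range (K.subtype.rTensor A)) : K →ₗ[k] K ⊗[k] A :=
  (LinearEquiv.ofInjective _ rTensor_injective).symm.toLinearMap ∘ₗ
    g.codRestrict (LinearMap.range (K.subtype.rTensor A)) h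

lemma restrictR_spec {K : Submodule k X} (g : K →ₗ[k] X ⊗[k] A)
    (h : ∀ x, g x ∈ LinearMap.range (K.subtype.rTensor A)) :
    K.subtype.rTensor A ∘ₗ restrictR g h = g := by
  ext x
  exact congrArg Subtype.val ((LinearEquiv.ofInjective _
    (rTensor_injective (A := A) (K := K))).apply_symm_apply ⟨g x, h x⟩)

lemma exact_eqLocus (f g : X →ₗ[k] Y) :
    Function.Exact (LinearMap.eqLocus f g).subtype (f - g) := by
  intro x
  simp [sub_eq_zero, LinearMap.mem_eqLocus]

lemma mem_range_lTensor {f g : X →ₗ[k] Y} {z : A ⊗[k] X}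
    (h : f.lTensor A z = g.lTensor A z) :
    z ∈ LinearMap.range ((LinearMap.eqLocus f g).subtype.lTensor A) := by
  refine (Module.Flat.lTensor_exact A (exact_eqLocus f g) z).1 ?_
  rw [LinearMap.lTensor_sub, LinearMap.sub_apply, h, sub_self]

lemma mem_range_rTensor {f g : X →ₗ[k] Y} {z : X ⊗[k] A}
    (h : f.rTensor A z = g.rTensor A z) :
    z ∈ LinearMap.range ((LinearMap.eqLocus f g).subtype.rTensor A) := by
  refine (Module.Flat.rTensor_exact A (exact_eqLocus f g) z).1 ?_
  rw [LinearMap.rTensor_sub, LinearMap.sub_apply, h, sub_self]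

lemma sub_lco_coassoc {K : Type*} [AddCommGroup K] [Module k K] {i : K →ₗ[k] X}
    (hi : Function.Injective i) (δ : A →ₗ[k] A ⊗[k] A) (ρ : X →ₗ[k] A ⊗[k] X)
    (σ : K →ₗ[k] A ⊗[k] K) (hs : i.lTensor A ∘ₗ σ = ρ ∘ₗ i)
    (h : (TensorProduct.assoc k A A X).toLinearMap ∘ₗ δ.rTensor X ∘ₗ ρ = ρ.lTensor A ∘ₗ ρ) :
    (TensorProduct.assoc k A A K).toLinearMap ∘ₗ δ.rTensor K ∘ₗ σ = σ.lTensor A ∘ₗ σ := by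
  have inj : Function.Injective ((i.lTensor A).lTensor A) :=
    Module.Flat.lTensor_preserves_injective_linearMap _
      (Module.Flat.lTensor_preserves_injective_linearMap _ hi)
  refine LinearMap.cancel_left inj |>.1 ?_
  have h1 : (i.lTensor A).lTensor A ∘ₗ (TensorProduct.assoc k A A K).toLinearMap =
      (TensorProduct.assoc k A A X).toLinearMap ∘ₗ i.lTensor (A ⊗[k] A) := by
    ext; simp
  rw [← LinearMap.comp_assoc, h1, LinearMap.comp_assoc, ← LinearMap.comp_assoc σ,
    LinearMap.lTensor_comp_rTensor, ← LinearMap.rTensor_comp_lTensor, LinearMap.comp_assoc, hs,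
    ← LinearMap.comp_assoc σ, ← LinearMap.lTensor_comp, hs, LinearMap.lTensor_comp,
    LinearMap.comp_assoc, hs, ← LinearMap.comp_assoc i, ← LinearMap.comp_assoc i, h]
  rfl

lemma sub_rco_coassoc {K : Type*} [AddCommGroup K] [Module k K] {i : K →ₗ[k] X}
    (hi : Function.Injective i) (δ : A →ₗ[k] A ⊗[k] A) (ρ : X →ₗ[k] X ⊗[k] A)
    (σ : K →ₗ[k] K ⊗[k] A) (hs : i.rTensor A ∘ₗ σ = ρ ∘ₗ i)
    (h : (TensorProduct.assoc k X A A).toLinearMap ∘ₗ ρ.rTensor A ∘ₗ ρ = δ.lTensor X ∘ₗ ρ) :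
    (TensorProduct.assoc k K A A).toLinearMap ∘ₗ σ.rTensor A ∘ₗ σ = δ.lTensor K ∘ₗ σ := by
  have inj : Function.Injective (i.rTensor (A ⊗[k] A)) :=
    Module.Flat.rTensor_preserves_injective_linearMap _ hi
  refine LinearMap.cancel_left inj |>.1 ?_
  have h1 : i.rTensor (A ⊗[k] A) ∘ₗ (TensorProduct.assoc k K A A).toLinearMap =
      (TensorProduct.assoc k X A A).toLinearMap ∘ₗ (i.rTensor A).rTensor A := by
    ext; simp
  rw [← LinearMap.comp_assoc, h1, LinearMap.comp_assoc, ← LinearMap.comp_assoc σ,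
    ← LinearMap.rTensor_comp, hs, LinearMap.rTensor_comp, LinearMap.comp_assoc, hs,
    ← LinearMap.comp_assoc σ, LinearMap.rTensor_comp_lTensor, ← LinearMap.lTensor_comp_rTensor,
    LinearMap.comp_assoc, hs, ← LinearMap.comp_assoc i, ← LinearMap.comp_assoc i, h]
  rfl

lemma sub_lco_counit {K : Type*} [AddCommGroup K] [Module k K] {i : K →ₗ[k] X}
    (hi : Function.Injective i) (ε : A →ₗ[k] k) (ρ : X →ₗ[k] A ⊗[k] X)
    (σ : K →ₗ[k] A ⊗[k] K) (hs : i.lTensor A ∘ₗ σ = ρ ∘ₗ i)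
    (h : ε.rTensor X ∘ₗ ρ = TensorProduct.mk k k X 1) :
    ε.rTensor K ∘ₗ σ = TensorProduct.mk k k K 1 := by
  have inj : Function.Injective (i.lTensor k) :=
    Module.Flat.lTensor_preserves_injective_linearMap _ hi
  refine LinearMap.cancel_left inj |>.1 ?_
  rw [← LinearMap.comp_assoc, LinearMap.lTensor_comp_rTensor, ← LinearMap.rTensor_comp_lTensor,
    LinearMap.comp_assoc, hs, ← LinearMap.comp_assoc, h]
  ext; simp

lemma sub_rco_counit {K : Type*} [AddCommGroup K] [Module k K] {i : K →ₗ[k] X}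
    (hi : Function.Injective i) (ε : A →ₗ[k] k) (ρ : X →ₗ[k] X ⊗[k] A)
    (σ : K →ₗ[k] K ⊗[k] A) (hs : i.rTensor A ∘ₗ σ = ρ ∘ₗ i)
    (h : ε.lTensor X ∘ₗ ρ = (TensorProduct.mk k X k).flip 1) :
    ε.lTensor K ∘ₗ σ = (TensorProduct.mk k K k).flip 1 := by
  have inj : Function.Injective (i.rTensor k) :=
    Module.Flat.rTensor_preserves_injective_linearMap _ hi
  refine LinearMap.cancel_left inj |>.1 ?_
  rw [← LinearMap.comp_assoc, LinearMap.rTensor_comp_lTensor, ← LinearMap.lTensor_comp_rTensor,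
    LinearMap.comp_assoc, hs, ← LinearMap.comp_assoc, h]
  ext; simp

lemma sub_lco_rco {K : Type*} [AddCommGroup K] [Module k K] {i : K →ₗ[k] X}
    (hi : Function.Injective i) (ρ : X →ₗ[k] A ⊗[k] X) (ρ' : X →ₗ[k] X ⊗[k] E)
    (σ : K →ₗ[k] A ⊗[k] K) (σ' : K →ₗ[k] K ⊗[k] E) (hs : i.lTensor A ∘ₗ σ = ρ ∘ₗ i)
    (hs' : i.rTensor E ∘ₗ σ' = ρ' ∘ₗ i)
    (h : (TensorProduct.assoc k A X E).toLinearMap ∘ₗ ρ.rTensor E ∘ₗ ρ' = ρ'.lTensor A ∘ₗ ρ) :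
    (TensorProduct.assoc k A K E).toLinearMap ∘ₗ σ.rTensor E ∘ₗ σ' = σ'.lTensor A ∘ₗ σ := by
  have inj : Function.Injective ((i.rTensor E).lTensor A) :=
    Module.Flat.lTensor_preserves_injective_linearMap _
      (Module.Flat.rTensor_preserves_injective_linearMap _ hi)
  refine LinearMap.cancel_left inj |>.1 ?_
  have h1 : (i.rTensor E).lTensor A ∘ₗ (TensorProduct.assoc k A K E).toLinearMap =
      (TensorProduct.assoc k A X E).toLinearMap ∘ₗ (i.lTensor A).rTensor E := by
    ext; simp
  rw [← LinearMap.comp_assoc, h1, LinearMap.comp_assoc, ← LinearMap.comp_assoc σ',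
    ← LinearMap.rTensor_comp, hs, LinearMap.rTensor_comp, LinearMap.comp_assoc, hs',
    ← LinearMap.comp_assoc σ, ← LinearMap.lTensor_comp, hs', LinearMap.lTensor_comp,
    LinearMap.comp_assoc, hs, ← LinearMap.comp_assoc i, ← LinearMap.comp_assoc i, h]
  rfl

end TensorLemmas

/-- A differential graded vector space: a vector space with an internal `ℤ`-grading
and a differential of degree `+1`. -/
structure DGVect (k : Type u) [Field k] where
  carrier : Type u
  [addCommGroup : AddCommGroup carrier]
  [module : Module k carrier]
  gr : ℤ → Submodule k carrier
  internal : DirectSum.IsInternal gr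
  d : carrier →ₗ[k] carrier
  d_mem : ∀ (n : ℤ) (x : carrier), x ∈ gr n → d x ∈ gr (n + 1)
  d_d : ∀ x : carrier, d (d x) = 0

namespace DGVect

attribute [instance] DGVect.addCommGroup DGVect.module

variable {k : Type u} [Field k]

instance : CoeSort (DGVect k) (Type u) := ⟨DGVect.carrier⟩

/-- `f` is homogeneous of degree `e`. -/
def IsGraded (M N : DGVect k) (e : ℤ) (f : M →ₗ[k] N) : Prop :=
  ∀ (n : ℤ) (x : M), x ∈ M.gr n → f x ∈ N.gr (n + e)

/-- `f` is a morphism of differential graded vector spaces. -/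
structure IsHom (M N : DGVect k) (f : M →ₗ[k] N) : Prop where
  mem : ∀ (n : ℤ) (x : M), x ∈ M.gr n → f x ∈ N.gr n
  comm : f ∘ₗ M.d = N.d ∘ₗ f

/-- The decomposition of `M` as the direct sum of its homogeneous parts. -/
def decomp (M : DGVect k) : M ≃ₗ[k] DirectSum ℤ fun n => M.gr n :=
  (LinearEquiv.ofBijective (DirectSum.coeLinearMap M.gr)
    (show Function.Bijective _ from M.internal)).symm

lemma decomp_apply (M : DGVect k) {n : ℤ} {x : M} (hx : x ∈ M.gr n) :
    M.decomp x = DirectSum.lof k ℤ (fun i => M.gr i) n ⟨x, hx⟩ := by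
  rw [decomp, LinearEquiv.symm_apply_eq]
  simp

/-- The endomorphism which is multiplication by `c n` in degree `n`. -/
def scale (M : DGVect k) (c : ℤ → k) : M →ₗ[k] M :=
  DirectSum.coeLinearMap M.gr ∘ₗ DirectSum.lmap (fun n => c n • LinearMap.id) ∘ₗ
    M.decomp.toLinearMap

lemma scale_apply (M : DGVect k) (c : ℤ → k) {n : ℤ} {x : M} (hx : x ∈ M.gr n) :
    M.scale c x = c n • x := by
  simp [scale, M.decomp_apply hx]

lemma hom_ext (M : DGVect k) {V : Type*} [AddCommMonoid V] [Module k V] {f g : M →ₗ[k] V}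
    (h : ∀ (n : ℤ) (x : M), x ∈ M.gr n → f x = g x) : f = g := by
  have : iSup M.gr ≤ LinearMap.eqLocus f g := iSup_le fun n x hx => h n x hx
  rw [M.internal.submodule_iSup_eq_top] at this
  ext x
  exact this trivial

/-- The sign involution `x ↦ (-1)^{|x|} x`. -/
def sgn (M : DGVect k) : M →ₗ[k] M := M.scale fun n => ((n.negOnePow : ℤˣ) : ℤ)

lemma sgn_apply (M : DGVect k) {n : ℤ} {x : M} (hx : x ∈ M.gr n) :
    M.sgn x = (((n.negOnePow : ℤˣ) : ℤ) : k) • x := M.scale_apply _ hx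

/-- The projection to degree `n`. -/
def proj (M : DGVect k) (n : ℤ) : M →ₗ[k] M := M.scale fun m => if m = n then 1 else 0

lemma proj_same (M : DGVect k) {n : ℤ} {x : M} (hx : x ∈ M.gr n) : M.proj n x = x := by
  simp [proj, M.scale_apply _ hx]

lemma proj_ne (M : DGVect k) {m n : ℤ} (h : m ≠ n) {x : M} (hx : x ∈ M.gr m) :
    M.proj n x = 0 := by
  simp [proj, M.scale_apply _ hx, h]

lemma proj_mem (M : DGVect k) (n : ℤ) (x : M) : M.proj n x ∈ M.gr n := by
  have : iSup M.gr ≤ (M.gr n).comap (M.proj n) := iSup_le fun m y hy => by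
    rw [Submodule.mem_comap]
    by_cases h : m = n
    · subst h; rwa [proj_same M hy]
    · rw [proj_ne M h hy]; exact zero_mem _
  rw [M.internal.submodule_iSup_eq_top] at this
  exact this trivial

lemma proj_graded {M N : DGVect k} {f : M →ₗ[k] N} (hf : ∀ n x, x ∈ M.gr n → f x ∈ N.gr n)
    (n : ℤ) (x : M) : N.proj n (f x) = f (M.proj n x) := by
  refine LinearMap.congr_fun (f := N.proj n ∘ₗ f) (g := f ∘ₗ M.proj n) (M.hom_ext ?_) x
  intro m y hy
  simp only [LinearMap.comp_apply]
  by_cases h : m = n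
  · subst h; rw [proj_same M hy, proj_same N (hf _ _ hy)]
  · rw [proj_ne M h hy, proj_ne N h (hf _ _ hy), map_zero]

lemma sgn_comp {M N : DGVect k} {e : ℤ} {f : M →ₗ[k] N} (hf : IsGraded M N e f) :
    N.sgn ∘ₗ f = (((e.negOnePow : ℤˣ) : ℤ) : k) • (f ∘ₗ M.sgn) := by
  refine M.hom_ext fun n x hx => ?_
  simp only [LinearMap.comp_apply, LinearMap.smul_apply]
  rw [sgn_apply N (hf n x hx), sgn_apply M hx, map_smul, smul_smul, Int.negOnePow_add]
  push_cast
  rw [mul_comm]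

lemma IsHom.graded {M N : DGVect k} {f : M →ₗ[k] N} (hf : IsHom M N f) : IsGraded M N 0 f :=
  fun n x hx => by rw [add_zero]; exact hf.mem n x hx

lemma IsHom.sgn {M N : DGVect k} {f : M →ₗ[k] N} (hf : IsHom M N f) :
    N.sgn ∘ₗ f = f ∘ₗ M.sgn := by
  rw [sgn_comp hf.graded]; simp

lemma sgn_d (M : DGVect k) : M.sgn ∘ₗ M.d = -(M.d ∘ₗ M.sgn) := by
  rw [sgn_comp (M := M) (N := M) (e := 1) M.d_mem]; simp

lemma sgn_sgn (M : DGVect k) : M.sgn ∘ₗ M.sgn = LinearMap.id := by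
  refine M.hom_ext fun n x hx => ?_
  simp only [LinearMap.comp_apply, LinearMap.id_apply]
  rw [sgn_apply M hx, map_smul, sgn_apply M hx, smul_smul, ← Int.cast_mul, ← Units.val_mul,
    Int.units_mul_self]
  simp

lemma sgn_mem (M : DGVect k) (n : ℤ) (x : M) (hx : x ∈ M.gr n) : M.sgn x ∈ M.gr n := by
  rw [sgn_apply M hx]; exact Submodule.smul_mem _ _ hx

lemma isInternal_of_proj {V : Type*} [AddCommGroup V] [Module k V] {A : ℤ → Submodule k V}
    (p : ℤ → V →ₗ[k] V) (hs : ∀ n, ∀ x ∈ A n, p n x = x)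
    (hn : ∀ m n, m ≠ n → ∀ x ∈ A m, p n x = 0) (ht : ∀ x, x ∈ iSup A) :
    DirectSum.IsInternal A := by
  rw [DirectSum.isInternal_submodule_iff_iSupIndep_and_iSup_eq_top]
  refine ⟨fun n => ?_, eq_top_iff.2 fun x _ => ht x⟩
  rw [Submodule.disjoint_def]
  intro x hx hx'
  have : (⨆ j, ⨆ (_ : j ≠ n), A j) ≤ LinearMap.ker (p n) :=
    iSup₂_le fun m hm y hy => hn m n hm y hy
  rw [← hs n x hx]
  exact this hx'

/-- The degree `n` part `⨁_{p+q=n} M_p ⊗ N_q` of the tensor product. -/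
def tensorGr (M N : DGVect k) (n : ℤ) : Submodule k (M ⊗[k] N) :=
  ⨆ p : ℤ, Submodule.map₂ (TensorProduct.mk k M N) (M.gr p) (N.gr (n - p))

lemma tmul_mem {M N : DGVect k} {p q n : ℤ} (h : p + q = n) {x : M} {y : N} (hx : x ∈ M.gr p)
    (hy : y ∈ N.gr q) : x ⊗ₜ[k] y ∈ tensorGr M N n := by
  obtain rfl : q = n - p := by omega
  exact Submodule.mem_iSup_of_mem p (Submodule.apply_mem_map₂ _ hx hy)

lemma tensorGr_le {M N : DGVect k} {n : ℤ} {S : Submodule k (M ⊗[k] N)}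
    (h : ∀ p q, p + q = n → ∀ x ∈ M.gr p, ∀ y ∈ N.gr q, x ⊗ₜ[k] y ∈ S) : tensorGr M N n ≤ S :=
  iSup_le fun p => Submodule.map₂_le.2 fun x hx y hy => h p (n - p) (by omega) x hx y hy

lemma tensor_ext {M N : DGVect k} {V : Type*} [AddCommMonoid V] [Module k V]
    {f g : M ⊗[k] N →ₗ[k] V}
    (h : ∀ p q, ∀ x ∈ M.gr p, ∀ y ∈ N.gr q, f (x ⊗ₜ[k] y) = g (x ⊗ₜ[k] y)) : f = g := by
  refine TensorProduct.ext (M.hom_ext fun p x hx => N.hom_ext fun q y hy => ?_)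
  exact h p q x hx y hy

lemma tensor_internal (M N : DGVect k) : DirectSum.IsInternal (tensorGr M N) := by
  let b : ℤ → M →ₗ[k] N →ₗ[k] M ⊗[k] N := fun n =>
    DirectSum.toModule k ℤ _ (fun p => ((TensorProduct.mk k M N).compl₂ (N.proj (n - p))) ∘ₗ
      (M.gr p).subtype) ∘ₗ M.decomp.toLinearMap
  have hb : ∀ n p q, ∀ x ∈ M.gr p, ∀ y ∈ N.gr q,
      b n x y = x ⊗ₜ[k] N.proj (n - p) y := by
    intro n p q x hx y hy
    simp [b, M.decomp_apply hx]
  refine isInternal_of_proj (fun n => TensorProduct.lift (b n)) ?_ ?_ ?_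
  · intro n x hx
    have : tensorGr M N n ≤ LinearMap.eqLocus (TensorProduct.lift (b n)) LinearMap.id :=
      tensorGr_le fun p q h x hx y hy => by
        obtain rfl : q = n - p := by omega
        simp [LinearMap.mem_eqLocus, hb n p _ x hx y hy, proj_same N hy]
    exact this hx
  · intro m n hmn x hx
    have : tensorGr M N m ≤ LinearMap.ker (TensorProduct.lift (b n)) :=
      tensorGr_le fun p q h x hx y hy => by
        have : q ≠ n - p := by omega
        simp [LinearMap.mem_ker, hb n p _ x hx y hy, proj_ne N this hy]
    exact this hx
  · intro x
    have key : LinearMap.range (iSup (tensorGr M N)).subtype = ⊤ := by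
      rw [Submodule.range_subtype, eq_top_iff, ← TensorProduct.map₂_mk_top_top_eq_top,
        ← M.internal.submodule_iSup_eq_top, ← N.internal.submodule_iSup_eq_top,
        Submodule.map₂_iSup_left]
      refine iSup_le fun p => ?_
      rw [Submodule.map₂_iSup_right]
      exact iSup_le fun q => Submodule.map₂_le.2 fun x hx y hy =>
        Submodule.mem_iSup_of_mem (p + q) (tmul_mem rfl hx hy)
    rw [Submodule.range_subtype] at key
    rw [key]; trivial

/-- The tensor product of differential graded vector spaces, with
`d (x ⊗ y) = d x ⊗ y + (-1)^{|x|} x ⊗ d y`. -/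
abbrev tensor (M N : DGVect k) : DGVect k where
  carrier := M ⊗[k] N
  gr := tensorGr M N
  internal := tensor_internal M N
  d := TensorProduct.map M.d LinearMap.id + TensorProduct.map M.sgn N.d
  d_mem n x hx := by
    have : tensorGr M N n ≤ (tensorGr M N (n + 1)).comap
        (TensorProduct.map M.d LinearMap.id + TensorProduct.map M.sgn N.d) :=
      tensorGr_le fun p q h x hx y hy => by
        simp only [Submodule.mem_comap, LinearMap.add_apply, TensorProduct.map_tmul]
        exact add_mem (tmul_mem (by omega) (M.d_mem p x hx) hy)
          (tmul_mem (by omega) (M.sgn_mem p x hx) (N.d_mem q y hy))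
    exact this hx
  d_d x := by
    have h : (TensorProduct.map M.d LinearMap.id + TensorProduct.map M.sgn N.d) ∘ₗ
        (TensorProduct.map M.d LinearMap.id + TensorProduct.map M.sgn N.d) = 0 := by
      ext x y
      have := LinearMap.congr_fun M.sgn_d x
      simp only [LinearMap.comp_apply, LinearMap.neg_apply] at this
      simp [M.d_d, N.d_d, this, TensorProduct.neg_tmul]
    exact LinearMap.congr_fun h x

/-- The ground field in degree zero. -/
abbrev unit (k : Type u) [Field k] : DGVect k where
  carrier := k
  gr n := if n = 0 then ⊤ else ⊥
  internal := isInternal_of_proj (fun n => if n = 0 then LinearMap.id else 0)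
    (by intro n x hx; by_cases h : n = 0 <;> simp_all)
    (by intro m n h x hx; by_cases h' : n = 0 <;> simp_all)
    (fun x => Submodule.mem_iSup_of_mem 0 (by simp))
  d := 0
  d_mem := by simp
  d_d := by simp

/-- The differential graded vector space `M[-1]`, with `M[-1]_n = M_{n+1}`. -/
abbrev shift (M : DGVect k) : DGVect k where
  carrier := M
  gr n := M.gr (n + 1)
  internal := isInternal_of_proj (fun n => M.proj (n + 1)) (fun n x hx => M.proj_same hx)
    (fun m n h x hx => M.proj_ne (by omega) hx) (fun x => by
      have h : iSup M.gr ≤ ⨆ n, M.gr (n + 1) := iSup_le fun n y hy =>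
        Submodule.mem_iSup_of_mem (n - 1) (by simpa using hy)
      rw [M.internal.submodule_iSup_eq_top] at h
      exact h trivial)
  d := -M.d
  d_mem n x hx := neg_mem (M.d_mem _ x hx)
  d_d x := by simp [M.d_d]

/-- The cone of `u : M ⟶ N`, which is `M_{n+1} ⊕ N_n` in degree `n`, with
`d (m, n) = (-d m, u m + d n)`. -/
abbrev cone (M N : DGVect k) (u : M →ₗ[k] N) (hu : IsHom M N u) : DGVect k where
  carrier := M × N
  gr n := (M.gr (n + 1)).prod (N.gr n)
  internal := isInternal_of_proj (fun n => (M.proj (n + 1)).prodMap (N.proj n))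
    (fun n x hx => Prod.ext (M.proj_same hx.1) (N.proj_same hx.2))
    (fun m n h x hx => Prod.ext (M.proj_ne (by omega) hx.1) (N.proj_ne h hx.2)) (fun x => by
      have h1 : iSup M.gr ≤ (⨆ n, (M.gr (n + 1)).prod (N.gr n)).comap
          (LinearMap.inl k M N) := iSup_le fun n y hy =>
        Submodule.mem_iSup_of_mem (n - 1) ⟨by simpa using hy, zero_mem _⟩
      have h2 : iSup N.gr ≤ (⨆ n, (M.gr (n + 1)).prod (N.gr n)).comap
          (LinearMap.inr k M N) := iSup_le fun n y hy =>
        Submodule.mem_iSup_of_mem n ⟨zero_mem _, hy⟩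
      rw [M.internal.submodule_iSup_eq_top] at h1
      rw [N.internal.submodule_iSup_eq_top] at h2
      have h1' : LinearMap.inl k M N x.1 ∈ ⨆ n, (M.gr (n + 1)).prod (N.gr n) := h1 trivial
      have h2' : LinearMap.inr k M N x.2 ∈ ⨆ n, (M.gr (n + 1)).prod (N.gr n) := h2 trivial
      simpa using add_mem h1' h2')
  d := (-(M.d ∘ₗ LinearMap.fst k M N)).prod
    (u ∘ₗ LinearMap.fst k M N + N.d ∘ₗ LinearMap.snd k M N)
  d_mem n x hx := ⟨neg_mem (M.d_mem _ _ hx.1), add_mem (hu.mem _ _ hx.1) (N.d_mem _ _ hx.2)⟩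
  d_d x := by
    have := LinearMap.congr_fun hu.comm x.1
    simp only [LinearMap.comp_apply] at this
    simp [M.d_d, N.d_d, this]

/-- The differential graded subspace on a homogeneous subspace stable under `d`. -/
abbrev sub (M : DGVect k) (K : Submodule k M) (hp : ∀ n, ∀ x ∈ K, M.proj n x ∈ K)
    (hd : ∀ x ∈ K, M.d x ∈ K) : DGVect k where
  carrier := K
  gr n := (M.gr n).comap K.subtype
  internal := isInternal_of_proj (fun n => (M.proj n).restrict (hp n))
    (fun n x hx => Subtype.ext (M.proj_same hx))
    (fun m n h x hx => Subtype.ext (M.proj_ne h hx)) (fun x => by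
      classical
      have hx : ∑ n ∈ (M.decomp x.1).support, M.proj n x.1 = x.1 := by
        have h1 : ∀ (n : ℤ) (y : DirectSum ℤ fun i => M.gr i),
            M.proj n (DirectSum.coeLinearMap M.gr y) = y n := by
          intro n y
          induction y using DirectSum.induction_on with
          | zero => simp
          | of i y =>
            rw [DirectSum.coeLinearMap_of]
            by_cases h : i = n
            · subst h; rw [proj_same M y.2, DirectSum.of_eq_same]
            · rw [proj_ne M h y.2, DirectSum.of_eq_of_ne _ _ _ (Ne.symm h)]; rfl
          | add y z hy hz => rw [map_add, map_add, hy, hz]; rfl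
        have h2 : DirectSum.coeLinearMap M.gr (M.decomp x.1) = x.1 :=
          M.decomp.symm_apply_apply x.1
        conv_rhs => rw [← h2, DirectSum.coeLinearMap_eq_dfinsuppSum]
        refine Finset.sum_congr rfl fun n _ => ?_
        conv_lhs => rw [← h2, h1]
      have hx' : ∑ n ∈ (M.decomp x.1).support, (⟨M.proj n x.1, hp n _ x.2⟩ : K) = x :=
        Subtype.ext (by simpa using hx)
      rw [← hx']
      exact Submodule.sum_mem _ fun n _ => Submodule.mem_iSup_of_mem n (M.proj_mem n x.1))
  d := M.d.restrict hd
  d_mem n x hx := M.d_mem n _ hx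
  d_d x := Subtype.ext (M.d_d _)

lemma IsHom.id (M : DGVect k) : IsHom M M LinearMap.id := ⟨fun _ _ h => h, rfl⟩

lemma IsHom.comp {M N P : DGVect k} {g : N →ₗ[k] P} {f : M →ₗ[k] N} (hg : IsHom N P g)
    (hf : IsHom M N f) : IsHom M P (g ∘ₗ f) where
  mem n x hx := hg.mem n _ (hf.mem n x hx)
  comm := by
    rw [LinearMap.comp_assoc, hf.comm, ← LinearMap.comp_assoc, hg.comm, LinearMap.comp_assoc]

lemma IsGraded.map {M N M' N' : DGVect k} {e e' : ℤ} {f : M →ₗ[k] M'} {g : N →ₗ[k] N'}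
    (hf : IsGraded M M' e f) (hg : IsGraded N N' e' g) :
    IsGraded (M.tensor N) (M'.tensor N') (e + e') (TensorProduct.map f g) := by
  intro n x hx
  have : tensorGr M N n ≤ (tensorGr M' N' (n + (e + e'))).comap (TensorProduct.map f g) :=
    tensorGr_le fun p q h x hx y hy => tmul_mem (by omega) (hf p x hx) (hg q y hy)
  exact this hx

lemma IsHom.map {M N M' N' : DGVect k} {f : M →ₗ[k] M'} {g : N →ₗ[k] N'}
    (hf : IsHom M M' f) (hg : IsHom N N' g) :
    IsHom (M.tensor N) (M'.tensor N') (TensorProduct.map f g) where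
  mem n x hx := by simpa using hf.graded.map hg.graded n x hx
  comm := by
    ext x y
    have h1 := LinearMap.congr_fun hf.comm x
    have h2 := LinearMap.congr_fun hg.comm y
    have h3 := LinearMap.congr_fun hf.sgn x
    simp only [LinearMap.comp_apply] at h1 h2 h3
    simp [h1, h2, h3]

lemma IsHom.rTensor {M M' : DGVect k} {f : M →ₗ[k] M'} (hf : IsHom M M' f) (N : DGVect k) :
    IsHom (M.tensor N) (M'.tensor N) (f.rTensor N) := hf.map (IsHom.id N)

lemma IsHom.lTensor {N N' : DGVect k} {f : N →ₗ[k] N'} (hf : IsHom N N' f) (M : DGVect k) :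
    IsHom (M.tensor N) (M.tensor N') (f.lTensor M) := (IsHom.id M).map hf

lemma sgn_tensor (M N : DGVect k) :
    (M.tensor N).sgn = TensorProduct.map M.sgn N.sgn := by
  refine tensor_ext fun p q x hx y hy => ?_
  rw [sgn_apply (M.tensor N) (n := p + q) (tmul_mem rfl hx hy), TensorProduct.map_tmul,
    sgn_apply M hx, sgn_apply N hy, TensorProduct.smul_tmul_smul, Int.negOnePow_add]
  simp

lemma isHom_assoc (M N P : DGVect k) : IsHom ((M.tensor N).tensor P) (M.tensor (N.tensor P))
    (TensorProduct.assoc k M N P).toLinearMap where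
  mem n x hx := by
    have : tensorGr (M.tensor N) P n ≤ (tensorGr M (N.tensor P) n).comap
        (TensorProduct.assoc k M N P).toLinearMap := by
      refine tensorGr_le fun p q h x hx y hy => ?_
      have : tensorGr M N p ≤ (tensorGr M (N.tensor P) n).comap
          ((TensorProduct.assoc k M N P).toLinearMap ∘ₗ
            (TensorProduct.mk k (M ⊗[k] N) P).flip y) :=
        tensorGr_le fun a b h' x hx z hz => by
          simp only [Submodule.mem_comap, LinearMap.comp_apply, LinearMap.flip_apply,
            TensorProduct.mk_apply, LinearEquiv.coe_coe, TensorProduct.assoc_tmul]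
          exact tmul_mem (q := b + q) (by omega) hx (tmul_mem rfl hz hy)
      exact this hx
    exact this hx
  comm := by
    ext x y z
    simp [sgn_tensor, TensorProduct.add_tmul, TensorProduct.tmul_add, add_assoc]

lemma IsHom.symm {M N : DGVect k} (e : M ≃ₗ[k] N) (he : IsHom M N e.toLinearMap) :
    IsHom N M e.symm.toLinearMap where
  mem n x hx := by
    have h1 : M.proj n (e.symm x) = e.symm x := by
      apply e.injective
      have := proj_graded he.mem n (e.symm x)
      simp only [LinearEquiv.coe_coe, LinearEquiv.apply_symm_apply] at this
      rw [← this, LinearEquiv.apply_symm_apply, proj_same N hx]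
    show e.symm x ∈ M.gr n
    rw [← h1]
    exact M.proj_mem n _
  comm := by
    ext x
    apply e.injective
    have := LinearMap.congr_fun he.comm (e.symm x)
    simp only [LinearMap.comp_apply, LinearEquiv.coe_coe, LinearEquiv.apply_symm_apply] at this ⊢
    exact this.symm

lemma isHom_sub (M : DGVect k) (K : Submodule k M) (hp : ∀ n, ∀ x ∈ K, M.proj n x ∈ K)
    (hd : ∀ x ∈ K, M.d x ∈ K) : IsHom (M.sub K hp hd) M K.subtype where
  mem _ _ hx := hx
  comm := rfl

lemma IsHom.of_comp {M N P : DGVect k} {i : N →ₗ[k] P} {f : M →ₗ[k] N} (hi : IsHom N P i)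
    (inj : Function.Injective i) (h : IsHom M P (i ∘ₗ f)) : IsHom M N f where
  mem n x hx := by
    have h1 : N.proj n (f x) = f x := inj (by
      rw [← proj_graded hi.mem]
      exact proj_same P (h.mem n x hx))
    rw [← h1]
    exact N.proj_mem n _
  comm := by
    refine (LinearMap.cancel_left inj).1 ?_
    rw [← LinearMap.comp_assoc, h.comm, ← LinearMap.comp_assoc, ← hi.comm]
    rfl

/-- The cohomology `ker d / im d` of a differential graded vector space (all degrees together). -/
abbrev homology (M : DGVect k) : Type u :=
  LinearMap.ker M.d ⧸ (LinearMap.range M.d).comap (LinearMap.ker M.d).subtype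

/-- The map induced on cohomology. -/
def homologyMap {M N : DGVect k} {f : M →ₗ[k] N} (hf : IsHom M N f) :
    M.homology →ₗ[k] N.homology :=
  Submodule.mapQ _ _
    (f.restrict (p := LinearMap.ker M.d) (q := LinearMap.ker N.d) fun x hx => by
      have := LinearMap.congr_fun hf.comm x
      simp only [LinearMap.comp_apply] at this
      rw [LinearMap.mem_ker] at hx ⊢
      rw [← this, hx, map_zero])
    (by
      rintro x ⟨y, hy⟩
      refine ⟨f y, ?_⟩
      have := LinearMap.congr_fun hf.comm y
      simp only [LinearMap.comp_apply] at this
      rw [← this, hy]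
      rfl)

/-- `f` induces an isomorphism on cohomology. -/
def IsQuasiIso {M N : DGVect k} {f : M →ₗ[k] N} (hf : IsHom M N f) : Prop :=
  Function.Bijective (homologyMap hf)

/-- `M` is positively graded: `M_n = 0` for `n < 0`. -/
def IsPositive (M : DGVect k) : Prop := ∀ n : ℤ, n < 0 → M.gr n = ⊥

/-- `M` is left bounded: `M_n = 0` for `n ≪ 0`. -/
def IsBoundedBelow (M : DGVect k) : Prop := ∃ a : ℤ, ∀ n : ℤ, n < a → M.gr n = ⊥

end DGVect

/-- A differential graded coalgebra: a coalgebra whose comultiplication and counit are morphisms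
of differential graded vector spaces. -/
structure DGCoalg (k : Type u) [Field k] extends DGVect k where
  [coalgebra : Coalgebra k carrier]
  comul_hom : DGVect.IsHom toDGVect (toDGVect.tensor toDGVect) (Coalgebra.comul (R := k))
  counit_hom : DGVect.IsHom toDGVect (DGVect.unit k) (Coalgebra.counit (R := k))

attribute [instance] DGCoalg.coalgebra

/-- A morphism of differential graded coalgebras. -/
structure DGCoalg.Hom {k : Type u} [Field k] (C D : DGCoalg k) where
  toHom : C.carrier →ₗc[k] D.carrier
  isHom : DGVect.IsHom C.toDGVect D.toDGVect toHom.toLinearMap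

/-- A quasi-isomorphism of differential graded coalgebras. -/
def DGCoalg.Hom.IsQuasiIso {k : Type u} [Field k] {C D : DGCoalg k} (f : C.Hom D) : Prop :=
  DGVect.IsQuasiIso f.isHom

/-- The ground field as a differential graded coalgebra concentrated in degree zero. -/
def DGCoalg.unit (k : Type u) [Field k] : DGCoalg k where
  toDGVect := DGVect.unit k
  coalgebra := inferInstanceAs (Coalgebra k k)
  comul_hom :=
    { mem := fun n x hx => by
        have hx : x ∈ (if n = 0 then ⊤ else ⊥ : Submodule k k) := hx
        by_cases h : n = 0
        · subst h
          exact DGVect.tmul_mem (M := DGVect.unit k) (N := DGVect.unit k) (p := 0) (q := 0)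
            (x := (1 : k)) (y := x) rfl (by simp) (by simp)
        · rw [if_neg h, Submodule.mem_bot] at hx
          rw [hx, map_zero]; exact zero_mem _
      comm := by ext; simp }
  counit_hom := ⟨fun n x hx => hx, rfl⟩

/-- A differential graded `A`-`B`-bicomodule, that is, an object of `Chain(A ⊗ B^op)`. -/
structure Bicomod {k : Type u} [Field k] (A B : DGCoalg k) extends DGVect k where
  lco : carrier →ₗ[k] A.carrier ⊗[k] carrier
  rco : carrier →ₗ[k] carrier ⊗[k] B.carrier
  lco_hom : DGVect.IsHom toDGVect (A.toDGVect.tensor toDGVect) lco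
  rco_hom : DGVect.IsHom toDGVect (toDGVect.tensor B.toDGVect) rco
  lco_coassoc : (TensorProduct.assoc k A.carrier A.carrier carrier).toLinearMap ∘ₗ
    (Coalgebra.comul (R := k) (A := A.carrier)).rTensor carrier ∘ₗ lco =
      lco.lTensor A.carrier ∘ₗ lco
  rco_coassoc : (TensorProduct.assoc k carrier B.carrier B.carrier).toLinearMap ∘ₗ
    rco.rTensor B.carrier ∘ₗ rco =
      (Coalgebra.comul (R := k) (A := B.carrier)).lTensor carrier ∘ₗ rco
  lco_counit : (Coalgebra.counit (R := k) (A := A.carrier)).rTensor carrier ∘ₗ lco =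
    TensorProduct.mk k k carrier 1
  rco_counit : (Coalgebra.counit (R := k) (A := B.carrier)).lTensor carrier ∘ₗ rco =
    (TensorProduct.mk k carrier k).flip 1
  lco_rco : (TensorProduct.assoc k A.carrier carrier B.carrier).toLinearMap ∘ₗ
    lco.rTensor B.carrier ∘ₗ rco = rco.lTensor A.carrier ∘ₗ lco

namespace Bicomod

variable {k : Type u} [Field k] {A B E : DGCoalg k}

/-- Morphisms of differential graded bicomodules: bicolinear maps of degree zero which commute
with the differentials. -/
@[ext]
structure Hom (M N : Bicomod A B) where
  toLin : M.carrier →ₗ[k] N.carrier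
  isHom : DGVect.IsHom M.toDGVect N.toDGVect toLin
  lco_comp : N.lco ∘ₗ toLin = toLin.lTensor A.carrier ∘ₗ M.lco
  rco_comp : N.rco ∘ₗ toLin = toLin.rTensor B.carrier ∘ₗ M.rco

instance : Category (Bicomod A B) where
  Hom := Hom
  id M := ⟨LinearMap.id, DGVect.IsHom.id _, by simp, by simp⟩
  comp f g := ⟨g.toLin ∘ₗ f.toLin, g.isHom.comp f.isHom,
    by rw [← LinearMap.comp_assoc, g.lco_comp, LinearMap.comp_assoc, f.lco_comp,
      LinearMap.lTensor_comp, LinearMap.comp_assoc],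
    by rw [← LinearMap.comp_assoc, g.rco_comp, LinearMap.comp_assoc, f.rco_comp,
      LinearMap.rTensor_comp, LinearMap.comp_assoc]⟩

@[ext]
lemma hom_ext {M N : Bicomod A B} {f g : M ⟶ N} (h : f.toLin = g.toLin) : f = g := Hom.ext h

@[simp]
lemma id_toLin (M : Bicomod A B) : Hom.toLin (𝟙 M) = LinearMap.id := rfl

@[simp]
lemma comp_toLin {M N P : Bicomod A B} (f : M ⟶ N) (g : N ⟶ P) :
    (f ≫ g).toLin = g.toLin ∘ₗ f.toLin := rfl

end Bicomod

/-- A differential graded coalgebra as a bicomodule over itself. -/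
def DGCoalg.reg {k : Type u} [Field k] (C : DGCoalg k) : Bicomod C C where
  toDGVect := C.toDGVect
  lco := Coalgebra.comul
  rco := Coalgebra.comul
  lco_hom := C.comul_hom
  rco_hom := C.comul_hom
  lco_coassoc := Coalgebra.coassoc
  rco_coassoc := Coalgebra.coassoc
  lco_counit := Coalgebra.rTensor_counit_comp_comul
  rco_counit := Coalgebra.lTensor_counit_comp_comul
  lco_rco := Coalgebra.coassoc

namespace Bicomod

variable {k : Type u} [Field k] {A B E : DGCoalg k}

/-- The `D`-`B`-bicomodule obtained from a `C`-`B`-bicomodule by corestriction along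
`f : C → D` of the left coaction. -/
def corestrictLeft {C D : DGCoalg k} (f : C.Hom D) (M : Bicomod C B) : Bicomod D B where
  toDGVect := M.toDGVect
  lco := f.toHom.toLinearMap.rTensor M.carrier ∘ₗ M.lco
  rco := M.rco
  lco_hom := (f.isHom.rTensor M.toDGVect).comp M.lco_hom
  rco_hom := M.rco_hom
  lco_coassoc := by
    have h := f.toHom.map_comp_comul
    have h1 : (Coalgebra.comul (R := k) (A := D.carrier)).rTensor M.carrier ∘ₗ
        f.toHom.toLinearMap.rTensor M.carrier =
        (TensorProduct.map f.toHom.toLinearMap f.toHom.toLinearMap).rTensor M.carrier ∘ₗ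
          (Coalgebra.comul (R := k) (A := C.carrier)).rTensor M.carrier := by
      rw [← LinearMap.rTensor_comp, ← LinearMap.rTensor_comp, h]
    have h2 : (TensorProduct.assoc k D.carrier D.carrier M.carrier).toLinearMap ∘ₗ
        (TensorProduct.map f.toHom.toLinearMap f.toHom.toLinearMap).rTensor M.carrier =
        TensorProduct.map f.toHom.toLinearMap (f.toHom.toLinearMap.rTensor M.carrier) ∘ₗ
          (TensorProduct.assoc k C.carrier C.carrier M.carrier).toLinearMap := by
      ext; simp
    rw [← LinearMap.comp_assoc (h := Coalgebra.comul.rTensor _), h1, LinearMap.comp_assoc,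
      ← LinearMap.comp_assoc, h2, LinearMap.comp_assoc, M.lco_coassoc,
      ← LinearMap.comp_assoc, ← LinearMap.comp_assoc]
    congr 1
    ext; simp
  rco_coassoc := M.rco_coassoc
  lco_counit := by
    rw [← LinearMap.comp_assoc, ← LinearMap.rTensor_comp, f.toHom.counit_comp]
    exact M.lco_counit
  rco_counit := M.rco_counit
  lco_rco := by
    have h2 : (TensorProduct.assoc k D.carrier M.carrier B.carrier).toLinearMap ∘ₗ
        (f.toHom.toLinearMap.rTensor M.carrier).rTensor B.carrier =
        f.toHom.toLinearMap.rTensor (M.carrier ⊗[k] B.carrier) ∘ₗ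
          (TensorProduct.assoc k C.carrier M.carrier B.carrier).toLinearMap := by
      ext; simp
    rw [LinearMap.rTensor_comp, LinearMap.comp_assoc, ← LinearMap.comp_assoc, h2,
      LinearMap.comp_assoc, M.lco_rco, ← LinearMap.comp_assoc, ← LinearMap.comp_assoc,
      LinearMap.rTensor_comp_lTensor, LinearMap.lTensor_comp_rTensor]

/-- The `A`-`D`-bicomodule obtained from an `A`-`C`-bicomodule by corestriction along
`f : C → D` of the right coaction. -/
def corestrictRight {C D : DGCoalg k} (f : C.Hom D) (M : Bicomod A C) : Bicomod A D where
  toDGVect := M.toDGVect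
  lco := M.lco
  rco := f.toHom.toLinearMap.lTensor M.carrier ∘ₗ M.rco
  lco_hom := M.lco_hom
  rco_hom := (f.isHom.lTensor M.toDGVect).comp M.rco_hom
  lco_coassoc := M.lco_coassoc
  rco_coassoc := by
    have h := f.toHom.map_comp_comul
    have h1 : (Coalgebra.comul (R := k) (A := D.carrier)).lTensor M.carrier ∘ₗ
        f.toHom.toLinearMap.lTensor M.carrier =
        (TensorProduct.map f.toHom.toLinearMap f.toHom.toLinearMap).lTensor M.carrier ∘ₗ
          (Coalgebra.comul (R := k) (A := C.carrier)).lTensor M.carrier := by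
      rw [← LinearMap.lTensor_comp, ← LinearMap.lTensor_comp, h]
    rw [← LinearMap.comp_assoc (h := Coalgebra.comul.lTensor _), h1, LinearMap.comp_assoc,
      ← M.rco_coassoc, ← LinearMap.comp_assoc, ← LinearMap.comp_assoc, ← LinearMap.comp_assoc,
      ← LinearMap.comp_assoc]
    congr 1
    rw [LinearMap.rTensor_comp]
    simp only [LinearMap.comp_assoc]
    rw [LinearMap.rTensor_comp_lTensor, ← LinearMap.lTensor_comp_rTensor]
    simp only [← LinearMap.comp_assoc]
    congr 1
    ext; simp
  lco_counit := M.lco_counit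
  rco_counit := by
    rw [← LinearMap.comp_assoc, ← LinearMap.lTensor_comp, f.toHom.counit_comp]
    exact M.rco_counit
  lco_rco := by
    rw [LinearMap.lTensor_comp, LinearMap.comp_assoc, ← M.lco_rco, ← LinearMap.comp_assoc,
      ← LinearMap.comp_assoc, ← LinearMap.comp_assoc, ← LinearMap.comp_assoc]
    congr 1
    simp only [LinearMap.comp_assoc]
    rw [LinearMap.rTensor_comp_lTensor, ← LinearMap.lTensor_comp_rTensor]
    simp only [← LinearMap.comp_assoc]
    congr 1
    ext; simp

/-- The `A`-`E`-bicomodule `X ⊗ Y`, for an `A`-`B`-bicomodule `X` and a `B'`-`E`-bicomodule `Y`. -/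
def tensor {B' : DGCoalg k} (X : Bicomod A B) (Y : Bicomod B' E) : Bicomod A E where
  toDGVect := X.toDGVect.tensor Y.toDGVect
  lco := (TensorProduct.assoc k A.carrier X.carrier Y.carrier).toLinearMap ∘ₗ
    X.lco.rTensor Y.carrier
  rco := (TensorProduct.assoc k X.carrier Y.carrier E.carrier).symm.toLinearMap ∘ₗ
    Y.rco.lTensor X.carrier
  lco_hom := (DGVect.isHom_assoc _ _ _).comp (X.lco_hom.rTensor Y.toDGVect)
  rco_hom := (DGVect.IsHom.symm _ (DGVect.isHom_assoc _ _ _)).comp (Y.rco_hom.lTensor X.toDGVect)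
  lco_coassoc := tensor_lco_coassoc _ _ X.lco_coassoc
  rco_coassoc := tensor_rco_coassoc _ _ Y.rco_coassoc
  lco_counit := tensor_lco_counit _ _ X.lco_counit
  rco_counit := tensor_rco_counit _ _ Y.rco_counit
  lco_rco := tensor_lco_rco _ _

/-- The subspace on which two morphisms of bicomodules agree, as a bicomodule. -/
def equalizer {P Q : Bicomod A E} (f g : P ⟶ Q) : Bicomod A E where
  toDGVect := P.toDGVect.sub (LinearMap.eqLocus f.toLin g.toLin)
    (fun n x hx => by
      rw [LinearMap.mem_eqLocus] at hx ⊢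
      rw [← DGVect.proj_graded f.isHom.mem, ← DGVect.proj_graded g.isHom.mem, hx])
    (fun x hx => by
      rw [LinearMap.mem_eqLocus] at hx ⊢
      have h1 := LinearMap.congr_fun f.isHom.comm x
      have h2 := LinearMap.congr_fun g.isHom.comm x
      simp only [LinearMap.comp_apply] at h1 h2
      rw [h1, h2, hx])
  lco := restrictL (P.lco ∘ₗ (LinearMap.eqLocus f.toLin g.toLin).subtype) fun x =>
    mem_range_lTensor (by
      have h1 := LinearMap.congr_fun f.lco_comp x
      have h2 := LinearMap.congr_fun g.lco_comp x
      simp only [LinearMap.comp_apply] at h1 h2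
      have hx : f.toLin x = g.toLin x := x.2
      rw [LinearMap.comp_apply, Submodule.subtype_apply, ← h1, ← h2, hx])
  rco := restrictR (P.rco ∘ₗ (LinearMap.eqLocus f.toLin g.toLin).subtype) fun x =>
    mem_range_rTensor (by
      have h1 := LinearMap.congr_fun f.rco_comp x
      have h2 := LinearMap.congr_fun g.rco_comp x
      simp only [LinearMap.comp_apply] at h1 h2
      have hx : f.toLin x = g.toLin x := x.2
      rw [LinearMap.comp_apply, Submodule.subtype_apply, ← h1, ← h2, hx])
  lco_hom := by
    refine DGVect.IsHom.of_comp ((DGVect.isHom_sub P.toDGVect _ _ _).lTensor A.toDGVect)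
      lTensor_injective ?_
    erw [restrictL_spec]
    exact P.lco_hom.comp (DGVect.isHom_sub P.toDGVect _ _ _)
  rco_hom := by
    refine DGVect.IsHom.of_comp ((DGVect.isHom_sub P.toDGVect _ _ _).rTensor E.toDGVect)
      rTensor_injective ?_
    erw [restrictR_spec]
    exact P.rco_hom.comp (DGVect.isHom_sub P.toDGVect _ _ _)
  lco_coassoc := sub_lco_coassoc (Submodule.injective_subtype _) _ _ _ (restrictL_spec _ _)
    P.lco_coassoc
  rco_coassoc := sub_rco_coassoc (Submodule.injective_subtype _) _ _ _ (restrictR_spec _ _)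
    P.rco_coassoc
  lco_counit := sub_lco_counit (Submodule.injective_subtype _) _ _ _ (restrictL_spec _ _)
    P.lco_counit
  rco_counit := sub_rco_counit (Submodule.injective_subtype _) _ _ _ (restrictR_spec _ _)
    P.rco_counit
  lco_rco := sub_lco_rco (Submodule.injective_subtype _) _ _ _ _ (restrictL_spec _ _)
    (restrictR_spec _ _) P.lco_rco

end Bicomod

section TensorLemmas

variable {k : Type*} [Field k] {A X Y B E : Type*} [AddCommGroup A] [Module k A] [AddCommGroup X]
  [Module k X] [AddCommGroup Y] [Module k Y] [AddCommGroup E] [Module k E] [AddCommGroup B]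
  [Module k B]

lemma comp_id_eq_map_id {P Q : Type*} [AddCommGroup P] [Module k P] [AddCommGroup Q]
    [Module k Q] (σ : X →ₗ[k] P ⊗[k] Q) :
    σ ∘ₗ LinearMap.id = TensorProduct.map LinearMap.id LinearMap.id ∘ₗ σ := by
  simp

lemma map_assoc_rTensor {P Q Y' : Type*} [AddCommGroup P] [Module k P] [AddCommGroup Q]
    [Module k Q] [AddCommGroup Y'] [Module k Y'] {σ : X →ₗ[k] P ⊗[k] Q} {s : X →ₗ[k] X}
    {p : P →ₗ[k] P} {q : Q →ₗ[k] Q} (g : Y →ₗ[k] Y') (h : σ ∘ₗ s = TensorProduct.map p q ∘ₗ σ) :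
    ((TensorProduct.assoc k P Q Y').toLinearMap ∘ₗ σ.rTensor Y') ∘ₗ TensorProduct.map s g =
      TensorProduct.map p (TensorProduct.map q g) ∘ₗ
        ((TensorProduct.assoc k P Q Y).toLinearMap ∘ₗ σ.rTensor Y) := by
  have h1 : TensorProduct.map p (TensorProduct.map q g) ∘ₗ
      (TensorProduct.assoc k P Q Y).toLinearMap =
      (TensorProduct.assoc k P Q Y').toLinearMap ∘ₗ TensorProduct.map (TensorProduct.map p q) g := by
    ext; simp
  rw [← LinearMap.comp_assoc, h1, LinearMap.comp_assoc, LinearMap.comp_assoc]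
  congr 1
  have h' : ∀ x, σ (s x) = TensorProduct.map p q (σ x) := LinearMap.congr_fun h
  ext; simp [h']

lemma map_lTensor {Y' : Type*} [AddCommGroup Y'] [Module k Y'] {ρ : Y →ₗ[k] B ⊗[k] Y}
    {ρ' : Y' →ₗ[k] B ⊗[k] Y'} {t : B →ₗ[k] B} {g : Y →ₗ[k] Y'} (s : X →ₗ[k] X)
    (h : ρ' ∘ₗ g = TensorProduct.map t g ∘ₗ ρ) :
    ρ'.lTensor X ∘ₗ TensorProduct.map s g =
      TensorProduct.map s (TensorProduct.map t g) ∘ₗ ρ.lTensor X := by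
  have h' : ∀ x, ρ' (g x) = TensorProduct.map t g (ρ x) := LinearMap.congr_fun h
  ext; simp [h']

lemma map_assoc_lTensor {Y' : Type*} [AddCommGroup Y'] [Module k Y'] {σ : Y →ₗ[k] Y ⊗[k] E}
    {τ : Y' →ₗ[k] Y' ⊗[k] E} {g : Y →ₗ[k] Y'} (s : X →ₗ[k] X)
    (h : τ ∘ₗ g = g.rTensor E ∘ₗ σ) :
    ((TensorProduct.assoc k X Y' E).symm.toLinearMap ∘ₗ τ.lTensor X) ∘ₗ TensorProduct.map s g =
      (TensorProduct.map s g).rTensor E ∘ₗ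
        ((TensorProduct.assoc k X Y E).symm.toLinearMap ∘ₗ σ.lTensor X) := by
  have h1 : (TensorProduct.map s g).rTensor E ∘ₗ (TensorProduct.assoc k X Y E).symm.toLinearMap =
      (TensorProduct.assoc k X Y' E).symm.toLinearMap ∘ₗ
        TensorProduct.map s (g.rTensor E) := by
    ext; simp
  rw [← LinearMap.comp_assoc _ _ (LinearMap.rTensor E _), h1, LinearMap.comp_assoc,
    LinearMap.comp_assoc]
  congr 1
  have h' : ∀ x, τ (g x) = g.rTensor E (σ x) := LinearMap.congr_fun h
  ext; simp [h']

lemma cotensor_aux₁ (ρ : X →ₗ[k] A ⊗[k] X) (σ : X →ₗ[k] X ⊗[k] B)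
    (h : (TensorProduct.assoc k A X B).toLinearMap ∘ₗ ρ.rTensor B ∘ₗ σ = σ.lTensor A ∘ₗ ρ) :
    ((TensorProduct.assoc k A X (B ⊗[k] Y)).toLinearMap ∘ₗ ρ.rTensor (B ⊗[k] Y)) ∘ₗ
      ((TensorProduct.assoc k X B Y).toLinearMap ∘ₗ σ.rTensor Y) =
    ((TensorProduct.assoc k X B Y).toLinearMap ∘ₗ σ.rTensor Y).lTensor A ∘ₗ
      ((TensorProduct.assoc k A X Y).toLinearMap ∘ₗ ρ.rTensor Y) := by
  have h1 : ((TensorProduct.assoc k A X (B ⊗[k] Y)).toLinearMap ∘ₗ ρ.rTensor (B ⊗[k] Y)) ∘ₗ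
      (TensorProduct.assoc k X B Y).toLinearMap =
      ((TensorProduct.assoc k X B Y).toLinearMap.lTensor A ∘ₗ
        (TensorProduct.assoc k A (X ⊗[k] B) Y).toLinearMap) ∘ₗ
        ((TensorProduct.assoc k A X B).toLinearMap ∘ₗ ρ.rTensor B).rTensor Y := by
    refine TensorProduct.ext_threefold fun x b y => ?_
    simp only [LinearMap.comp_apply, LinearEquiv.coe_coe, TensorProduct.assoc_tmul,
      LinearMap.rTensor_tmul]
    induction ρ x using TensorProduct.induction_on with
    | zero => simp
    | tmul b c => simp
    | add b c hb hc => simp only [TensorProduct.add_tmul, map_add, hb, hc]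
  have h2 : ((TensorProduct.assoc k X B Y).toLinearMap ∘ₗ σ.rTensor Y).lTensor A ∘ₗ
      (TensorProduct.assoc k A X Y).toLinearMap =
      ((TensorProduct.assoc k X B Y).toLinearMap.lTensor A ∘ₗ
        (TensorProduct.assoc k A (X ⊗[k] B) Y).toLinearMap) ∘ₗ (σ.lTensor A).rTensor Y := by
    ext; simp
  rw [← LinearMap.comp_assoc (ρ.rTensor Y) _ (LinearMap.lTensor A _), h2, ← LinearMap.comp_assoc,
    h1]
  simp only [LinearMap.comp_assoc, ← LinearMap.rTensor_comp, h]

lemma cotensor_aux₂ (σ : X →ₗ[k] X ⊗[k] B) (τ : Y →ₗ[k] Y ⊗[k] E) :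
    ((TensorProduct.assoc k X (B ⊗[k] Y) E).symm.toLinearMap ∘ₗ
      ((TensorProduct.assoc k B Y E).symm.toLinearMap ∘ₗ τ.lTensor B).lTensor X) ∘ₗ
      ((TensorProduct.assoc k X B Y).toLinearMap ∘ₗ σ.rTensor Y) =
    ((TensorProduct.assoc k X B Y).toLinearMap ∘ₗ σ.rTensor Y).rTensor E ∘ₗ
      ((TensorProduct.assoc k X Y E).symm.toLinearMap ∘ₗ τ.lTensor X) := by
  have h1 : ((TensorProduct.assoc k X (B ⊗[k] Y) E).symm.toLinearMap ∘ₗ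
      ((TensorProduct.assoc k B Y E).symm.toLinearMap ∘ₗ τ.lTensor B).lTensor X) ∘ₗ
      (TensorProduct.assoc k X B Y).toLinearMap =
      ((TensorProduct.assoc k X B Y).toLinearMap.rTensor E ∘ₗ
        (TensorProduct.assoc k (X ⊗[k] B) Y E).symm.toLinearMap) ∘ₗ τ.lTensor (X ⊗[k] B) := by
    refine TensorProduct.ext_threefold fun x b y => ?_
    simp only [LinearMap.comp_apply, LinearEquiv.coe_coe, TensorProduct.assoc_tmul,
      LinearMap.lTensor_tmul]
    induction τ y using TensorProduct.induction_on with
    | zero => simp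
    | tmul b c => simp
    | add b c hb hc => simp only [TensorProduct.tmul_add, map_add, hb, hc]
  have h2 : ((TensorProduct.assoc k X B Y).toLinearMap ∘ₗ σ.rTensor Y).rTensor E ∘ₗ
      (TensorProduct.assoc k X Y E).symm.toLinearMap =
      ((TensorProduct.assoc k X B Y).toLinearMap.rTensor E ∘ₗ
        (TensorProduct.assoc k (X ⊗[k] B) Y E).symm.toLinearMap) ∘ₗ σ.rTensor (Y ⊗[k] E) := by
    ext; simp
  rw [← LinearMap.comp_assoc (τ.lTensor X) _ (LinearMap.rTensor E _), h2, ← LinearMap.comp_assoc,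
    h1]
  simp only [LinearMap.comp_assoc, LinearMap.rTensor_comp_lTensor,
    LinearMap.lTensor_comp_rTensor]

lemma cotensor_aux₃ (ρ : Y →ₗ[k] B ⊗[k] Y) (τ : Y →ₗ[k] Y ⊗[k] E)
    (h : (TensorProduct.assoc k B Y E).toLinearMap ∘ₗ ρ.rTensor E ∘ₗ τ = τ.lTensor B ∘ₗ ρ) :
    ((TensorProduct.assoc k B Y E).symm.toLinearMap ∘ₗ τ.lTensor B) ∘ₗ ρ = ρ.rTensor E ∘ₗ τ := by
  rw [LinearMap.comp_assoc, ← h]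
  ext; simp

lemma sub_colinear_left {K K' X' : Type*} [AddCommGroup K] [Module k K] [AddCommGroup K']
    [Module k K'] [AddCommGroup X'] [Module k X'] {i : K →ₗ[k] X} {i' : K' →ₗ[k] X'}
    (inj : Function.Injective i') {s : A →ₗ[k] A} {g : X →ₗ[k] X'} {h : K →ₗ[k] K'}
    (e : i' ∘ₗ h = g ∘ₗ i) {ρ : X →ₗ[k] A ⊗[k] X} {ρ' : X' →ₗ[k] A ⊗[k] X'}
    {σ : K →ₗ[k] A ⊗[k] K} {σ' : K' →ₗ[k] A ⊗[k] K'} (hs : ρ ∘ₗ i = i.lTensor A ∘ₗ σ)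
    (hs' : ρ' ∘ₗ i' = i'.lTensor A ∘ₗ σ') (hg : ρ' ∘ₗ g = TensorProduct.map s g ∘ₗ ρ) :
    σ' ∘ₗ h = TensorProduct.map s h ∘ₗ σ := by
  refine (LinearMap.cancel_left
    (Module.Flat.lTensor_preserves_injective_linearMap (M := A) i' inj)).1 ?_
  rw [← LinearMap.comp_assoc, ← hs', LinearMap.comp_assoc, e, ← LinearMap.comp_assoc, hg,
    LinearMap.comp_assoc, hs, ← LinearMap.comp_assoc, ← LinearMap.comp_assoc]
  congr 1
  have e' : ∀ x, i' (h x) = g (i x) := LinearMap.congr_fun e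
  ext; simp [e']

lemma sub_colinear_right {K K' X' : Type*} [AddCommGroup K] [Module k K] [AddCommGroup K']
    [Module k K'] [AddCommGroup X'] [Module k X'] {i : K →ₗ[k] X} {i' : K' →ₗ[k] X'}
    (inj : Function.Injective i') {g : X →ₗ[k] X'} {h : K →ₗ[k] K'}
    (e : i' ∘ₗ h = g ∘ₗ i) {ρ : X →ₗ[k] X ⊗[k] A} {ρ' : X' →ₗ[k] X' ⊗[k] A}
    {σ : K →ₗ[k] K ⊗[k] A} {σ' : K' →ₗ[k] K' ⊗[k] A} (hs : ρ ∘ₗ i = i.rTensor A ∘ₗ σ)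
    (hs' : ρ' ∘ₗ i' = i'.rTensor A ∘ₗ σ') (hg : ρ' ∘ₗ g = g.rTensor A ∘ₗ ρ) :
    σ' ∘ₗ h = h.rTensor A ∘ₗ σ := by
  refine (LinearMap.cancel_left
    (Module.Flat.rTensor_preserves_injective_linearMap (M := A) i' inj)).1 ?_
  rw [← LinearMap.comp_assoc, ← hs', LinearMap.comp_assoc, e, ← LinearMap.comp_assoc, hg,
    LinearMap.comp_assoc, hs, ← LinearMap.comp_assoc, ← LinearMap.comp_assoc,
    ← LinearMap.rTensor_comp, ← LinearMap.rTensor_comp, e]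

end TensorLemmas

namespace Bicomod

variable {k : Type u} [Field k] {A B E : DGCoalg k}

/-- The map `X ⊗ Y → X ⊗ B ⊗ Y` given by the right coaction of `X`. -/
def cotensorLeft (X : Bicomod A B) (Y : Bicomod B E) :
    X.tensor Y ⟶ X.tensor (B.reg.tensor Y) where
  toLin := (TensorProduct.assoc k X.carrier B.carrier Y.carrier).toLinearMap ∘ₗ
    X.rco.rTensor Y.carrier
  isHom := (DGVect.isHom_assoc _ _ _).comp (X.rco_hom.rTensor Y.toDGVect)
  lco_comp := cotensor_aux₁ X.lco X.rco X.lco_rco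
  rco_comp := cotensor_aux₂ X.rco Y.rco

/-- `X ⊗ g`. -/
def tensorMap {B' : DGCoalg k} (X : Bicomod A B) {Y Y' : Bicomod B' E} (g : Y ⟶ Y') :
    X.tensor Y ⟶ X.tensor Y' where
  toLin := g.toLin.lTensor X.carrier
  isHom := g.isHom.lTensor X.toDGVect
  lco_comp := map_assoc_rTensor _ (comp_id_eq_map_id _)
  rco_comp := map_assoc_lTensor LinearMap.id g.rco_comp

/-- The map `X ⊗ Y → X ⊗ B ⊗ Y` given by the left coaction of `Y`. -/
def cotensorRight (X : Bicomod A B) (Y : Bicomod B E) :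
    X.tensor Y ⟶ X.tensor (B.reg.tensor Y) where
  toLin := Y.lco.lTensor X.carrier
  isHom := Y.lco_hom.lTensor X.toDGVect
  lco_comp := map_assoc_rTensor _ (comp_id_eq_map_id _)
  rco_comp := map_assoc_lTensor LinearMap.id (cotensor_aux₃ _ _ Y.lco_rco)

/-- The cotensor product `X □_B Y`: the kernel of the difference of the two maps
`X ⊗ Y → X ⊗ B ⊗ Y`, as an `A`-`E`-bicomodule. -/
def cotensor (X : Bicomod A B) (Y : Bicomod B E) : Bicomod A E :=
  equalizer (cotensorLeft X Y) (cotensorRight X Y)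

/-- The inclusion of the equalizer. -/
def equalizerι {P Q : Bicomod A E} (f g : P ⟶ Q) : equalizer f g ⟶ P where
  toLin := (LinearMap.eqLocus f.toLin g.toLin).subtype
  isHom := ⟨fun _ _ h => h, rfl⟩
  lco_comp := (restrictL_spec _ _).symm
  rco_comp := (restrictR_spec _ _).symm

lemma equalizerι_injective {P Q : Bicomod A E} (f g : P ⟶ Q) :
    Function.Injective (equalizerι f g).toLin := Submodule.injective_subtype _

/-- The linear map between equalizers induced by a linear map `h` which carries the first one
into the second one. -/
def equalizerLin {P Q P' Q' : Bicomod A E} (f g : P ⟶ Q) (f' g' : P' ⟶ Q')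
    (h : P.carrier →ₗ[k] P'.carrier)
    (hh : ∀ x, f.toLin x = g.toLin x → f'.toLin (h x) = g'.toLin (h x)) :
    (equalizer f g).carrier →ₗ[k] (equalizer f' g').carrier :=
  h.restrict (p := LinearMap.eqLocus f.toLin g.toLin) (q := LinearMap.eqLocus f'.toLin g'.toLin)
    hh

lemma equalizerLin_spec {P Q P' Q' : Bicomod A E} (f g : P ⟶ Q) (f' g' : P' ⟶ Q')
    (h : P.carrier →ₗ[k] P'.carrier)
    (hh : ∀ x, f.toLin x = g.toLin x → f'.toLin (h x) = g'.toLin (h x)) :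
    (equalizerι f' g').toLin ∘ₗ equalizerLin f g f' g' h hh = h ∘ₗ (equalizerι f g).toLin := rfl

/-- The morphism `X □ g : X □_B Y ⟶ X □_B Y'`, the restriction of `X ⊗ g`. -/
def cotensorMap (X : Bicomod A B) {Y Y' : Bicomod B E} (g : Y ⟶ Y') :
    X.cotensor Y ⟶ X.cotensor Y' where
  toLin := equalizerLin _ _ _ _ (tensorMap X g).toLin fun x hx => by
    have h1 : (cotensorLeft X Y').toLin ∘ₗ (tensorMap X g).toLin =
        (tensorMap X (tensorMap B.reg g)).toLin ∘ₗ (cotensorLeft X Y).toLin :=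
      map_assoc_rTensor _ (comp_id_eq_map_id _)
    have h2 : (cotensorRight X Y').toLin ∘ₗ (tensorMap X g).toLin =
        (tensorMap X (tensorMap B.reg g)).toLin ∘ₗ (cotensorRight X Y).toLin :=
      map_lTensor _ g.lco_comp
    exact (LinearMap.congr_fun h1 x).trans
      ((congrArg _ hx).trans (LinearMap.congr_fun h2 x).symm)
  isHom := DGVect.IsHom.of_comp (equalizerι _ _).isHom (equalizerι_injective _ _)
    ((tensorMap X g).isHom.comp (equalizerι _ _).isHom)
  lco_comp := sub_colinear_left (equalizerι_injective _ _) (equalizerLin_spec _ _ _ _ _ _)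
    (equalizerι _ _).lco_comp (equalizerι _ _).lco_comp (tensorMap X g).lco_comp
  rco_comp := sub_colinear_right (equalizerι_injective _ _) (equalizerLin_spec _ _ _ _ _ _)
    (equalizerι _ _).rco_comp (equalizerι _ _).rco_comp (tensorMap X g).rco_comp

/-- Two morphisms are homotopic if `f - g = h d + d h` for a bicolinear map `h` of degree `-1`;
for the left coaction the compatibility carries the Koszul sign, i.e. it says that
`h` is a colinear map of degree zero to the shifted bicomodule. -/
def Homotopic : HomRel (Bicomod A B) := fun M N f g =>
  ∃ h : M.carrier →ₗ[k] N.carrier, DGVect.IsGraded M.toDGVect N.toDGVect (-1) h ∧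
    N.lco ∘ₗ h = TensorProduct.map A.sgn h ∘ₗ M.lco ∧
    N.rco ∘ₗ h = h.rTensor B.carrier ∘ₗ M.rco ∧
    f.toLin - g.toLin = h ∘ₗ M.d + N.d ∘ₗ h

/-- The functor `X □_B -` on differential graded bicomodules. -/
def cotensorFunctor (X : Bicomod A B) (E : DGCoalg k) : Bicomod B E ⥤ Bicomod A E where
  obj Y := X.cotensor Y
  map g := X.cotensorMap g
  map_id Y := hom_ext (LinearMap.ext fun x => Subtype.ext
    (LinearMap.congr_fun (LinearMap.lTensor_id X.carrier Y.carrier) x.1))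
  map_comp f g := hom_ext (LinearMap.ext fun x => Subtype.ext
    (LinearMap.congr_fun (LinearMap.lTensor_comp X.carrier g.toLin f.toLin) x.1))

lemma cotensor_homotopic (X : Bicomod A B) {Y Y' : Bicomod B E} {f g : Y ⟶ Y'}
    (hfg : Homotopic f g) : Homotopic (X.cotensorMap f) (X.cotensorMap g) := by
  obtain ⟨h, hd, hl, hr, hh⟩ := hfg
  have hX : X.lco ∘ₗ X.sgn = TensorProduct.map A.sgn X.sgn ∘ₗ X.lco := by
    rw [← X.lco_hom.sgn, DGVect.sgn_tensor]
  have hX' : X.rco ∘ₗ X.sgn = TensorProduct.map X.sgn B.sgn ∘ₗ X.rco := by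
    rw [← X.rco_hom.sgn, DGVect.sgn_tensor]
  refine ⟨equalizerLin _ _ _ _ (TensorProduct.map X.sgn h) fun x hx => ?_, ?_, ?_, ?_, ?_⟩
  · have h1 : (cotensorLeft X Y').toLin ∘ₗ TensorProduct.map X.sgn h =
        TensorProduct.map X.sgn (TensorProduct.map B.sgn h) ∘ₗ (cotensorLeft X Y).toLin :=
      map_assoc_rTensor _ hX'
    have h2 : (cotensorRight X Y').toLin ∘ₗ TensorProduct.map X.sgn h =
        TensorProduct.map X.sgn (TensorProduct.map B.sgn h) ∘ₗ (cotensorRight X Y).toLin :=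
      map_lTensor _ hl
    exact (LinearMap.congr_fun h1 x).trans
      ((congrArg _ hx).trans (LinearMap.congr_fun h2 x).symm)
  · intro n x hx
    have := DGVect.IsGraded.map (e := 0)
      (fun n x hx => by rw [add_zero]; exact X.sgn_mem n x hx) hd n x.1 hx
    rw [zero_add] at this
    exact this
  · exact sub_colinear_left (equalizerι_injective _ _) (equalizerLin_spec _ _ _ _ _ _)
      (equalizerι _ _).lco_comp (equalizerι _ _).lco_comp (map_assoc_rTensor h hX)
  · exact sub_colinear_right (equalizerι_injective _ _) (equalizerLin_spec _ _ _ _ _ _)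
      (equalizerι _ _).rco_comp (equalizerι _ _).rco_comp (map_assoc_lTensor X.sgn hr)
  · have key : f.toLin.lTensor X.carrier - g.toLin.lTensor X.carrier =
        TensorProduct.map X.sgn h ∘ₗ (X.toDGVect.tensor Y.toDGVect).d +
          (X.toDGVect.tensor Y'.toDGVect).d ∘ₗ TensorProduct.map X.sgn h := by
      rw [← LinearMap.lTensor_sub, hh]
      have h1 : ∀ x, X.sgn (X.d x) = -X.d (X.sgn x) := LinearMap.congr_fun X.sgn_d
      have h2 : ∀ x, X.sgn (X.sgn x) = x := LinearMap.congr_fun X.sgn_sgn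
      ext x y
      simp [h1, h2, TensorProduct.neg_tmul]
      abel
    exact LinearMap.ext fun x => Subtype.ext (LinearMap.congr_fun key x.1)

end Bicomod

section TensorLemmas

variable {k : Type*} [Field k] {A X B Z : Type*} [AddCommGroup A] [Module k A] [AddCommGroup X]
  [Module k X] [AddCommGroup B] [Module k B] [AddCommGroup Z] [Module k Z]

lemma twist_coassoc {δ : A →ₗ[k] A ⊗[k] A} {s : A →ₗ[k] A} {ρ : X →ₗ[k] A ⊗[k] X}
    (hs : δ ∘ₗ s = TensorProduct.map s s ∘ₗ δ)
    (h : (TensorProduct.assoc k A A X).toLinearMap ∘ₗ δ.rTensor X ∘ₗ ρ = ρ.lTensor A ∘ₗ ρ) :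
    (TensorProduct.assoc k A A X).toLinearMap ∘ₗ δ.rTensor X ∘ₗ (s.rTensor X ∘ₗ ρ) =
      (s.rTensor X ∘ₗ ρ).lTensor A ∘ₗ (s.rTensor X ∘ₗ ρ) := by
  have h1 : (TensorProduct.assoc k A A X).toLinearMap ∘ₗ (TensorProduct.map s s).rTensor X =
      TensorProduct.map s (s.rTensor X) ∘ₗ (TensorProduct.assoc k A A X).toLinearMap := by
    ext; simp
  rw [← LinearMap.comp_assoc ρ, ← LinearMap.rTensor_comp, hs, LinearMap.rTensor_comp,
    LinearMap.comp_assoc, ← LinearMap.comp_assoc, h1, LinearMap.comp_assoc, h,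
    ← LinearMap.comp_assoc, ← LinearMap.comp_assoc]
  congr 1
  ext; simp

lemma twist_lco_rco {s : A →ₗ[k] A} {ρ : X →ₗ[k] A ⊗[k] X} {σ : X →ₗ[k] X ⊗[k] B}
    (h : (TensorProduct.assoc k A X B).toLinearMap ∘ₗ ρ.rTensor B ∘ₗ σ = σ.lTensor A ∘ₗ ρ) :
    (TensorProduct.assoc k A X B).toLinearMap ∘ₗ (s.rTensor X ∘ₗ ρ).rTensor B ∘ₗ σ =
      σ.lTensor A ∘ₗ (s.rTensor X ∘ₗ ρ) := by
  have h1 : (TensorProduct.assoc k A X B).toLinearMap ∘ₗ (s.rTensor X).rTensor B =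
      s.rTensor (X ⊗[k] B) ∘ₗ (TensorProduct.assoc k A X B).toLinearMap := by
    ext; simp
  rw [LinearMap.rTensor_comp, LinearMap.comp_assoc, ← LinearMap.comp_assoc, h1,
    LinearMap.comp_assoc, h, ← LinearMap.comp_assoc, ← LinearMap.comp_assoc,
    LinearMap.rTensor_comp_lTensor, LinearMap.lTensor_comp_rTensor]

lemma push_lco_coassoc {i : X →ₗ[k] Z} {δ : A →ₗ[k] A ⊗[k] A} {ρ : X →ₗ[k] A ⊗[k] X}
    {σ : Z →ₗ[k] A ⊗[k] Z} (hs : σ ∘ₗ i = i.lTensor A ∘ₗ ρ)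
    (h : (TensorProduct.assoc k A A X).toLinearMap ∘ₗ δ.rTensor X ∘ₗ ρ = ρ.lTensor A ∘ₗ ρ) :
    ((TensorProduct.assoc k A A Z).toLinearMap ∘ₗ δ.rTensor Z ∘ₗ σ) ∘ₗ i =
      (σ.lTensor A ∘ₗ σ) ∘ₗ i := by
  have h1 : (i.lTensor A).lTensor A ∘ₗ (TensorProduct.assoc k A A X).toLinearMap =
      (TensorProduct.assoc k A A Z).toLinearMap ∘ₗ i.lTensor (A ⊗[k] A) := by
    ext; simp
  rw [LinearMap.comp_assoc, LinearMap.comp_assoc, LinearMap.comp_assoc, hs,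
    ← LinearMap.comp_assoc ρ _ (σ.lTensor A), ← LinearMap.lTensor_comp, hs,
    LinearMap.lTensor_comp, LinearMap.comp_assoc ρ, ← h, ← LinearMap.comp_assoc _ _
    ((i.lTensor A).lTensor A), h1, ← LinearMap.comp_assoc ρ, LinearMap.rTensor_comp_lTensor,
    ← LinearMap.lTensor_comp_rTensor]
  rfl

lemma push_rco_coassoc {i : X →ₗ[k] Z} {δ : A →ₗ[k] A ⊗[k] A} {ρ : X →ₗ[k] X ⊗[k] A}
    {σ : Z →ₗ[k] Z ⊗[k] A} (hs : σ ∘ₗ i = i.rTensor A ∘ₗ ρ)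
    (h : (TensorProduct.assoc k X A A).toLinearMap ∘ₗ ρ.rTensor A ∘ₗ ρ = δ.lTensor X ∘ₗ ρ) :
    ((TensorProduct.assoc k Z A A).toLinearMap ∘ₗ σ.rTensor A ∘ₗ σ) ∘ₗ i =
      (δ.lTensor Z ∘ₗ σ) ∘ₗ i := by
  have h1 : i.rTensor (A ⊗[k] A) ∘ₗ (TensorProduct.assoc k X A A).toLinearMap =
      (TensorProduct.assoc k Z A A).toLinearMap ∘ₗ (i.rTensor A).rTensor A := by
    ext; simp
  rw [LinearMap.comp_assoc, LinearMap.comp_assoc, LinearMap.comp_assoc, hs,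
    ← LinearMap.comp_assoc ρ, ← LinearMap.comp_assoc ρ _ (δ.lTensor Z),
    ← LinearMap.rTensor_comp, hs, LinearMap.rTensor_comp, LinearMap.lTensor_comp_rTensor, ← LinearMap.rTensor_comp_lTensor,
    LinearMap.comp_assoc ρ _ (i.rTensor (A ⊗[k] A)), ← h, ← LinearMap.comp_assoc _ _
    (i.rTensor (A ⊗[k] A)), h1]
  rfl

lemma push_lco_counit {i : X →ₗ[k] Z} {ε : A →ₗ[k] k} {ρ : X →ₗ[k] A ⊗[k] X}
    {σ : Z →ₗ[k] A ⊗[k] Z} (hs : σ ∘ₗ i = i.lTensor A ∘ₗ ρ)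
    (h : ε.rTensor X ∘ₗ ρ = TensorProduct.mk k k X 1) :
    (ε.rTensor Z ∘ₗ σ) ∘ₗ i = TensorProduct.mk k k Z 1 ∘ₗ i := by
  rw [LinearMap.comp_assoc, hs, ← LinearMap.comp_assoc, LinearMap.rTensor_comp_lTensor,
    ← LinearMap.lTensor_comp_rTensor, LinearMap.comp_assoc, h]
  ext; simp

lemma push_rco_counit {i : X →ₗ[k] Z} {ε : A →ₗ[k] k} {ρ : X →ₗ[k] X ⊗[k] A}
    {σ : Z →ₗ[k] Z ⊗[k] A} (hs : σ ∘ₗ i = i.rTensor A ∘ₗ ρ)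
    (h : ε.lTensor X ∘ₗ ρ = (TensorProduct.mk k X k).flip 1) :
    (ε.lTensor Z ∘ₗ σ) ∘ₗ i = (TensorProduct.mk k Z k).flip 1 ∘ₗ i := by
  rw [LinearMap.comp_assoc, hs, ← LinearMap.comp_assoc, LinearMap.lTensor_comp_rTensor,
    ← LinearMap.rTensor_comp_lTensor, LinearMap.comp_assoc, h]
  ext; simp

lemma push_lco_rco {i : X →ₗ[k] Z} {ρ : X →ₗ[k] A ⊗[k] X} {ρ' : X →ₗ[k] X ⊗[k] B}
    {σ : Z →ₗ[k] A ⊗[k] Z} {σ' : Z →ₗ[k] Z ⊗[k] B} (hs : σ ∘ₗ i = i.lTensor A ∘ₗ ρ)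
    (hs' : σ' ∘ₗ i = i.rTensor B ∘ₗ ρ')
    (h : (TensorProduct.assoc k A X B).toLinearMap ∘ₗ ρ.rTensor B ∘ₗ ρ' = ρ'.lTensor A ∘ₗ ρ) :
    ((TensorProduct.assoc k A Z B).toLinearMap ∘ₗ σ.rTensor B ∘ₗ σ') ∘ₗ i =
      (σ'.lTensor A ∘ₗ σ) ∘ₗ i := by
  have h1 : (i.rTensor B).lTensor A ∘ₗ (TensorProduct.assoc k A X B).toLinearMap =
      (TensorProduct.assoc k A Z B).toLinearMap ∘ₗ (i.lTensor A).rTensor B := by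
    ext; simp
  rw [LinearMap.comp_assoc, LinearMap.comp_assoc, LinearMap.comp_assoc, hs, hs',
    ← LinearMap.comp_assoc ρ', ← LinearMap.comp_assoc ρ, ← LinearMap.lTensor_comp,
    ← LinearMap.rTensor_comp, hs, hs', LinearMap.lTensor_comp, LinearMap.rTensor_comp,
    LinearMap.comp_assoc ρ, ← h, ← LinearMap.comp_assoc _ _ ((i.rTensor B).lTensor A), h1]
  rfl

/-- The direct sum of two left coactions. -/
def prodL (ρ : X →ₗ[k] A ⊗[k] X) (σ : Z →ₗ[k] A ⊗[k] Z) : X × Z →ₗ[k] A ⊗[k] (X × Z) :=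
  ((LinearMap.inl k X Z).lTensor A ∘ₗ ρ).coprod ((LinearMap.inr k X Z).lTensor A ∘ₗ σ)

lemma prodL_inl (ρ : X →ₗ[k] A ⊗[k] X) (σ : Z →ₗ[k] A ⊗[k] Z) :
    prodL ρ σ ∘ₗ LinearMap.inl k X Z = (LinearMap.inl k X Z).lTensor A ∘ₗ ρ :=
  LinearMap.coprod_inl _ _

lemma prodL_inr (ρ : X →ₗ[k] A ⊗[k] X) (σ : Z →ₗ[k] A ⊗[k] Z) :
    prodL ρ σ ∘ₗ LinearMap.inr k X Z = (LinearMap.inr k X Z).lTensor A ∘ₗ σ :=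
  LinearMap.coprod_inr _ _

lemma prodL_fst (ρ : X →ₗ[k] A ⊗[k] X) (σ : Z →ₗ[k] A ⊗[k] Z) :
    ρ ∘ₗ LinearMap.fst k X Z = (LinearMap.fst k X Z).lTensor A ∘ₗ prodL ρ σ := by
  refine LinearMap.prod_ext ?_ ?_
  · rw [LinearMap.comp_assoc, LinearMap.comp_assoc, prodL_inl, ← LinearMap.comp_assoc _ _
      (LinearMap.lTensor _ _), ← LinearMap.lTensor_comp, LinearMap.fst_comp_inl, LinearMap.lTensor_id]
    rfl
  · rw [LinearMap.comp_assoc, LinearMap.comp_assoc, prodL_inr, ← LinearMap.comp_assoc _ _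
      (LinearMap.lTensor _ _), ← LinearMap.lTensor_comp, LinearMap.fst_comp_inr,
      LinearMap.lTensor_zero, LinearMap.zero_comp, LinearMap.comp_zero]

/-- The direct sum of two right coactions. -/
def prodR (ρ : X →ₗ[k] X ⊗[k] A) (σ : Z →ₗ[k] Z ⊗[k] A) : X × Z →ₗ[k] (X × Z) ⊗[k] A :=
  ((LinearMap.inl k X Z).rTensor A ∘ₗ ρ).coprod ((LinearMap.inr k X Z).rTensor A ∘ₗ σ)

lemma prodR_inl (ρ : X →ₗ[k] X ⊗[k] A) (σ : Z →ₗ[k] Z ⊗[k] A) :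
    prodR ρ σ ∘ₗ LinearMap.inl k X Z = (LinearMap.inl k X Z).rTensor A ∘ₗ ρ :=
  LinearMap.coprod_inl _ _

lemma prodR_inr (ρ : X →ₗ[k] X ⊗[k] A) (σ : Z →ₗ[k] Z ⊗[k] A) :
    prodR ρ σ ∘ₗ LinearMap.inr k X Z = (LinearMap.inr k X Z).rTensor A ∘ₗ σ :=
  LinearMap.coprod_inr _ _

lemma prodR_fst (ρ : X →ₗ[k] X ⊗[k] A) (σ : Z →ₗ[k] Z ⊗[k] A) :
    ρ ∘ₗ LinearMap.fst k X Z = (LinearMap.fst k X Z).rTensor A ∘ₗ prodR ρ σ := by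
  refine LinearMap.prod_ext ?_ ?_
  · rw [LinearMap.comp_assoc, LinearMap.comp_assoc, prodR_inl, ← LinearMap.comp_assoc _ _
      (LinearMap.rTensor _ _), ← LinearMap.rTensor_comp, LinearMap.fst_comp_inl, LinearMap.rTensor_id]
    rfl
  · rw [LinearMap.comp_assoc, LinearMap.comp_assoc, prodR_inr, ← LinearMap.comp_assoc _ _
      (LinearMap.rTensor _ _), ← LinearMap.rTensor_comp, LinearMap.fst_comp_inr,
      LinearMap.rTensor_zero, LinearMap.zero_comp, LinearMap.comp_zero]

end TensorLemmas

namespace DGVect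

variable {k : Type u} [Field k]

lemma isGraded_shift (M : DGVect k) : IsGraded M M.shift (-1) LinearMap.id := fun n x hx => by
  show x ∈ M.gr (n + -1 + 1)
  simpa using hx

lemma sgn_shift (M : DGVect k) : M.shift.sgn = -M.sgn := by
  simpa using sgn_comp M.isGraded_shift

end DGVect

namespace Bicomod

variable {k : Type u} [Field k] {A B E : DGCoalg k}

/-- The shifted bicomodule `M[-1]`, with `M[-1]_n = M_{n+1}` and differential `-d`; the left
coaction acquires the Koszul sign. -/
def shift (M : Bicomod A B) : Bicomod A B where
  toDGVect := M.toDGVect.shift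
  lco := A.sgn.rTensor M.carrier ∘ₗ M.lco
  rco := M.rco
  lco_hom :=
    { mem := fun n x hx => by
        have h := DGVect.IsGraded.map (M := A.toDGVect) (e := 0)
          (fun n x hx => by rw [add_zero]; exact A.sgn_mem n x hx)
          M.isGraded_shift (n + 1) _ (M.lco_hom.mem (n + 1) x hx)
        rw [show n + 1 + (0 + -1) = n by ring] at h
        exact h
      comm := by
        have h1 : (A.toDGVect.tensor M.toDGVect.shift).d ∘ₗ A.sgn.rTensor M.carrier =
            -(A.sgn.rTensor M.carrier ∘ₗ (A.toDGVect.tensor M.toDGVect).d) := by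
          have h1 : ∀ x, A.sgn (A.d x) = -A.d (A.sgn x) := LinearMap.congr_fun A.sgn_d
          ext x y
          simp [h1, TensorProduct.neg_tmul, TensorProduct.tmul_neg, add_comm]
        have h2 := M.lco_hom.comm
        show (A.sgn.rTensor M.carrier ∘ₗ M.lco) ∘ₗ (-M.d) = _ ∘ₗ A.sgn.rTensor M.carrier ∘ₗ M.lco
        rw [← LinearMap.comp_assoc, h1, LinearMap.comp_neg, LinearMap.comp_assoc, h2,
          LinearMap.neg_comp, LinearMap.comp_assoc] }
  rco_hom :=
    { mem := fun n x hx => by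
        have h := DGVect.IsGraded.map M.isGraded_shift (DGVect.IsHom.id B.toDGVect).graded
          (n + 1) _ (M.rco_hom.mem (n + 1) x hx)
        rw [show n + 1 + (-1 + 0) = n by ring, TensorProduct.map_id] at h
        exact h
      comm := by
        have h1 : (M.toDGVect.shift.tensor B.toDGVect).d = -(M.toDGVect.tensor B.toDGVect).d := by
          ext x y
          simp [DGVect.sgn_shift, TensorProduct.neg_tmul, add_comm]
        show M.rco ∘ₗ (-M.d) = _ ∘ₗ M.rco
        rw [h1, LinearMap.comp_neg, M.rco_hom.comm]
        rfl }
  lco_coassoc := twist_coassoc (by rw [← A.comul_hom.sgn, DGVect.sgn_tensor]) M.lco_coassoc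
  rco_coassoc := M.rco_coassoc
  lco_counit := by
    have h : Coalgebra.counit (R := k) (A := A.carrier) ∘ₗ A.sgn = Coalgebra.counit := by
      refine A.hom_ext fun n x hx => ?_
      have h1 : Coalgebra.counit (R := k) x ∈ (if n = 0 then ⊤ else ⊥ : Submodule k k) :=
        A.counit_hom.mem n x hx
      rw [LinearMap.comp_apply, A.sgn_apply hx, map_smul]
      by_cases hn : n = 0
      · simp [hn]
      · rw [if_neg hn, Submodule.mem_bot] at h1
        rw [h1, smul_zero]
    rw [← LinearMap.comp_assoc, ← LinearMap.rTensor_comp, h]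
    exact M.lco_counit
  rco_counit := M.rco_counit
  lco_rco := twist_lco_rco M.lco_rco

lemma isGraded_inl {M N : Bicomod A B} (u : M ⟶ N) :
    DGVect.IsGraded M.toDGVect.shift (M.toDGVect.cone N.toDGVect u.toLin u.isHom) 0
      (LinearMap.inl k M.carrier N.carrier) := fun n x hx => by
  rw [add_zero]
  exact ⟨hx, zero_mem _⟩

lemma isHom_inr {M N : Bicomod A B} (u : M ⟶ N) :
    DGVect.IsHom N.toDGVect (M.toDGVect.cone N.toDGVect u.toLin u.isHom)
      (LinearMap.inr k M.carrier N.carrier) where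
  mem n x hx := ⟨zero_mem _, hx⟩
  comm := by ext <;> simp

/-- The mapping cone of a morphism of bicomodules, with the coactions of `M[-1] ⊕ N`. -/
def cone {M N : Bicomod A B} (u : M ⟶ N) : Bicomod A B where
  toDGVect := M.toDGVect.cone N.toDGVect u.toLin u.isHom
  lco := prodL (A.sgn.rTensor M.carrier ∘ₗ M.lco) N.lco
  rco := prodR M.rco N.rco
  lco_hom :=
    { mem := fun n x hx => by
        have h1 := (DGVect.IsHom.id A.toDGVect).graded.map (isGraded_inl u) n _
          (M.shift.lco_hom.mem n x.1 hx.1)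
        have h2 := ((isHom_inr u).lTensor A.toDGVect).mem n _ (N.lco_hom.mem n x.2 hx.2)
        rw [add_zero, add_zero] at h1
        exact add_mem h1 h2
      comm := by
        refine LinearMap.prod_ext ?_ ?_
        · have hd : (M.toDGVect.cone N.toDGVect u.toLin u.isHom).d ∘ₗ
              LinearMap.inl k M.carrier N.carrier =
              LinearMap.inl k M.carrier N.carrier ∘ₗ M.toDGVect.shift.d +
                LinearMap.inr k M.carrier N.carrier ∘ₗ u.toLin := by
            ext <;> simp
          have ht : (A.toDGVect.tensor (M.toDGVect.cone N.toDGVect u.toLin u.isHom)).d ∘ₗ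
              (LinearMap.inl k M.carrier N.carrier).lTensor A.carrier =
              (LinearMap.inl k M.carrier N.carrier).lTensor A.carrier ∘ₗ
                (A.toDGVect.tensor M.toDGVect.shift).d +
              TensorProduct.map A.sgn (LinearMap.inr k M.carrier N.carrier ∘ₗ u.toLin) := by
            have hd' := fun x => LinearMap.congr_fun hd x
            simp only [LinearMap.comp_apply, LinearMap.add_apply] at hd'
            ext x y
            simp only [LinearMap.comp_apply, AlgebraTensorModule.curry_apply,
              LinearMap.restrictScalars_self, TensorProduct.curry_apply, LinearMap.add_apply,
              LinearMap.lTensor_tmul, TensorProduct.map_tmul, LinearMap.id_apply, hd', map_add,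
              TensorProduct.tmul_add, add_assoc]
          have hs : TensorProduct.map A.sgn (LinearMap.inr k M.carrier N.carrier ∘ₗ u.toLin) ∘ₗ
              A.sgn.rTensor M.carrier =
              (LinearMap.inr k M.carrier N.carrier).lTensor A.carrier ∘ₗ
                u.toLin.lTensor A.carrier := by
            have h2 : ∀ x, A.sgn (A.sgn x) = x := LinearMap.congr_fun A.sgn_sgn
            ext x y
            simp [h2]
          have hc := M.shift.lco_hom.comm
          change (A.sgn.rTensor M.carrier ∘ₗ M.lco) ∘ₗ M.toDGVect.shift.d =
            (A.toDGVect.tensor M.toDGVect.shift).d ∘ₗ A.sgn.rTensor M.carrier ∘ₗ M.lco at hc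
          rw [LinearMap.comp_assoc, hd, LinearMap.comp_assoc, prodL_inl, LinearMap.comp_add,
            ← LinearMap.comp_assoc _ _ (prodL _ _), prodL_inl, LinearMap.comp_assoc, hc,
            ← LinearMap.comp_assoc _ _ (prodL _ _), prodL_inr, LinearMap.comp_assoc,
            u.lco_comp]
          conv_rhs => rw [← LinearMap.comp_assoc, ht, LinearMap.add_comp,
            ← LinearMap.comp_assoc M.lco _ (TensorProduct.map _ _), hs]
          rfl
        · rw [LinearMap.comp_assoc, LinearMap.comp_assoc, prodL_inr, ← (isHom_inr u).comm,
            ← LinearMap.comp_assoc, prodL_inr, LinearMap.comp_assoc, N.lco_hom.comm,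
            ← LinearMap.comp_assoc, ((isHom_inr u).lTensor A.toDGVect).comm]
          rfl }
  rco_hom :=
    { mem := fun n x hx => by
        have h1 := (isGraded_inl u).map (DGVect.IsHom.id B.toDGVect).graded n _
          (M.shift.rco_hom.mem n x.1 hx.1)
        have h2 := ((isHom_inr u).rTensor B.toDGVect).mem n _ (N.rco_hom.mem n x.2 hx.2)
        rw [add_zero, add_zero] at h1
        exact add_mem h1 h2
      comm := by
        refine LinearMap.prod_ext ?_ ?_
        · have hd : (M.toDGVect.cone N.toDGVect u.toLin u.isHom).d ∘ₗ
              LinearMap.inl k M.carrier N.carrier =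
              LinearMap.inl k M.carrier N.carrier ∘ₗ M.toDGVect.shift.d +
                LinearMap.inr k M.carrier N.carrier ∘ₗ u.toLin := by
            ext <;> simp
          have ht : ((M.toDGVect.cone N.toDGVect u.toLin u.isHom).tensor B.toDGVect).d ∘ₗ
              (LinearMap.inl k M.carrier N.carrier).rTensor B.carrier =
              (LinearMap.inl k M.carrier N.carrier).rTensor B.carrier ∘ₗ
                (M.toDGVect.shift.tensor B.toDGVect).d +
              (LinearMap.inr k M.carrier N.carrier).rTensor B.carrier ∘ₗ
                u.toLin.rTensor B.carrier := by
            have hd' := fun x => LinearMap.congr_fun hd x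
            have hs' := fun x => LinearMap.congr_fun (DGVect.sgn_comp (isGraded_inl u)) x
            simp only [LinearMap.comp_apply, LinearMap.add_apply,
              Int.negOnePow_zero, Units.val_one, Int.cast_one, one_smul] at hd' hs'
            ext x y
            simp only [LinearMap.comp_apply, AlgebraTensorModule.curry_apply,
              LinearMap.restrictScalars_self, TensorProduct.curry_apply, LinearMap.add_apply,
              LinearMap.rTensor_tmul, TensorProduct.map_tmul, LinearMap.id_apply, hd', hs',
              map_add, TensorProduct.add_tmul]
            abel
          have hc := M.shift.rco_hom.comm
          change M.rco ∘ₗ M.toDGVect.shift.d =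
            (M.toDGVect.shift.tensor B.toDGVect).d ∘ₗ M.rco at hc
          rw [LinearMap.comp_assoc, hd, LinearMap.comp_assoc, prodR_inl, LinearMap.comp_add,
            ← LinearMap.comp_assoc _ _ (prodR _ _), prodR_inl, LinearMap.comp_assoc, hc,
            ← LinearMap.comp_assoc _ _ (prodR _ _), prodR_inr, LinearMap.comp_assoc,
            u.rco_comp, ← LinearMap.comp_assoc _ _ (DGVect.d _), ht, LinearMap.add_comp]
          rfl
        · rw [LinearMap.comp_assoc, LinearMap.comp_assoc, prodR_inr, ← (isHom_inr u).comm,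
            ← LinearMap.comp_assoc, prodR_inr, LinearMap.comp_assoc, N.rco_hom.comm,
            ← LinearMap.comp_assoc, ((isHom_inr u).rTensor B.toDGVect).comm]
          rfl }
  lco_coassoc := LinearMap.prod_ext
    (push_lco_coassoc (prodL_inl _ _) M.shift.lco_coassoc)
    (push_lco_coassoc (prodL_inr _ _) N.lco_coassoc)
  rco_coassoc := LinearMap.prod_ext
    (push_rco_coassoc (prodR_inl _ _) M.rco_coassoc)
    (push_rco_coassoc (prodR_inr _ _) N.rco_coassoc)
  lco_counit := LinearMap.prod_ext
    (push_lco_counit (prodL_inl _ _) M.shift.lco_counit)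
    (push_lco_counit (prodL_inr _ _) N.lco_counit)
  rco_counit := LinearMap.prod_ext
    (push_rco_counit (prodR_inl _ _) M.rco_counit)
    (push_rco_counit (prodR_inr _ _) N.rco_counit)
  lco_rco := LinearMap.prod_ext
    (push_lco_rco (prodL_inl _ _) (prodR_inl _ _) M.shift.lco_rco)
    (push_lco_rco (prodL_inr _ _) (prodR_inr _ _) N.lco_rco)

/-- The inclusion of the target into the cone. -/
def coneIn {M N : Bicomod A B} (u : M ⟶ N) : N ⟶ cone u where
  toLin := LinearMap.inr k M.carrier N.carrier
  isHom := isHom_inr u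
  lco_comp := prodL_inr _ _
  rco_comp := prodR_inr _ _

/-- The projection of the cone to the shifted source. -/
def coneOut {M N : Bicomod A B} (u : M ⟶ N) : cone u ⟶ M.shift where
  toLin := LinearMap.fst k M.carrier N.carrier
  isHom := ⟨fun _ _ hx => hx.1, rfl⟩
  lco_comp := prodL_fst _ _
  rco_comp := prodR_fst _ _

/-- The shift functor `M ↦ M[-1]`. -/
def shiftFunctor (A B : DGCoalg k) : Bicomod A B ⥤ Bicomod A B where
  obj M := M.shift
  map {M N} f :=
    { toLin := f.toLin
      isHom := ⟨fun n x hx => f.isHom.mem (n + 1) x hx, by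
        show f.toLin ∘ₗ (-M.d) = (-N.d) ∘ₗ f.toLin
        rw [LinearMap.comp_neg, LinearMap.neg_comp, f.isHom.comm]⟩
      lco_comp := by
        show (A.sgn.rTensor N.carrier ∘ₗ N.lco) ∘ₗ f.toLin =
          f.toLin.lTensor A.carrier ∘ₗ A.sgn.rTensor M.carrier ∘ₗ M.lco
        rw [LinearMap.comp_assoc, f.lco_comp, ← LinearMap.comp_assoc, ← LinearMap.comp_assoc,
          LinearMap.rTensor_comp_lTensor, LinearMap.lTensor_comp_rTensor]
      rco_comp := f.rco_comp }

lemma shift_homotopic {M N : Bicomod A B} {f g : M ⟶ N} (hfg : Homotopic f g) :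
    Homotopic ((shiftFunctor A B).map f) ((shiftFunctor A B).map g) := by
  obtain ⟨h, hd, hl, hr, hh⟩ := hfg
  refine ⟨-h, fun n x hx => ?_, ?_, ?_, ?_⟩
  · have := hd (n + 1) x hx
    rw [show n + 1 + -1 = n + -1 + 1 by ring] at this
    exact neg_mem this
  · show (A.sgn.rTensor N.carrier ∘ₗ N.lco) ∘ₗ (-h) =
      TensorProduct.map A.sgn (-h) ∘ₗ A.sgn.rTensor M.carrier ∘ₗ M.lco
    rw [LinearMap.comp_neg, LinearMap.comp_assoc, hl, ← LinearMap.comp_assoc,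
      ← LinearMap.comp_assoc, ← LinearMap.neg_comp]
    congr 1
    ext; simp [TensorProduct.tmul_neg]
  · show N.rco ∘ₗ (-h) = (-h).rTensor B.carrier ∘ₗ M.rco
    rw [LinearMap.comp_neg, hr, LinearMap.rTensor_neg, LinearMap.neg_comp]
  · show f.toLin - g.toLin = (-h) ∘ₗ (-M.d) + (-N.d) ∘ₗ (-h)
    rw [hh]
    ext; simp

end Bicomod

namespace DGVect

variable {k : Type u} [Field k]

lemma isQuasiIso_iff {M N : DGVect k} {f : M →ₗ[k] N} (hf : IsHom M N f) :
    IsQuasiIso hf ↔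
      (∀ x, M.d x = 0 → (∃ y, N.d y = f x) → ∃ x', M.d x' = x) ∧
      (∀ y, N.d y = 0 → ∃ x, M.d x = 0 ∧ ∃ y', N.d y' = f x - y) := by
  have key : ∀ x : LinearMap.ker M.d, homologyMap hf (Submodule.Quotient.mk x) = 0 ↔
      ∃ y, N.d y = f x := by
    intro x
    rw [homologyMap, Submodule.mapQ_apply, Submodule.Quotient.mk_eq_zero]
    rfl
  have key2 : ∀ (x : LinearMap.ker M.d) (y : LinearMap.ker N.d),
      homologyMap hf (Submodule.Quotient.mk x) = Submodule.Quotient.mk y ↔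
        ∃ y', N.d y' = f x - y := by
    intro x y
    rw [homologyMap, Submodule.mapQ_apply, Submodule.Quotient.eq]
    rfl
  constructor
  · rintro ⟨hi, hs⟩
    refine ⟨fun x hx hy => ?_, fun y hy => ?_⟩
    · have h0 := hi (((key ⟨x, hx⟩).2 hy).trans (map_zero _).symm)
      rw [Submodule.Quotient.mk_eq_zero] at h0
      exact h0
    · obtain ⟨z, hz⟩ := hs (Submodule.Quotient.mk ⟨y, hy⟩)
      obtain ⟨x, rfl⟩ := Submodule.Quotient.mk_surjective _ z
      exact ⟨x, x.2, (key2 x ⟨y, hy⟩).1 hz⟩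
  · rintro ⟨hi, hs⟩
    refine ⟨(injective_iff_map_eq_zero _).2 fun z hz => ?_, fun z => ?_⟩
    · obtain ⟨x, rfl⟩ := Submodule.Quotient.mk_surjective _ z
      rw [Submodule.Quotient.mk_eq_zero]
      exact hi x x.2 ((key x).1 hz)
    · obtain ⟨y, rfl⟩ := Submodule.Quotient.mk_surjective _ z
      obtain ⟨x, hx, hy⟩ := hs y y.2
      exact ⟨Submodule.Quotient.mk ⟨x, hx⟩, (key2 ⟨x, hx⟩ y).2 hy⟩

end DGVect

lemma Bicomod.shift_quasiIso {k : Type u} [Field k] {A B : DGCoalg k} {M N : Bicomod A B}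
    (f : M ⟶ N) (hf : DGVect.IsQuasiIso f.isHom) :
    DGVect.IsQuasiIso ((shiftFunctor A B).map f).isHom := by
  rw [DGVect.isQuasiIso_iff] at hf ⊢
  refine ⟨fun x hx hy => ?_, fun y hy => ?_⟩
  · obtain ⟨y, hy⟩ := hy
    obtain ⟨x', hx'⟩ := hf.1 x (neg_eq_zero.1 hx) ⟨-y, (map_neg N.d y).trans hy⟩
    exact ⟨-x', (congrArg Neg.neg (map_neg M.d x')).trans ((neg_neg _).trans hx')⟩
  · obtain ⟨x, hx, y', hy'⟩ := hf.2 y (neg_eq_zero.1 hy)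
    exact ⟨x, neg_eq_zero.2 hx, -y',
      (congrArg Neg.neg (map_neg N.d y')).trans ((neg_neg _).trans hy')⟩

namespace Bicomod

variable {k : Type u} [Field k] {A B E : DGCoalg k}

/-- The homotopy category `H(A ⊗ B^op)` of differential graded `A`-`B`-bicomodules. -/
abbrev HCat (A B : DGCoalg k) : Type (u + 1) := CategoryTheory.Quotient (Homotopic (A := A) (B := B))

/-- The projection to the homotopy category. -/
abbrev toH (A B : DGCoalg k) : Bicomod A B ⥤ HCat A B := CategoryTheory.Quotient.functor _

/-- The quasi-isomorphisms in the homotopy category: the classes of the morphisms which induce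
an isomorphism on cohomology. -/
def quasiIso (A B : DGCoalg k) : MorphismProperty (HCat A B) := fun M N φ =>
  ∃ f : M.as ⟶ N.as, (toH A B).map f = φ ∧ DGVect.IsQuasiIso f.isHom

/-- The derived category `D(A ⊗ B^op)`: the localization of the homotopy category at the
quasi-isomorphisms. -/
abbrev DCat (A B : DGCoalg k) : Type (u + 1) := (quasiIso A B).Localization

/-- The localization functor `H(A ⊗ B^op) ⥤ D(A ⊗ B^op)`. -/
abbrev HtoD (A B : DGCoalg k) : HCat A B ⥤ DCat A B := (quasiIso A B).Q

/-- A bicomodule as an object of the derived category. -/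
abbrev toD (A B : DGCoalg k) : Bicomod A B ⥤ DCat A B := toH A B ⋙ HtoD A B

/-- The objects of the homotopy category which are isomorphic to left bounded bicomodules. -/
def isPlusH (A B : DGCoalg k) : ObjectProperty (HCat A B) := fun X =>
  ∃ M : Bicomod A B, M.IsBoundedBelow ∧ Nonempty (X ≅ (toH A B).obj M)

/-- The objects of the derived category which are isomorphic to left bounded bicomodules. -/
def isPlusD (A B : DGCoalg k) : ObjectProperty (DCat A B) := fun X =>
  ∃ M : Bicomod A B, M.IsBoundedBelow ∧ Nonempty (X ≅ (toD A B).obj M)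

/-- `H⁺(A ⊗ B^op)`. -/
abbrev HPlus (A B : DGCoalg k) : Type (u + 1) := (isPlusH A B).FullSubcategory

/-- `D⁺(A ⊗ B^op)`. -/
abbrev DPlus (A B : DGCoalg k) : Type (u + 1) := (isPlusD A B).FullSubcategory

/-- The functor `H⁺(A ⊗ B^op) ⥤ D⁺(A ⊗ B^op)` induced by the localization functor. -/
def HtoDPlus (A B : DGCoalg k) : HPlus A B ⥤ DPlus A B :=
  (isPlusD A B).lift ((isPlusH A B).ι ⋙ HtoD A B) fun X => by
    obtain ⟨M, hM, ⟨e⟩⟩ := X.2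
    exact ⟨M, hM, ⟨(HtoD A B).mapIso e⟩⟩

/-- A left bounded bicomodule as an object of `D⁺(A ⊗ B^op)`. -/
def toDPlus (M : Bicomod A B) (hM : M.IsBoundedBelow) : DPlus A B :=
  ⟨(toD A B).obj M, M, hM, ⟨Iso.refl _⟩⟩

lemma cotensor_isBoundedBelow {X : Bicomod A B} {Y : Bicomod B E} (hX : X.IsBoundedBelow)
    (hY : Y.IsBoundedBelow) : (X.cotensor Y).IsBoundedBelow := by
  obtain ⟨a, ha⟩ := hX
  obtain ⟨b, hb⟩ := hY
  refine ⟨a + b, fun n hn => ?_⟩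
  have h : DGVect.tensorGr X.toDGVect Y.toDGVect n ≤ ⊥ :=
    DGVect.tensorGr_le fun p q hpq x hx y hy => by
      rcases lt_or_ge p a with h | h
      · rw [ha p h, Submodule.mem_bot] at hx
        rw [hx, TensorProduct.zero_tmul]
        exact zero_mem _
      · rw [hb q (by omega), Submodule.mem_bot] at hy
        rw [hy, TensorProduct.tmul_zero]
        exact zero_mem _
  rw [eq_bot_iff]
  intro x hx
  exact Subtype.ext (h hx)

/-- The functor `X □_B - : H(B ⊗ E^op) ⥤ H(A ⊗ E^op)`. -/
def cotensorH (X : Bicomod A B) (E : DGCoalg k) : HCat B E ⥤ HCat A E :=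
  CategoryTheory.Quotient.lift _ (X.cotensorFunctor E ⋙ toH A E) fun _ _ _ _ h =>
    CategoryTheory.Quotient.sound _ (X.cotensor_homotopic h)

/-- The functor `X □_B - : H⁺(B ⊗ E^op) ⥤ H⁺(A ⊗ E^op)` for a left bounded bicomodule `X`. -/
def cotensorHPlus (X : Bicomod A B) (hX : X.IsBoundedBelow) (E : DGCoalg k) :
    HPlus B E ⥤ HPlus A E :=
  (isPlusH A E).lift ((isPlusH B E).ι ⋙ X.cotensorH E) fun Y => by
    obtain ⟨M, hM, ⟨e⟩⟩ := Y.2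
    exact ⟨X.cotensor M, cotensor_isBoundedBelow hX hM, ⟨(X.cotensorH E).mapIso e⟩⟩

/-- `R : D⁺(B ⊗ E^op) ⥤ D⁺(A ⊗ E^op)` is the derived cotensor product `X □_B^R -`, i.e. the total
right derived functor of `X □_B -`: with a suitable natural transformation, it is the left Kan
extension of `H⁺(B ⊗ E^op) ⥤ H⁺(A ⊗ E^op) ⥤ D⁺(A ⊗ E^op)` along `H⁺(B ⊗ E^op) ⥤ D⁺(B ⊗ E^op)`.
This determines `R` up to a unique isomorphism. -/
def IsDerivedCotensor (X : Bicomod A B) (hX : X.IsBoundedBelow)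
    (R : DPlus B E ⥤ DPlus A E) : Prop :=
  ∃ α : X.cotensorHPlus hX E ⋙ HtoDPlus A E ⟶ HtoDPlus B E ⋙ R, R.IsLeftKanExtension α

/-- The shift functor on the homotopy category. -/
def shiftH (A B : DGCoalg k) : HCat A B ⥤ HCat A B :=
  CategoryTheory.Quotient.lift _ (shiftFunctor A B ⋙ toH A B) fun _ _ _ _ h =>
    CategoryTheory.Quotient.sound _ (shift_homotopic h)

lemma shiftH_inverts (A B : DGCoalg k) :
    (quasiIso A B).IsInvertedBy (shiftH A B ⋙ HtoD A B) := by
  rintro M N φ ⟨f, rfl, hf⟩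
  exact MorphismProperty.Q_inverts _ _ ⟨(shiftFunctor A B).map f, rfl, shift_quasiIso f hf⟩

/-- The shift functor on the derived category. -/
def shiftD (A B : DGCoalg k) : DCat A B ⥤ DCat A B :=
  Localization.lift (shiftH A B ⋙ HtoD A B) (shiftH_inverts A B) (HtoD A B)

/-- The shift of (the image in the derived category of) `M` is the image of `M[-1]`. -/
def shiftDIso (M : Bicomod A B) : (shiftD A B).obj ((toD A B).obj M) ≅ (toD A B).obj M.shift :=
  (Localization.fac (shiftH A B ⋙ HtoD A B) (shiftH_inverts A B) (HtoD A B)).app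
    ((toH A B).obj M)

lemma shift_isBoundedBelow {M : Bicomod A B} (hM : M.IsBoundedBelow) :
    M.shift.IsBoundedBelow := by
  obtain ⟨a, ha⟩ := hM
  exact ⟨a - 1, fun n hn => ha (n + 1) (by omega)⟩

/-- The shift functor on `D⁺`. -/
def shiftDPlus (A B : DGCoalg k) : DPlus A B ⥤ DPlus A B :=
  (isPlusD A B).lift ((isPlusD A B).ι ⋙ shiftD A B) fun X => by
    obtain ⟨M, hM, ⟨e⟩⟩ := X.2
    exact ⟨M.shift, shift_isBoundedBelow hM, ⟨(shiftD A B).mapIso e ≪≫ shiftDIso M⟩⟩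

/-- The distinguished triangles of the derived category: the triangles which are isomorphic to
`M ⟶ N ⟶ cone u ⟶ M[-1]` for some morphism `u : M ⟶ N` of bicomodules. -/
def IsDistinguished {X Y Z : DCat A B} (f : X ⟶ Y) (g : Y ⟶ Z)
    (h : Z ⟶ (shiftD A B).obj X) : Prop :=
  ∃ (M N : Bicomod A B) (u : M ⟶ N) (a : X ≅ (toD A B).obj M) (b : Y ≅ (toD A B).obj N)
    (c : Z ≅ (toD A B).obj (cone u)),
    f ≫ b.hom = a.hom ≫ (toD A B).map u ∧ g ≫ c.hom = b.hom ≫ (toD A B).map (coneIn u) ∧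
      h ≫ (shiftD A B).map a.hom ≫ (shiftDIso M).hom = c.hom ≫ (toD A B).map (coneOut u)

/-- A functor `D⁺(A ⊗ B^op) ⥤ D⁺(A' ⊗ B'^op)` is triangulated if it commutes with the shift and
preserves distinguished triangles. -/
def IsTriangulated {A' B' : DGCoalg k} (F : DPlus A B ⥤ DPlus A' B') : Prop :=
  ∃ θ : shiftDPlus A B ⋙ F ≅ F ⋙ shiftDPlus A' B',
    ∀ (X Y Z : DPlus A B) (f : X ⟶ Y) (g : Y ⟶ Z) (h : Z ⟶ (shiftDPlus A B).obj X),
      IsDistinguished f.hom g.hom h.hom →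
        IsDistinguished (F.map f).hom (F.map g).hom (F.map h ≫ θ.hom.app X).hom

end Bicomod

/-- The left comodules over `C`, i.e. `Chain(C)`, as the bicomodules over `C` and the ground
field; the right coaction of the ground field is uniquely determined by its counit axiom. -/
abbrev LeftComod {k : Type u} [Field k] (C : DGCoalg k) : Type (u + 1) :=
  Bicomod C (DGCoalg.unit k)

/-- `D⁺(C)`. -/
abbrev DerivedPlus {k : Type u} [Field k] (C : DGCoalg k) : Type (u + 1) :=
  Bicomod.DPlus C (DGCoalg.unit k)

namespace DGCoalg.Hom

variable {k : Type u} [Field k] {C D : DGCoalg k} (f : C.Hom D)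

/-- The `D`-`C`-bicomodule `_fC`. -/
def leftBicomod : Bicomod D C := C.reg.corestrictLeft f

/-- The `C`-`D`-bicomodule `C_f`. -/
def rightBicomod : Bicomod C D := C.reg.corestrictRight f

lemma leftBicomod_isBoundedBelow (hC : C.IsPositive) : f.leftBicomod.IsBoundedBelow := ⟨0, hC⟩

lemma rightBicomod_isBoundedBelow (hC : C.IsPositive) : f.rightBicomod.IsBoundedBelow := ⟨0, hC⟩

end DGCoalg.Hom

end

/-! Cotensoring with `_fC` is corestriction along `f`: the coaction identifies a `C`-comodule `M`,
regarded over `D`, with `_fC □_C M` (`corToCotensor_bijective`). Corestriction leaves the underlying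
complex alone, so it preserves quasi-isomorphisms and needs no resolution to be derived
(`isDerivedCotensor_corDPlus`); shifts and cones are preserved through maps which are the identity
on elements (`isTriangulated_corDPlus`).

Cotensoring with `C_f` is coinduction, which plays the role of the right adjoint: the unit `M → C_f
□_D M` is the coaction and the counit `C_f □_D N → N` is given by the counit of `C`. The heart of
the matter is that this counit is a quasi-isomorphism when `N` is a resolution. For `N = D ⊗ V` one
has `C_f □_D N ≅ C ⊗ V`, the counit becomes `f ⊗ V`, and tensoring over a field preserves
quasi-isomorphisms (`coindCounitLin_cofree_isQuasiIso`). For the total object of a left bounded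
complex of such comodules, filter by the position in the complex (`coindCounitLin_tot_isQuasiIso`).

Resolutions come from cofree bicomodules `B ⊗ W ⊗ E`. Every bicomodule embeds in a cofree one;
iterating on cokernels gives a resolution, which stays left bounded because the coalgebras are
positively graded (`exists_cofreeResolution`), and its total object is quasi-isomorphic to the
original (`toTot_isQuasiIso`). An acyclic complex over a field has a linear contraction, and a
contraction followed by a map to the cogenerators `W` extends to a colinear homotopy; so maps from
acyclic bicomodules to cofree ones are null-homotopic (`cofree_isLocal`), and the same follows for
bounded total objects (`tot_isLocal`). Therefore maps into a resolution are the same in the homotopy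
category and in the derived category (`IsLocal.toD_map_bijective`), and the functor from `H⁺` to
`D⁺` has a right adjoint `resolve` with invertible counit. Precomposition with a right adjoint
computes left Kan extensions, so `resolve` followed by a cotensor product is the derived cotensor
product (`isDerivedCotensor_resolve`).

The composite of derived coinduction with corestriction is the identity by the statement about the
counit (`coindCorIso`). For the other composite, one triangle identity writes the map from the
corestriction of `M` to its resolution as the corestriction of `M → C_f □_D J` followed by the
counit; two of the three maps are quasi-isomorphisms, hence so is the third (`isIso_corCoindUnit`).
Finally, `f` itself is a bicolinear quasi-isomorphism from the corestriction of `C_f` to `D`, which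
gives the first assertion, and `_fC` is the corestriction of `C`, so that derived coinduction
returns `C`, which gives the second. -/

noncomputable section

/-! ### Complexes over a field: contractions, cones, homotopy inverses -/

namespace DGVect

variable {k : Type u} [Field k]

/-- The linear map which is given by `g n` in degree `n`. -/
def gradedLift (M : DGVect k) {V : Type*} [AddCommGroup V] [Module k V]
    (g : ℤ → M →ₗ[k] V) : M →ₗ[k] V :=
  DirectSum.toModule k ℤ V (fun n => g n ∘ₗ (M.gr n).subtype) ∘ₗ M.decomp.toLinearMap

lemma gradedLift_apply (M : DGVect k) {V : Type*} [AddCommGroup V] [Module k V]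
    (g : ℤ → M →ₗ[k] V) {n : ℤ} {x : M} (hx : x ∈ M.gr n) : M.gradedLift g x = g n x := by
  simp [gradedLift, M.decomp_apply hx]

/-- The cohomology of `M` vanishes. -/
def IsAcyclic (M : DGVect k) : Prop := ∀ x, M.d x = 0 → ∃ y, M.d y = x

lemma d_proj (M : DGVect k) (n : ℤ) (x : M) : M.d (M.proj n x) = M.proj (n + 1) (M.d x) := by
  refine LinearMap.congr_fun (f := M.d ∘ₗ M.proj n) (g := M.proj (n + 1) ∘ₗ M.d) (M.hom_ext ?_) x
  intro m y hy
  simp only [LinearMap.comp_apply]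
  by_cases h : m = n
  · subst h; rw [proj_same M hy, proj_same M (M.d_mem _ _ hy)]
  · rw [proj_ne M h hy, proj_ne M (by omega) (M.d_mem _ _ hy), map_zero]

lemma IsAcyclic.exists_homogeneous {M : DGVect k} (hM : M.IsAcyclic) {n : ℤ} {x : M}
    (hx : x ∈ M.gr (n + 1)) (hd : M.d x = 0) : ∃ y ∈ M.gr n, M.d y = x := by
  obtain ⟨y, rfl⟩ := hM x hd
  exact ⟨M.proj n y, M.proj_mem n y, by rw [d_proj, proj_same M hx]⟩

/-- The homogeneous components of a cycle are cycles, there are finitely many nonzero ones, and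
their primitives can be added. -/
lemma isAcyclic_of_homogeneous {M : DGVect k}
    (h : ∀ n, ∀ x ∈ M.gr n, M.d x = 0 → ∃ y, M.d y = x) : M.IsAcyclic := by
  classical
  intro x hx
  have key : ∀ n, ∃ y, M.d y = M.proj n x := fun n => by
    refine h n _ (M.proj_mem n x) ?_
    rw [d_proj, hx, map_zero]
  choose y hy using key
  have hsum : x = ∑ n ∈ (M.decomp x).support, M.proj n x := by
    have h1 : ∀ z : DirectSum ℤ fun i => M.gr i, ∀ n,
        M.proj n (DirectSum.coeLinearMap M.gr z) = z n := by
      intro z n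
      induction z using DirectSum.induction_on with
      | zero => simp
      | of i y =>
        rw [DirectSum.coeLinearMap_of]
        by_cases h : i = n
        · subst h; rw [proj_same M y.2, DirectSum.of_eq_same]
        · rw [proj_ne M h y.2, DirectSum.of_eq_of_ne _ _ _ (Ne.symm h)]; rfl
      | add y z hy hz => rw [map_add, map_add, hy, hz]; rfl
    have h2 : DirectSum.coeLinearMap M.gr (M.decomp x) = x := M.decomp.symm_apply_apply x
    conv_lhs => rw [← h2, DirectSum.coeLinearMap_eq_dfinsuppSum]
    refine Finset.sum_congr rfl fun n _ => ?_
    conv_rhs => rw [← h2, h1]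
  refine ⟨∑ n ∈ (M.decomp x).support, y n, ?_⟩
  rw [map_sum, Finset.sum_congr rfl fun n _ => hy n, ← hsum]

/-- Over a field the surjection `d` onto the cycles has a linear section `t`, and `s₀ = t ∘ (id - t
d)` is a contraction. It need not be homogeneous; keeping only its part of degree `-1` does not
spoil the identity, because `d` commutes with the projections up to the shift of degree. -/
lemma IsAcyclic.exists_contraction {M : DGVect k} (hM : M.IsAcyclic) :
    ∃ s : M →ₗ[k] M, IsGraded M M (-1) s ∧ ∀ x, M.d (s x) + s (M.d x) = x := by
  obtain ⟨t, ht⟩ := (M.d.codRestrict (LinearMap.ker M.d) M.d_d).exists_rightInverse_of_surjective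
    (LinearMap.range_eq_top.2 fun x => (hM x.1 x.2).imp fun y hy => Subtype.ext hy)
  have ht' : ∀ z, M.d (t z) = z := fun z => congrArg Subtype.val (LinearMap.congr_fun ht z)
  let p : M →ₗ[k] LinearMap.ker M.d :=
    (LinearMap.id - t ∘ₗ M.d.codRestrict (LinearMap.ker M.d) M.d_d).codRestrict _ fun x =>
      (map_sub M.d x _).trans (by rw [LinearMap.comp_apply, ht']; exact sub_self _)
  let s₀ := t ∘ₗ p
  have hs : ∀ x, M.d (s₀ x) + s₀ (M.d x) = x := by
    intro x
    have h1 : M.d (s₀ x) = x - t (M.d.codRestrict (LinearMap.ker M.d) M.d_d x) := ht' _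
    have h2 : p (M.d x) = M.d.codRestrict (LinearMap.ker M.d) M.d_d x := by
      apply Subtype.ext
      change M.d x - t (M.d.codRestrict (LinearMap.ker M.d) M.d_d (M.d x)) = M.d x
      have : M.d.codRestrict (LinearMap.ker M.d) M.d_d (M.d x) = 0 := Subtype.ext (M.d_d x)
      rw [this, map_zero, sub_zero]
    rw [h1, LinearMap.comp_apply, h2, sub_add_cancel]
  refine ⟨M.gradedLift fun n => M.proj (n + -1) ∘ₗ s₀, fun n x hx => ?_, fun x => ?_⟩
  · rw [gradedLift_apply M _ hx]
    exact M.proj_mem _ _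
  · refine LinearMap.congr_fun (f := M.d ∘ₗ M.gradedLift (fun n => M.proj (n + -1) ∘ₗ s₀) +
      M.gradedLift (fun n => M.proj (n + -1) ∘ₗ s₀) ∘ₗ M.d) (g := LinearMap.id)
      (M.hom_ext fun n y hy => ?_) x
    simp only [LinearMap.add_apply, LinearMap.comp_apply, LinearMap.id_apply]
    rw [gradedLift_apply M _ hy, gradedLift_apply M _ (M.d_mem n y hy), LinearMap.comp_apply,
      LinearMap.comp_apply, d_proj, neg_add_cancel_right, add_neg_cancel_right,
      LinearMap.comp_apply (M.proj n) s₀ (M.d y), ← map_add]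
    exact (congrArg (M.proj n) (hs y)).trans (proj_same M hy)

lemma IsHom.comm_apply {M N : DGVect k} {f : M →ₗ[k] N} (hf : IsHom M N f) (x : M) :
    f (M.d x) = N.d (f x) := LinearMap.congr_fun hf.comm x

/-- A direct chase in place of the long exact sequence: a cycle `(x, y)` of the cone is a cycle `x`
together with a witness that `f x` is a boundary. -/
lemma isQuasiIso_iff_isAcyclic_cone {M N : DGVect k} {f : M →ₗ[k] N} (hf : IsHom M N f) :
    IsQuasiIso hf ↔ (cone M N f hf).IsAcyclic := by
  have hd : ∀ x y, (cone M N f hf).d (x, y) = (-M.d x, f x + N.d y) := fun _ _ => rfl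
  rw [isQuasiIso_iff]
  constructor
  · rintro ⟨h1, h2⟩ ⟨x, y⟩ hxy
    rw [hd, Prod.mk_eq_zero, neg_eq_zero] at hxy
    obtain ⟨x', hx'⟩ := h1 x hxy.1 ⟨-y, by rw [map_neg]; exact (eq_neg_of_add_eq_zero_left hxy.2).symm⟩
    obtain ⟨c, hc, y', hy'⟩ := h2 (y + f x') (by
      rw [map_add, ← hf.comm_apply, hx', add_comm]; exact hxy.2)
    refine ⟨(c - x', -y'), ?_⟩
    rw [hd, map_neg, hy', map_sub, map_sub, hc, hx']
    ext
    · simp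
    · simp
  · intro h
    refine ⟨fun x hx hy => ?_, fun y hy => ?_⟩
    · obtain ⟨y, hy⟩ := hy
      obtain ⟨⟨x', y'⟩, h'⟩ := h (x, -y) (by rw [hd]; simp [hx, hy])
      rw [hd, Prod.mk.injEq] at h'
      exact ⟨-x', by rw [map_neg, h'.1]⟩
    · obtain ⟨⟨x', y'⟩, h'⟩ := h (0, y) (by rw [hd]; simp [hy])
      rw [hd, Prod.mk.injEq, neg_eq_zero] at h'
      exact ⟨x', h'.1, -y', by rw [map_neg, ← h'.2]; abel⟩

lemma isQuasiIso_of_homotopyInverse {M N : DGVect k} {f : M →ₗ[k] N} (hf : IsHom M N f)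
    {g : N →ₗ[k] M} (hg : IsHom N M g) (h : M →ₗ[k] M) (h' : N →ₗ[k] N)
    (hh : ∀ x, g (f x) = x + M.d (h x) + h (M.d x))
    (hh' : ∀ y, f (g y) = y + N.d (h' y) + h' (N.d y)) : IsQuasiIso hf := by
  rw [isQuasiIso_iff]
  refine ⟨fun x hx hy => ?_, fun y hy => ?_⟩
  · obtain ⟨y, hy⟩ := hy
    refine ⟨g y - h x, ?_⟩
    rw [map_sub, ← hg.comm_apply, hy, hh, hx, map_zero]
    abel
  · exact ⟨g y, by rw [← hg.comm_apply, hy, map_zero], h' y, by rw [hh', hy, map_zero]; abel⟩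

/-- The inverse and the two homotopies are matrix entries of a contraction `S` of the cone: `g` is
the entry from `N` to `M`, `h` the one from `M` to `M`, and `h'` minus the one from `N` to `N`. The
contraction identity, read entry by entry, gives all the relations. -/
lemma IsQuasiIso.exists_homotopyInverse {M N : DGVect k} {f : M →ₗ[k] N} {hf : IsHom M N f}
    (hq : IsQuasiIso hf) : ∃ (g : N →ₗ[k] M) (h : M →ₗ[k] M) (h' : N →ₗ[k] N), IsHom N M g ∧
      IsGraded M M (-1) h ∧ IsGraded N N (-1) h' ∧
      (∀ x, g (f x) = x + M.d (h x) + h (M.d x)) ∧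
      (∀ y, f (g y) = y + N.d (h' y) + h' (N.d y)) := by
  obtain ⟨s, hs, hds⟩ := ((isQuasiIso_iff_isAcyclic_cone hf).1 hq).exists_contraction
  have hd : ∀ z, (cone M N f hf).d z = (-M.d z.1, f z.1 + N.d z.2) := fun _ => rfl
  let S : M × N →ₗ[k] M × N := s
  have h1 : ∀ y, S (0, y) = ((LinearMap.fst k M N ∘ₗ S ∘ₗ LinearMap.inr k M N) y,
    (LinearMap.snd k M N ∘ₗ S ∘ₗ LinearMap.inr k M N) y) := fun _ => rfl
  have h2 : ∀ x, (S (x, 0)).1 = (LinearMap.fst k M N ∘ₗ S ∘ₗ LinearMap.inl k M N) x := fun _ => rfl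
  have key1 : ∀ y, (-M.d (S (0, y)).1, f (S (0, y)).1 + N.d (S (0, y)).2) + S (0, N.d y) =
      (0, y) := fun y => by
    have := hds (0, y)
    rwa [hd, hd, map_zero, neg_zero, map_zero, zero_add] at this
  have key2 : ∀ x, -M.d (S (x, 0)).1 + (S (-M.d x, f x)).1 = x := fun x => by
    have := congrArg Prod.fst (hds (x, 0))
    rw [hd, hd, map_zero, add_zero] at this
    exact this
  refine ⟨LinearMap.fst k M N ∘ₗ S ∘ₗ LinearMap.inr k M N,
    LinearMap.fst k M N ∘ₗ S ∘ₗ LinearMap.inl k M N,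
    -(LinearMap.snd k M N ∘ₗ S ∘ₗ LinearMap.inr k M N), ⟨fun n y hy => ?_, ?_⟩, fun n x hx => ?_,
    fun n y hy => ?_, fun x => ?_, fun y => ?_⟩
  · have := (hs n (0, y) ⟨zero_mem _, hy⟩).1
    rwa [neg_add_cancel_right] at this
  · ext y
    have := congrArg Prod.fst (key1 y)
    rw [h1, h1] at this
    simp only [Prod.fst_add] at this
    exact (neg_add_eq_zero.1 this).symm
  · have := (hs (n + -1) (x, 0) ⟨by rwa [neg_add_cancel_right], zero_mem _⟩).1
    rwa [neg_add_cancel_right] at this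
  · exact neg_mem (hs n (0, y) ⟨zero_mem _, hy⟩).2
  · have h3 : S (-M.d x, f x) = -S (M.d x, 0) + S (0, f x) := by
      rw [← map_neg S, ← map_add S]; simp
    have := key2 x
    rw [h3, Prod.fst_add, Prod.fst_neg, h1, h2, h2] at this
    conv_rhs => arg 1; arg 1; rw [← this]
    simp only
    abel
  · have := congrArg Prod.snd (key1 y)
    rw [h1, h1] at this
    simp only [Prod.snd_add] at this
    conv_rhs => arg 1; arg 1; rw [← this]
    simp only [LinearMap.neg_apply, map_neg]
    abel

lemma IsGraded.sgn_apply_neg_one {M N : DGVect k} {h : M →ₗ[k] N} (hh : IsGraded M N (-1) h)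
    (x : M) : N.sgn (h x) = -h (M.sgn x) := by
  have := LinearMap.congr_fun (sgn_comp hh) x
  simpa using this

/-- Homotopy equivalences survive any additive construction, which spares the Künneth formula. The
homotopy `h ⊗ V` needs no sign: since `h` has odd degree, the two terms which involve the
differential of `V` cancel. -/
lemma IsQuasiIso.rTensor {M N : DGVect k} {f : M →ₗ[k] N} {hf : IsHom M N f}
    (hq : IsQuasiIso hf) (V : DGVect k) : IsQuasiIso (hf.rTensor V) := by
  obtain ⟨g, h, h', hg, hh, hh', e, e'⟩ := hq.exists_homotopyInverse
  have key : ∀ {P : DGVect k} {φ h : P →ₗ[k] P}, IsGraded P P (-1) h →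
      (∀ x, φ x = x + P.d (h x) + h (P.d x)) → ∀ x, φ.rTensor V x =
        x + (P.tensor V).d (h.rTensor V x) + h.rTensor V ((P.tensor V).d x) := by
    intro P φ h hh e x
    refine LinearMap.congr_fun (f := φ.rTensor V) (g := LinearMap.id + (P.tensor V).d ∘ₗ
      h.rTensor V + h.rTensor V ∘ₗ (P.tensor V).d) (TensorProduct.ext' fun x v => ?_) x
    simp only [LinearMap.rTensor_tmul, e, LinearMap.add_apply, LinearMap.comp_apply, map_add,
      TensorProduct.map_tmul, hh.sgn_apply_neg_one, LinearMap.id_apply, TensorProduct.add_tmul,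
      TensorProduct.neg_tmul]
    abel
  refine isQuasiIso_of_homotopyInverse _ (hg.rTensor V) (h.rTensor V) (h'.rTensor V)
    (fun x => ?_) (fun x => ?_)
  · rw [← key (φ := g ∘ₗ f) hh e, LinearMap.rTensor_comp_apply]
  · rw [← key (φ := f ∘ₗ g) hh' e', LinearMap.rTensor_comp_apply]

lemma homologyMap_comp {M N P : DGVect k} {f : M →ₗ[k] N} {g : N →ₗ[k] P} (hf : IsHom M N f)
    (hg : IsHom N P g) (x : M.homology) :
    homologyMap (hg.comp hf) x = homologyMap hg (homologyMap hf x) := by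
  obtain ⟨x, rfl⟩ := Submodule.Quotient.mk_surjective _ x
  rfl

lemma homologyMap_id (M : DGVect k) (x : M.homology) : homologyMap (IsHom.id M) x = x := by
  obtain ⟨x, rfl⟩ := Submodule.Quotient.mk_surjective _ x
  rfl

lemma IsQuasiIso.comp {M N P : DGVect k} {f : M →ₗ[k] N} {g : N →ₗ[k] P} {hf : IsHom M N f}
    {hg : IsHom N P g} (h : IsQuasiIso hf) (h' : IsQuasiIso hg) : IsQuasiIso (hg.comp hf) := by
  have : ⇑(homologyMap (hg.comp hf)) = homologyMap hg ∘ homologyMap hf :=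
    funext (homologyMap_comp hf hg)
  rw [IsQuasiIso, this]
  exact Function.Bijective.comp h' h

lemma IsQuasiIso.of_comp_left {M N P : DGVect k} {f : M →ₗ[k] N} {g : N →ₗ[k] P}
    {hf : IsHom M N f} {hg : IsHom N P g} (h : IsQuasiIso hg) (h' : IsQuasiIso (hg.comp hf)) :
    IsQuasiIso hf := by
  have : ⇑(homologyMap (hg.comp hf)) = homologyMap hg ∘ homologyMap hf :=
    funext (homologyMap_comp hf hg)
  rw [IsQuasiIso, this] at h'
  exact (Function.Bijective.of_comp_iff' h _).1 h'

lemma isQuasiIso_of_bijective {M N : DGVect k} {f : M →ₗ[k] N} (hf : IsHom M N f)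
    (h : Function.Bijective f) : IsQuasiIso hf := by
  have hg := IsHom.symm (LinearEquiv.ofBijective f h) hf
  refine isQuasiIso_of_homotopyInverse hf hg 0 0 (fun x => ?_) (fun y => ?_)
  · simp
  · simp

/-- A complex is acyclic if it has a decreasing filtration, eventually zero in each degree, such
that each cycle can be pushed into the next step by a boundary. -/
lemma isAcyclic_of_filtration {M : DGVect k} (F : ℕ → Submodule k M) (h0 : F 0 = ⊤)
    (hs : ∀ m, ∃ n, ∀ x ∈ M.gr m, x ∈ F n → x = 0)
    (hF : ∀ n m, ∀ x ∈ M.gr (m + 1), x ∈ F n → M.d x = 0 → ∃ w ∈ M.gr m, x - M.d w ∈ F (n + 1)) :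
    M.IsAcyclic := by
  refine isAcyclic_of_homogeneous fun m x hx hd => ?_
  obtain ⟨m, rfl⟩ : ∃ m', m = m' + 1 := ⟨m - 1, by omega⟩
  -- The corrections accumulate into one element `w` of fixed degree. No limit is needed, because in
  -- degree `m + 1` the filtration reaches zero after finitely many steps.
  have key : ∀ n, ∃ w ∈ M.gr m, x - M.d w ∈ F n := by
    intro n
    induction n with
    | zero => exact ⟨0, zero_mem _, by rw [h0]; trivial⟩
    | succ n ih =>
      obtain ⟨w, hw, hwF⟩ := ih
      obtain ⟨v, hv, hvF⟩ := hF n m _ (sub_mem hx (M.d_mem _ _ hw)) hwF (by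
        rw [map_sub, hd, M.d_d, sub_zero])
      exact ⟨w + v, add_mem hw hv, by rwa [map_add, ← sub_sub]⟩
  obtain ⟨n, hn⟩ := hs (m + 1)
  obtain ⟨w, hw, hwF⟩ := key n
  exact ⟨w, (sub_eq_zero.1 (hn _ (sub_mem hx (M.d_mem _ _ hw)) hwF)).symm⟩

end DGVect

/-! ### Cokernels, the inverse shift and odd bicolinear maps -/

namespace DGVect

variable {k : Type u} [Field k]

/-- The quotient of a differential graded vector space by the image of a morphism. -/
abbrev coker {M N : DGVect k} {f : M →ₗ[k] N} (hf : IsHom M N f) : DGVect k where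
  carrier := N ⧸ LinearMap.range f
  gr n := (N.gr n).map (LinearMap.range f).mkQ
  internal := isInternal_of_proj
    (fun n => Submodule.mapQ _ _ (N.proj n) (by
      rintro _ ⟨x, rfl⟩
      exact ⟨M.proj n x, (proj_graded hf.mem n x).symm⟩))
    (by
      rintro n _ ⟨x, hx, rfl⟩
      rw [Submodule.mkQ_apply, Submodule.mapQ_apply, proj_same N hx])
    (by
      rintro m n h _ ⟨x, hx, rfl⟩
      rw [Submodule.mkQ_apply, Submodule.mapQ_apply, proj_ne N h hx, Submodule.Quotient.mk_zero])
    (fun x => by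
      obtain ⟨x, rfl⟩ := Submodule.mkQ_surjective _ x
      rw [← Submodule.map_iSup, N.internal.submodule_iSup_eq_top]
      exact ⟨x, trivial, rfl⟩)
  d := Submodule.mapQ _ _ N.d (by
    rintro _ ⟨x, rfl⟩
    exact ⟨M.d x, hf.comm_apply x⟩)
  d_mem := by
    rintro n _ ⟨x, hx, rfl⟩
    exact ⟨N.d x, N.d_mem n x hx, rfl⟩
  d_d x := by
    obtain ⟨x, rfl⟩ := Submodule.mkQ_surjective _ x
    rw [Submodule.mkQ_apply, Submodule.mapQ_apply, Submodule.mapQ_apply, N.d_d,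
      Submodule.Quotient.mk_zero]

lemma isHom_mkQ {M N : DGVect k} {f : M →ₗ[k] N} (hf : IsHom M N f) :
    IsHom N (coker hf) (LinearMap.range f).mkQ :=
  ⟨fun _ x hx => ⟨x, hx, rfl⟩, rfl⟩

lemma IsHom.of_comp_surjective {M N P : DGVect k} {p : M →ₗ[k] N} {f : N →ₗ[k] P}
    (hp : IsHom M N p) (hs : Function.Surjective p)
    (h : IsHom M P (f ∘ₗ p)) : IsHom N P f where
  mem n x hx := by
    obtain ⟨y, rfl⟩ := hs x
    rw [← proj_same N hx, proj_graded hp.mem]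
    exact h.mem n _ (M.proj_mem n y)
  comm := by
    rw [← LinearMap.cancel_right hs, LinearMap.comp_assoc, ← hp.comm, ← LinearMap.comp_assoc,
      h.comm]
    rfl

/-- The differential graded vector space `M[1]`, with `M[1]_n = M_{n-1}`. -/
abbrev unshift (M : DGVect k) : DGVect k where
  carrier := M
  gr n := M.gr (n - 1)
  internal := isInternal_of_proj (fun n => M.proj (n - 1)) (fun n x hx => M.proj_same hx)
    (fun m n h x hx => M.proj_ne (by omega) hx) (fun x => by
      have h : iSup M.gr ≤ ⨆ n, M.gr (n - 1) := iSup_le fun n y hy =>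
        Submodule.mem_iSup_of_mem (n + 1) (by simpa using hy)
      rw [M.internal.submodule_iSup_eq_top] at h
      exact h trivial)
  d := -M.d
  d_mem n x hx := by
    have := M.d_mem _ x hx
    rw [sub_add_cancel] at this
    rw [add_sub_cancel_right]
    exact neg_mem this
  d_d x := by simp [M.d_d]

lemma isGraded_unshift (M : DGVect k) : IsGraded M M.unshift 1 LinearMap.id := fun n x hx => by
  show x ∈ M.gr (n + 1 - 1)
  rwa [add_sub_cancel_right]

lemma sgn_unshift (M : DGVect k) : M.unshift.sgn = -M.sgn := by
  simpa using sgn_comp M.isGraded_unshift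

end DGVect

namespace Bicomod

variable {k : Type u} [Field k] {A B E : DGCoalg k}

/-- The cokernel of a morphism of bicomodules. -/
def coker {M N : Bicomod A B} (f : M ⟶ N) : Bicomod A B where
  toDGVect := DGVect.coker f.isHom
  lco := Submodule.liftQ _ ((LinearMap.range f.toLin).mkQ.lTensor A.carrier ∘ₗ N.lco) (by
    rintro _ ⟨x, rfl⟩
    have h : (LinearMap.range f.toLin).mkQ ∘ₗ f.toLin = 0 := LinearMap.range_mkQ_comp _
    have h' : ((LinearMap.range f.toLin).mkQ.lTensor A.carrier ∘ₗ N.lco) ∘ₗ f.toLin = 0 := by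
      rw [LinearMap.comp_assoc, f.lco_comp, ← LinearMap.comp_assoc, ← LinearMap.lTensor_comp, h,
        LinearMap.lTensor_zero, LinearMap.zero_comp]
    exact LinearMap.congr_fun h' x)
  rco := Submodule.liftQ _ ((LinearMap.range f.toLin).mkQ.rTensor B.carrier ∘ₗ N.rco) (by
    rintro _ ⟨x, rfl⟩
    have h : (LinearMap.range f.toLin).mkQ ∘ₗ f.toLin = 0 := LinearMap.range_mkQ_comp _
    have h' : ((LinearMap.range f.toLin).mkQ.rTensor B.carrier ∘ₗ N.rco) ∘ₗ f.toLin = 0 := by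
      rw [LinearMap.comp_assoc, f.rco_comp, ← LinearMap.comp_assoc, ← LinearMap.rTensor_comp, h,
        LinearMap.rTensor_zero, LinearMap.zero_comp]
    exact LinearMap.congr_fun h' x)
  lco_hom := DGVect.IsHom.of_comp_surjective (DGVect.isHom_mkQ f.isHom) (Submodule.mkQ_surjective _)
    (by
      erw [Submodule.liftQ_mkQ]
      exact ((DGVect.isHom_mkQ f.isHom).lTensor A.toDGVect).comp N.lco_hom)
  rco_hom := DGVect.IsHom.of_comp_surjective (DGVect.isHom_mkQ f.isHom) (Submodule.mkQ_surjective _)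
    (by
      erw [Submodule.liftQ_mkQ]
      exact ((DGVect.isHom_mkQ f.isHom).rTensor B.toDGVect).comp N.rco_hom)
  lco_coassoc := (LinearMap.cancel_right (Submodule.mkQ_surjective _)).1
    (push_lco_coassoc (Submodule.liftQ_mkQ _ _ _) N.lco_coassoc)
  rco_coassoc := (LinearMap.cancel_right (Submodule.mkQ_surjective _)).1
    (push_rco_coassoc (Submodule.liftQ_mkQ _ _ _) N.rco_coassoc)
  lco_counit := (LinearMap.cancel_right (Submodule.mkQ_surjective _)).1
    (push_lco_counit (Submodule.liftQ_mkQ _ _ _) N.lco_counit)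
  rco_counit := (LinearMap.cancel_right (Submodule.mkQ_surjective _)).1
    (push_rco_counit (Submodule.liftQ_mkQ _ _ _) N.rco_counit)
  lco_rco := (LinearMap.cancel_right (Submodule.mkQ_surjective _)).1
    (push_lco_rco (Submodule.liftQ_mkQ _ _ _) (Submodule.liftQ_mkQ _ _ _) N.lco_rco)

/-- The projection to the cokernel. -/
def cokerπ {M N : Bicomod A B} (f : M ⟶ N) : N ⟶ coker f where
  toLin := (LinearMap.range f.toLin).mkQ
  isHom := DGVect.isHom_mkQ f.isHom
  lco_comp := Submodule.liftQ_mkQ _ _ _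
  rco_comp := Submodule.liftQ_mkQ _ _ _

/-- The bicomodule `M[1]`, with `M[1]_n = M_{n-1}` and differential `-d`. -/
def unshift (M : Bicomod A B) : Bicomod A B where
  toDGVect := M.toDGVect.unshift
  lco := A.sgn.rTensor M.carrier ∘ₗ M.lco
  rco := M.rco
  lco_hom :=
    { mem := fun n x hx => by
        have h := DGVect.IsGraded.map (M := A.toDGVect) (e := 0)
          (fun n x hx => by rw [add_zero]; exact A.sgn_mem n x hx)
          M.isGraded_unshift (n - 1) _ (M.lco_hom.mem (n - 1) x hx)
        rw [show n - 1 + (0 + 1) = n by ring] at h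
        exact h
      comm := M.shift.lco_hom.comm }
  rco_hom :=
    { mem := fun n x hx => by
        have h := DGVect.IsGraded.map M.isGraded_unshift (DGVect.IsHom.id B.toDGVect).graded
          (n - 1) _ (M.rco_hom.mem (n - 1) x hx)
        rw [show n - 1 + (1 + 0) = n by ring, TensorProduct.map_id] at h
        exact h
      comm := by
        have h1 : (M.toDGVect.unshift.tensor B.toDGVect).d =
            -(M.toDGVect.tensor B.toDGVect).d := by
          ext x y
          simp [DGVect.sgn_unshift, TensorProduct.neg_tmul, add_comm]
        show M.rco ∘ₗ (-M.d) = _ ∘ₗ M.rco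
        rw [h1, LinearMap.comp_neg, M.rco_hom.comm]
        rfl }
  lco_coassoc := M.shift.lco_coassoc
  rco_coassoc := M.rco_coassoc
  lco_counit := M.shift.lco_counit
  rco_counit := M.rco_counit
  lco_rco := M.shift.lco_rco

/-- Bicolinear maps of odd degree `e`, with the Koszul sign for the left coaction. -/
structure IsOdd (M N : Bicomod A B) (e : ℤ) (h : M.carrier →ₗ[k] N.carrier) : Prop where
  graded : DGVect.IsGraded M.toDGVect N.toDGVect e h
  lco : N.lco ∘ₗ h = TensorProduct.map A.sgn h ∘ₗ M.lco
  rco : N.rco ∘ₗ h = h.rTensor B.carrier ∘ₗ M.rco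

/-- The sign in the left coaction of the shifted bicomodule is exactly the Koszul sign demanded of
an odd map. -/
lemma isOdd_unshift (M : Bicomod A B) : IsOdd M M.unshift 1 LinearMap.id where
  graded := M.toDGVect.isGraded_unshift
  lco := rfl
  rco := comp_id_eq_map_id M.rco

lemma IsOdd.comp_hom {M N P : Bicomod A B} {e : ℤ} {h : N.carrier →ₗ[k] P.carrier}
    (hh : IsOdd N P e h) (f : M ⟶ N) : IsOdd M P e (h ∘ₗ f.toLin) where
  graded n x hx := hh.graded n _ (f.isHom.mem n x hx)
  lco := by
    rw [← LinearMap.comp_assoc, hh.lco, LinearMap.comp_assoc, f.lco_comp, ← LinearMap.comp_assoc]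
    congr 1
    ext; simp
  rco := by
    rw [← LinearMap.comp_assoc, hh.rco, LinearMap.comp_assoc, f.rco_comp, LinearMap.rTensor_comp,
      LinearMap.comp_assoc]

lemma IsOdd.hom_comp {M N P : Bicomod A B} {e : ℤ} {h : M.carrier →ₗ[k] N.carrier}
    (f : N ⟶ P) (hh : IsOdd M N e h) : IsOdd M P e (f.toLin ∘ₗ h) where
  graded n x hx := f.isHom.mem _ _ (hh.graded n x hx)
  lco := by
    rw [← LinearMap.comp_assoc, f.lco_comp, LinearMap.comp_assoc, hh.lco, ← LinearMap.comp_assoc]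
    congr 1
    ext; simp
  rco := by
    rw [← LinearMap.comp_assoc, f.rco_comp, LinearMap.comp_assoc, hh.rco, LinearMap.rTensor_comp,
      LinearMap.comp_assoc]

lemma IsOdd.zero (M N : Bicomod A B) (e : ℤ) : IsOdd M N e 0 where
  graded n x hx := zero_mem _
  lco := by rw [TensorProduct.map_zero_right]; simp
  rco := by simp

lemma IsOdd.neg {M N : Bicomod A B} {e : ℤ} {h : M.carrier →ₗ[k] N.carrier} (hh : IsOdd M N e h) :
    IsOdd M N e (-h) where
  graded n x hx := neg_mem (hh.graded n x hx)
  lco := by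
    rw [LinearMap.comp_neg, hh.lco, ← LinearMap.neg_comp]
    congr 1
    ext; simp [TensorProduct.tmul_neg]
  rco := by rw [LinearMap.comp_neg, hh.rco, LinearMap.rTensor_neg, LinearMap.neg_comp]

lemma IsOdd.add {M N : Bicomod A B} {e : ℤ} {h h' : M.carrier →ₗ[k] N.carrier}
    (hh : IsOdd M N e h) (hh' : IsOdd M N e h') : IsOdd M N e (h + h') where
  graded n x hx := add_mem (hh.graded n x hx) (hh'.graded n x hx)
  lco := by rw [LinearMap.comp_add, hh.lco, hh'.lco, ← LinearMap.add_comp, TensorProduct.map_add_right]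
  rco := by rw [LinearMap.comp_add, hh.rco, hh'.rco, LinearMap.rTensor_add, LinearMap.add_comp]

lemma homotopic_iff {M N : Bicomod A B} {f g : M ⟶ N} : Homotopic f g ↔
    ∃ h, IsOdd M N (-1) h ∧ f.toLin - g.toLin = h ∘ₗ M.d + N.d ∘ₗ h :=
  ⟨fun ⟨h, h1, h2, h3, h4⟩ => ⟨h, ⟨h1, h2, h3⟩, h4⟩,
    fun ⟨h, ⟨h1, h2, h3⟩, h4⟩ => ⟨h, h1, h2, h3, h4⟩⟩

/-- The coaction as a morphism `Y ⟶ B ⊗ Y`. -/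
def lcoHom (Y : Bicomod B E) : Y ⟶ B.reg.tensor Y where
  toLin := Y.lco
  isHom := Y.lco_hom
  lco_comp := Y.lco_coassoc
  rco_comp := cotensor_aux₃ _ _ Y.lco_rco

/-- The coaction as a morphism `Y ⟶ Y ⊗ E`. -/
def rcoHom (Y : Bicomod B E) : Y ⟶ Y.tensor E.reg where
  toLin := Y.rco
  isHom := Y.rco_hom
  lco_comp := Y.lco_rco
  rco_comp := by
    change ((TensorProduct.assoc k Y.carrier E.carrier E.carrier).symm.toLinearMap ∘ₗ
      (Coalgebra.comul (R := k)).lTensor Y.carrier) ∘ₗ Y.rco = _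
    rw [LinearMap.comp_assoc, ← Y.rco_coassoc]
    exact LinearMap.ext fun x => LinearEquiv.symm_apply_apply _ _

/-- The cofree bicomodule `B ⊗ Y ⊗ E`. -/
def cofree (Y : Bicomod B E) : Bicomod B E := B.reg.tensor (Y.tensor E.reg)

/-- The unit `Y ⟶ B ⊗ Y ⊗ E`. -/
def toCofree (Y : Bicomod B E) : Y ⟶ Y.cofree :=
  Y.lcoHom ≫ tensorMap B.reg Y.rcoHom

end Bicomod

/-! ### Counit contractions and cofree bicomodules -/

section TensorLemmas

variable {k : Type*} [Field k] {B W X E : Type*} [AddCommGroup B] [Module k B] [AddCommGroup W]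
  [Module k W] [AddCommGroup X] [Module k X] [AddCommGroup E] [Module k E]

/-- The map `B ⊗ W → W` given by a linear form on `B`. -/
def contractL (W : Type*) [AddCommGroup W] [Module k W] (ε : B →ₗ[k] k) : B ⊗[k] W →ₗ[k] W :=
  (TensorProduct.lid k W).toLinearMap ∘ₗ ε.rTensor W

@[simp]
lemma contractL_tmul (ε : B →ₗ[k] k) (b : B) (w : W) :
    contractL W ε (b ⊗ₜ[k] w) = ε b • w := by
  simp [contractL]

/-- The map `W ⊗ E → W` given by a linear form on `E`. -/
def contractR (W : Type*) [AddCommGroup W] [Module k W] (ε : E →ₗ[k] k) : W ⊗[k] E →ₗ[k] W :=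
  (TensorProduct.rid k W).toLinearMap ∘ₗ ε.lTensor W

@[simp]
lemma contractR_tmul (ε : E →ₗ[k] k) (w : W) (e : E) :
    contractR W ε (w ⊗ₜ[k] e) = ε e • w := by
  simp [contractR]

lemma contractL_comp {ε : B →ₗ[k] k} {ρ : W →ₗ[k] B ⊗[k] W}
    (h : ε.rTensor W ∘ₗ ρ = TensorProduct.mk k k W 1) : contractL W ε ∘ₗ ρ = LinearMap.id := by
  rw [contractL, LinearMap.comp_assoc, h]
  ext; simp

lemma contractR_comp {ε : E →ₗ[k] k} {ρ : W →ₗ[k] W ⊗[k] E}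
    (h : ε.lTensor W ∘ₗ ρ = (TensorProduct.mk k W k).flip 1) :
    contractR W ε ∘ₗ ρ = LinearMap.id := by
  rw [contractR, LinearMap.comp_assoc, h]
  ext; simp

lemma comp_contractL (ε : B →ₗ[k] k) (g : W →ₗ[k] X) :
    g ∘ₗ contractL W ε = contractL X ε ∘ₗ g.lTensor B := by
  ext; simp

/-- Contracting the middle factor of `B ⊗ B ⊗ W` is contracting the second factor of `B ⊗ B`, so
this is one counit axiom tensored with `W`. It recovers an element of a cofree comodule from its
coaction. -/
lemma contractL_lTensor_comul {δ : B →ₗ[k] B ⊗[k] B} {ε : B →ₗ[k] k}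
    (h : ε.lTensor B ∘ₗ δ = (TensorProduct.mk k B k).flip 1) :
    (contractL W ε).lTensor B ∘ₗ (TensorProduct.assoc k B B W).toLinearMap ∘ₗ δ.rTensor W =
      LinearMap.id := by
  have h1 : (contractL W ε).lTensor B ∘ₗ (TensorProduct.assoc k B B W).toLinearMap =
      (contractR B ε).rTensor W := by
    refine TensorProduct.ext_threefold fun b c w => ?_
    simp [TensorProduct.smul_tmul]
  rw [← LinearMap.comp_assoc, h1, ← LinearMap.rTensor_comp, contractR_comp h,
    LinearMap.rTensor_id]

lemma contractR_rTensor_comul {δ : E →ₗ[k] E ⊗[k] E} {ε : E →ₗ[k] k}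
    (h : ε.rTensor E ∘ₗ δ = TensorProduct.mk k k E 1) :
    (contractR W ε).rTensor E ∘ₗ (TensorProduct.assoc k W E E).symm.toLinearMap ∘ₗ δ.lTensor W =
      LinearMap.id := by
  have h1 : (contractR W ε).rTensor E ∘ₗ (TensorProduct.assoc k W E E).symm.toLinearMap =
      (contractL E ε).lTensor W := by
    ext; simp [TensorProduct.smul_tmul]
  rw [← LinearMap.comp_assoc, h1, ← LinearMap.lTensor_comp, contractL_comp h,
    LinearMap.lTensor_id]

/-- A bicolinear map to a cofree bicomodule is determined by its projection to the cogenerators. -/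
lemma eq_of_colinear_cofree {δ : B →ₗ[k] B ⊗[k] B} {ε : B →ₗ[k] k} {δ' : E →ₗ[k] E ⊗[k] E}
    {ε' : E →ₗ[k] k} (h : ε.lTensor B ∘ₗ δ = (TensorProduct.mk k B k).flip 1)
    (h' : ε'.rTensor E ∘ₗ δ' = TensorProduct.mk k k E 1)
    {ρ : X →ₗ[k] B ⊗[k] X} {σ : X →ₗ[k] X ⊗[k] E} {f : X →ₗ[k] B ⊗[k] (W ⊗[k] E)}
    (hl : ((TensorProduct.assoc k B B (W ⊗[k] E)).toLinearMap ∘ₗ δ.rTensor (W ⊗[k] E)) ∘ₗ f =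
      f.lTensor B ∘ₗ ρ)
    (hr : ((TensorProduct.assoc k B (W ⊗[k] E) E).symm.toLinearMap ∘ₗ
      ((TensorProduct.assoc k W E E).symm.toLinearMap ∘ₗ δ'.lTensor W).lTensor B) ∘ₗ f =
        f.rTensor E ∘ₗ σ) :
    f = ((contractR W ε' ∘ₗ contractL (W ⊗[k] E) ε ∘ₗ f).rTensor E).lTensor B ∘ₗ
      σ.lTensor B ∘ₗ ρ := by
  -- The same principle on the right: comultiplying in `E` and then projecting to the cogenerators
  -- leaves only the contraction in `B`.
  have h1 : (contractR W ε' ∘ₗ contractL (W ⊗[k] E) ε).rTensor E ∘ₗ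
      ((TensorProduct.assoc k B (W ⊗[k] E) E).symm.toLinearMap ∘ₗ
      ((TensorProduct.assoc k W E E).symm.toLinearMap ∘ₗ δ'.lTensor W).lTensor B) =
      contractL (W ⊗[k] E) ε := by
    have h2 : (contractL (W ⊗[k] E) ε).rTensor E ∘ₗ
        (TensorProduct.assoc k B (W ⊗[k] E) E).symm.toLinearMap =
        contractL ((W ⊗[k] E) ⊗[k] E) ε := by
      refine TensorProduct.ext' fun b z => ?_
      induction z using TensorProduct.induction_on with
      | zero => simp
      | tmul x e => simp [TensorProduct.smul_tmul']
      | add x y hx hy => simp only [TensorProduct.tmul_add, map_add, hx, hy]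
    rw [LinearMap.rTensor_comp, LinearMap.comp_assoc, ← LinearMap.comp_assoc _ _
      ((contractL (W ⊗[k] E) ε).rTensor E), h2, ← comp_contractL, ← LinearMap.comp_assoc,
      contractR_rTensor_comul h', LinearMap.id_comp]
  rw [← LinearMap.comp_assoc ρ, ← LinearMap.lTensor_comp, ← LinearMap.comp_assoc f,
    LinearMap.rTensor_comp, LinearMap.comp_assoc, ← hr, ← LinearMap.comp_assoc f, h1,
    LinearMap.lTensor_comp, LinearMap.comp_assoc, ← hl, ← LinearMap.comp_assoc f,
    contractL_lTensor_comul h, LinearMap.id_comp]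

end TensorLemmas

namespace DGCoalg

variable {k : Type u} [Field k]

lemma counit_d (B : DGCoalg k) (x : B.carrier) : Coalgebra.counit (R := k) (B.d x) = 0 :=
  (B.counit_hom.comm_apply x).trans rfl

lemma counit_sgn (B : DGCoalg k) (x : B.carrier) :
    Coalgebra.counit (R := k) (B.sgn x) = Coalgebra.counit (R := k) x := by
  refine LinearMap.congr_fun (f := Coalgebra.counit ∘ₗ B.sgn) (B.hom_ext fun n x hx => ?_) x
  have h1 : Coalgebra.counit (R := k) x ∈ (if n = 0 then ⊤ else ⊥ : Submodule k k) :=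
    B.counit_hom.mem n x hx
  rw [LinearMap.comp_apply, B.sgn_apply hx, map_smul]
  by_cases hn : n = 0
  · simp [hn]
  · rw [if_neg hn, Submodule.mem_bot] at h1
    rw [h1, smul_zero]

lemma comul_sgn (B : DGCoalg k) : Coalgebra.comul (R := k) ∘ₗ B.sgn =
    TensorProduct.map B.sgn B.sgn ∘ₗ Coalgebra.comul (R := k) := by
  rw [← B.comul_hom.sgn, DGVect.sgn_tensor]

lemma counit_eq_zero (B : DGCoalg k) {n : ℤ} (hn : n ≠ 0) {x : B.carrier} (hx : x ∈ B.gr n) :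
    Coalgebra.counit (R := k) x = 0 := by
  have h1 : Coalgebra.counit (R := k) x ∈ (if n = 0 then ⊤ else ⊥ : Submodule k k) :=
    B.counit_hom.mem n x hx
  rwa [if_neg hn, Submodule.mem_bot] at h1

lemma isHom_contractL (B : DGCoalg k) (V : DGVect k) : DGVect.IsHom (B.toDGVect.tensor V) V
    (contractL V (Coalgebra.counit (R := k) (A := B.carrier))) where
  mem n z hz := by
    have : DGVect.tensorGr B.toDGVect V n ≤ (V.gr n).comap
        (contractL V (Coalgebra.counit (R := k) (A := B.carrier))) :=
      DGVect.tensorGr_le fun p q h x hx y hy => by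
        rw [Submodule.mem_comap, contractL_tmul]
        by_cases hp : p = 0
        · rw [hp, zero_add] at h
          exact Submodule.smul_mem _ _ (h ▸ hy)
        · rw [B.counit_eq_zero hp hx, zero_smul]
          exact zero_mem _
    exact this hz
  comm := by
    ext
    simp [counit_d, counit_sgn]

lemma isHom_contractR (E : DGCoalg k) (V : DGVect k) : DGVect.IsHom (V.tensor E.toDGVect) V
    (contractR V (Coalgebra.counit (R := k) (A := E.carrier))) where
  mem n z hz := by
    have : DGVect.tensorGr V E.toDGVect n ≤ (V.gr n).comap
        (contractR V (Coalgebra.counit (R := k) (A := E.carrier))) :=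
      DGVect.tensorGr_le fun p q h x hx y hy => by
        rw [Submodule.mem_comap, contractR_tmul]
        by_cases hp : q = 0
        · rw [hp, add_zero] at h
          exact Submodule.smul_mem _ _ (h ▸ hx)
        · rw [E.counit_eq_zero hp hy, zero_smul]
          exact zero_mem _
    exact this hz
  comm := by
    ext
    simp [counit_d]

end DGCoalg

namespace Bicomod

variable {k : Type u} [Field k] {A B E : DGCoalg k}

/-- The projection `B ⊗ Y ⊗ E → Y` given by the counits. -/
def cofreeCounit (Y : Bicomod B E) : Y.cofree.carrier →ₗ[k] Y.carrier :=
  contractR Y.carrier (Coalgebra.counit (R := k) (A := E.carrier)) ∘ₗ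
    contractL (Y.carrier ⊗[k] E.carrier) (Coalgebra.counit (R := k) (A := B.carrier))

/-- Both counit axioms, applied one after the other. The retraction is a map of complexes but not
colinear; it is used to see that a bicomodule embeds in its cofree one. -/
lemma cofreeCounit_toCofree (Y : Bicomod B E) (y : Y.carrier) :
    Y.cofreeCounit (Y.toCofree.toLin y) = y := by
  have h : (contractR Y.carrier (Coalgebra.counit (R := k) (A := E.carrier)) ∘ₗ
      contractL (Y.carrier ⊗[k] E.carrier) (Coalgebra.counit (R := k) (A := B.carrier))) ∘ₗ
      Y.rco.lTensor B.carrier ∘ₗ Y.lco = LinearMap.id := by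
    rw [LinearMap.comp_assoc, ← LinearMap.comp_assoc Y.lco, ← comp_contractL, LinearMap.comp_assoc,
      contractL_comp Y.lco_counit, LinearMap.comp_id, contractR_comp Y.rco_counit]
  exact LinearMap.congr_fun h y

lemma toCofree_injective (Y : Bicomod B E) : Function.Injective Y.toCofree.toLin :=
  Function.LeftInverse.injective Y.cofreeCounit_toCofree

lemma isHom_cofreeCounit (Y : Bicomod B E) :
    DGVect.IsHom Y.cofree.toDGVect Y.toDGVect Y.cofreeCounit :=
  (E.isHom_contractR Y.toDGVect).comp (B.isHom_contractL (Y.toDGVect.tensor E.toDGVect))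

/-- The map `B ⊗ X ⊗ E → B ⊗ W ⊗ E` of odd degree given by a linear map `X → W`. -/
def cofreeOddMap {X W : Bicomod B E} (h : X.carrier →ₗ[k] W.carrier) :
    X.cofree.carrier →ₗ[k] W.cofree.carrier :=
  TensorProduct.map B.sgn (h.rTensor E.carrier)

lemma isOdd_cofreeOddMap {X W : Bicomod B E} {h : X.carrier →ₗ[k] W.carrier} {e : ℤ}
    (hh : DGVect.IsGraded X.toDGVect W.toDGVect e h) :
    IsOdd X.cofree W.cofree e (cofreeOddMap h) where
  graded n x hx := by
    have := DGVect.IsGraded.map (e := 0) (fun n x hx => by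
      rw [add_zero]; exact B.sgn_mem n x hx) (hh.map (DGVect.IsHom.id E.toDGVect).graded) n x hx
    rwa [add_zero, zero_add] at this
  lco := map_assoc_rTensor _ B.comul_sgn
  rco := map_assoc_lTensor _ (by
    change ((TensorProduct.assoc k W.carrier E.carrier E.carrier).symm.toLinearMap ∘ₗ
      (Coalgebra.comul (R := k)).lTensor W.carrier) ∘ₗ h.rTensor E.carrier =
      (h.rTensor E.carrier).rTensor E.carrier ∘ₗ
      ((TensorProduct.assoc k X.carrier E.carrier E.carrier).symm.toLinearMap ∘ₗ
      (Coalgebra.comul (R := k)).lTensor X.carrier)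
    refine TensorProduct.ext' fun x e => ?_
    simp only [LinearMap.comp_apply, LinearMap.rTensor_tmul, LinearMap.lTensor_tmul,
      LinearEquiv.coe_coe]
    induction (Coalgebra.comul (R := k) e) using TensorProduct.induction_on with
    | zero => simp
    | tmul a b => simp
    | add a b ha hb => simp only [TensorProduct.tmul_add, map_add, ha, hb])

/-- Cofree extension turns a linear null-homotopy of `g` into one of `B ⊗ g ⊗ E`. The sign
involution on `B` cancels the terms with the differential of `B`, and the odd degree of `h` those
with the differential of `E`. -/
lemma cofreeOddMap_d {X W : Bicomod B E} {h g : X.carrier →ₗ[k] W.carrier}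
    (hh : DGVect.IsGraded X.toDGVect W.toDGVect (-1) h)
    (hg : ∀ x, h (X.d x) + W.d (h x) = g x) (z : X.cofree.carrier) :
    cofreeOddMap h (X.cofree.d z) + W.cofree.d (cofreeOddMap h z) =
      (g.rTensor E.carrier).lTensor B.carrier z := by
  have key : TensorProduct.map B.sgn (h.rTensor E.carrier) ∘ₗ
      (B.toDGVect.tensor (X.toDGVect.tensor E.toDGVect)).d +
      (B.toDGVect.tensor (W.toDGVect.tensor E.toDGVect)).d ∘ₗ
      TensorProduct.map B.sgn (h.rTensor E.carrier) = (g.rTensor E.carrier).lTensor B.carrier := by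
    have h1 : ∀ x, B.sgn (B.d x) = -B.d (B.sgn x) := LinearMap.congr_fun B.sgn_d
    have h2 : ∀ x, B.sgn (B.sgn x) = x := LinearMap.congr_fun B.sgn_sgn
    ext b x e
    simp only [LinearMap.comp_apply, LinearMap.add_apply, AlgebraTensorModule.curry_apply,
      LinearMap.restrictScalars_self, TensorProduct.curry_apply, TensorProduct.map_tmul,
      LinearMap.id_apply, LinearMap.rTensor_tmul, LinearMap.lTensor_tmul, h1, h2, map_add,
      hh.sgn_apply_neg_one, TensorProduct.tmul_add, TensorProduct.neg_tmul, TensorProduct.tmul_neg,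
      ← hg, TensorProduct.add_tmul]
    abel
  exact LinearMap.congr_fun key z

/-- Each morphism from an acyclic bicomodule to `I` is null-homotopic. -/
def IsLocal (I : Bicomod A B) : Prop :=
  ∀ (X : Bicomod A B), X.IsAcyclic → ∀ f : X ⟶ I,
    ∃ h, IsOdd X I (-1) h ∧ ∀ x, f.toLin x = h (X.d x) + I.d (h x)

/-- A bicolinear map `f` to a cofree bicomodule is determined by its projection `g` to `W`. If `s`
is a linear contraction of `X`, then `g ∘ s` is a null-homotopy of `g`, and its colinear extension
is one of `f`. Acyclicity is thus used only at the level of vector spaces. -/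
lemma cofree_isLocal (W : Bicomod B E) : W.cofree.IsLocal := by
  intro X hX f
  obtain ⟨s, hs, hds⟩ := hX.exists_contraction
  let g : X.carrier →ₗ[k] W.carrier := W.cofreeCounit ∘ₗ f.toLin
  have hg : DGVect.IsHom X.toDGVect W.toDGVect g := W.isHom_cofreeCounit.comp f.isHom
  have hgr : DGVect.IsGraded X.toDGVect W.toDGVect (-1) (g ∘ₗ s) :=
    fun n x hx => hg.mem _ _ (hs n x hx)
  have hf : ∀ x, f.toLin x = (g.rTensor E.carrier).lTensor B.carrier (X.toCofree.toLin x) :=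
    LinearMap.congr_fun (eq_of_colinear_cofree (B := B.carrier) (E := E.carrier) (W := W.carrier)
      (X := X.carrier) (δ := Coalgebra.comul) (δ' := Coalgebra.comul) (ρ := X.lco) (σ := X.rco)
      (f := f.toLin) Coalgebra.lTensor_counit_comp_comul Coalgebra.rTensor_counit_comp_comul
      f.lco_comp f.rco_comp)
  refine ⟨cofreeOddMap (g ∘ₗ s) ∘ₗ X.toCofree.toLin, (isOdd_cofreeOddMap hgr).comp_hom _,
    fun x => ?_⟩
  rw [hf, ← cofreeOddMap_d hgr (g := g) (fun x => by
    rw [LinearMap.comp_apply g, LinearMap.comp_apply g, ← hg.comm_apply, ← map_add, add_comm, hds])]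
  rw [LinearMap.comp_apply, LinearMap.comp_apply, X.toCofree.isHom.comm_apply]

end Bicomod

/-! ### Total bicomodules of complexes of bicomodules -/

/-- A sequence of bicomodules with maps of degree `1` which form a complex and anticommute with
the differentials. -/
structure OddComplex {k : Type u} [Field k] (A B : DGCoalg k) where
  obj : ℕ → Bicomod A B
  δ : ∀ n, (obj n).carrier →ₗ[k] (obj (n + 1)).carrier
  isOdd : ∀ n, Bicomod.IsOdd (obj n) (obj (n + 1)) 1 (δ n)
  δ_d : ∀ n x, δ n ((obj n).d x) = -(obj (n + 1)).d (δ n x)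
  δ_δ : ∀ n x, δ (n + 1) (δ n x) = 0

namespace OddComplex

variable {k : Type u} [Field k] {A B : DGCoalg k} (K : OddComplex A B)

/-- The direct sum of the terms. -/
abbrev Sum : Type u := DirectSum ℕ fun n => (K.obj n).carrier

/-- The inclusion of the `n`-th term. -/
abbrev inc (n : ℕ) : (K.obj n).carrier →ₗ[k] K.Sum :=
  DirectSum.lof k ℕ (fun n => (K.obj n).carrier) n

/-- The projection to the `n`-th term. -/
abbrev pr (n : ℕ) : K.Sum →ₗ[k] (K.obj n).carrier :=
  DirectSum.component k ℕ (fun n => (K.obj n).carrier) n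

lemma pr_inc_same (n : ℕ) (x : (K.obj n).carrier) : K.pr n (K.inc n x) = x :=
  DirectSum.component.lof_self k _ _

lemma pr_inc_ne {m n : ℕ} (h : m ≠ n) (x : (K.obj n).carrier) : K.pr m (K.inc n x) = 0 := by
  classical
  rw [DirectSum.component.of, dif_neg h.symm]

lemma sum_ext {x y : K.Sum} (h : ∀ n, K.pr n x = K.pr n y) : x = y :=
  DirectSum.ext_component k h

lemma sum_hom_ext {V : Type*} [AddCommMonoid V] [Module k V] {f g : K.Sum →ₗ[k] V}
    (h : ∀ n, f ∘ₗ K.inc n = g ∘ₗ K.inc n) : f = g :=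
  DirectSum.linearMap_ext k h

/-- The differential of the total complex. -/
def totD : K.Sum →ₗ[k] K.Sum :=
  DirectSum.toModule k ℕ _ fun n => K.inc n ∘ₗ (K.obj n).d + K.inc (n + 1) ∘ₗ K.δ n

lemma totD_inc (n : ℕ) (x : (K.obj n).carrier) :
    K.totD (K.inc n x) = K.inc n ((K.obj n).d x) + K.inc (n + 1) (K.δ n x) := by
  simp [totD]

lemma pr_zero_totD (x : K.Sum) : K.pr 0 (K.totD x) = (K.obj 0).d (K.pr 0 x) := by
  refine LinearMap.congr_fun (f := K.pr 0 ∘ₗ K.totD) (g := (K.obj 0).d ∘ₗ K.pr 0)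
    (K.sum_hom_ext fun n => LinearMap.ext fun y => ?_) x
  simp only [LinearMap.comp_apply]
  rw [totD_inc, map_add, K.pr_inc_ne (Nat.succ_ne_zero n).symm, add_zero]
  rcases Nat.eq_zero_or_pos n with rfl | h
  · rw [pr_inc_same, pr_inc_same]
  · rw [K.pr_inc_ne (by omega), K.pr_inc_ne (by omega), map_zero]

lemma pr_succ_totD (n : ℕ) (x : K.Sum) : K.pr (n + 1) (K.totD x) =
    (K.obj (n + 1)).d (K.pr (n + 1) x) + K.δ n (K.pr n x) := by
  refine LinearMap.congr_fun (f := K.pr (n + 1) ∘ₗ K.totD)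
    (g := (K.obj (n + 1)).d ∘ₗ K.pr (n + 1) + K.δ n ∘ₗ K.pr n)
    (K.sum_hom_ext fun m => LinearMap.ext fun y => ?_) x
  simp only [LinearMap.comp_apply, LinearMap.add_apply]
  rw [totD_inc, map_add]
  by_cases h : m = n
  · subst h
    rw [pr_inc_same, pr_inc_same, K.pr_inc_ne (by omega), K.pr_inc_ne (by omega), map_zero]
  by_cases h' : m = n + 1
  · subst h'
    rw [pr_inc_same, pr_inc_same, K.pr_inc_ne (by omega), K.pr_inc_ne (by omega), map_zero]
  · rw [K.pr_inc_ne (by omega), K.pr_inc_ne (by omega), K.pr_inc_ne (by omega),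
      K.pr_inc_ne (by omega), map_zero, map_zero]

/-- The total complex. -/
abbrev totDG : DGVect k where
  carrier := K.Sum
  gr m := ⨅ n, ((K.obj n).gr m).comap (K.pr n)
  internal := DGVect.isInternal_of_proj
    (fun m => DirectSum.lmap fun n => (K.obj n).toDGVect.proj m)
    (fun m x hx => K.sum_ext fun n => by
      rw [Submodule.mem_iInf] at hx
      exact (K.obj n).proj_same (hx n))
    (fun m m' h x hx => K.sum_ext fun n => by
      rw [Submodule.mem_iInf] at hx
      exact ((K.obj n).proj_ne h (hx n)).trans (map_zero _).symm)
    (fun x => by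
      classical
      induction x using DirectSum.induction_on with
      | zero => exact zero_mem _
      | of n y =>
        have h : iSup (K.obj n).gr ≤ (⨆ m, ⨅ j, ((K.obj j).gr m).comap (K.pr j)).comap
            (K.inc n) := iSup_le fun m y hy => by
          refine Submodule.mem_iSup_of_mem m ((Submodule.mem_iInf _).2 fun j => ?_)
          rw [Submodule.mem_comap]
          by_cases hj : j = n
          · subst hj; rwa [pr_inc_same]
          · rw [pr_inc_ne K hj]; exact zero_mem _
        rw [(K.obj n).internal.submodule_iSup_eq_top] at h
        exact h (x := y) trivial
      | add x y hx hy => exact add_mem hx hy)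
  d := K.totD
  d_mem m x hx := by
    rw [Submodule.mem_iInf] at hx ⊢
    intro n
    rw [Submodule.mem_comap]
    cases n with
    | zero =>
      rw [pr_zero_totD]
      exact (K.obj 0).d_mem _ _ (hx 0)
    | succ n =>
      rw [pr_succ_totD]
      exact add_mem ((K.obj (n + 1)).d_mem _ _ (hx (n + 1))) ((K.isOdd n).graded _ _ (hx n))
  d_d x := by
    refine LinearMap.congr_fun (f := K.totD ∘ₗ K.totD) (g := 0)
      (K.sum_hom_ext fun m => LinearMap.ext fun y => ?_) x
    simp only [LinearMap.comp_apply, LinearMap.zero_apply, totD_inc, map_add, DGVect.d_d,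
      K.δ_d, K.δ_δ, map_zero, map_neg]
    abel

lemma mem_totDG {m : ℤ} {x : K.Sum} : x ∈ K.totDG.gr m ↔ ∀ n, K.pr n x ∈ (K.obj n).gr m :=
  Submodule.mem_iInf _

lemma inc_mem {n : ℕ} {m : ℤ} {x : (K.obj n).carrier} (hx : x ∈ (K.obj n).gr m) :
    K.inc n x ∈ K.totDG.gr m :=
  K.mem_totDG.2 fun j => by
    by_cases hj : j = n
    · subst hj; rwa [pr_inc_same]
    · rw [pr_inc_ne K hj]; exact zero_mem _

lemma inc_graded (n : ℕ) : DGVect.IsGraded (K.obj n).toDGVect K.totDG 0 (K.inc n) :=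
  fun m x hx => by rw [add_zero]; exact K.inc_mem hx

/-- Homogeneity in the direct sum is tested by components, and an element is the finite sum of its
components, so it suffices to look at single terms. -/
lemma mem_of_inc {V : DGVect k} {f : K.Sum →ₗ[k] V}
    (h : ∀ n m x, x ∈ (K.obj n).gr m → f (K.inc n x) ∈ V.gr m) (m : ℤ) (x : K.Sum)
    (hx : x ∈ K.totDG.gr m) : f x ∈ V.gr m := by
  classical
  rw [← DirectSum.sum_support_of x, map_sum]
  exact Submodule.sum_mem _ fun n _ => h n m _ (K.mem_totDG.1 hx n)

/-- The left coaction of the direct sum. -/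
def totLco : K.Sum →ₗ[k] A.carrier ⊗[k] K.Sum :=
  DirectSum.toModule k ℕ _ fun n => (K.inc n).lTensor A.carrier ∘ₗ (K.obj n).lco

/-- The right coaction of the direct sum. -/
def totRco : K.Sum →ₗ[k] K.Sum ⊗[k] B.carrier :=
  DirectSum.toModule k ℕ _ fun n => (K.inc n).rTensor B.carrier ∘ₗ (K.obj n).rco

lemma totLco_inc (n : ℕ) :
    K.totLco ∘ₗ K.inc n = (K.inc n).lTensor A.carrier ∘ₗ (K.obj n).lco := by
  ext; simp [totLco]

lemma totRco_inc (n : ℕ) :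
    K.totRco ∘ₗ K.inc n = (K.inc n).rTensor B.carrier ∘ₗ (K.obj n).rco := by
  ext; simp [totRco]

lemma totD_comp_inc (n : ℕ) :
    K.totD ∘ₗ K.inc n = K.inc n ∘ₗ (K.obj n).d + K.inc (n + 1) ∘ₗ K.δ n :=
  LinearMap.ext (K.totD_inc n)

lemma tensor_d_inc (n : ℕ) : (A.toDGVect.tensor K.totDG).d ∘ₗ (K.inc n).lTensor A.carrier =
    (K.inc n).lTensor A.carrier ∘ₗ (A.toDGVect.tensor (K.obj n).toDGVect).d +
      (K.inc (n + 1)).lTensor A.carrier ∘ₗ TensorProduct.map A.sgn (K.δ n) := by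
  refine TensorProduct.ext' fun a x => ?_
  simp only [LinearMap.comp_apply, LinearMap.add_apply, LinearMap.lTensor_tmul,
    TensorProduct.map_tmul, totD_inc, TensorProduct.tmul_add, map_add, LinearMap.id_apply,
    add_assoc]

lemma inc_tensor_d (n : ℕ) : (K.totDG.tensor B.toDGVect).d ∘ₗ (K.inc n).rTensor B.carrier =
    (K.inc n).rTensor B.carrier ∘ₗ ((K.obj n).toDGVect.tensor B.toDGVect).d +
      (K.inc (n + 1)).rTensor B.carrier ∘ₗ (K.δ n).rTensor B.carrier := by
  have h : ∀ x, K.totDG.sgn (K.inc n x) = K.inc n ((K.obj n).sgn x) := fun x => by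
    simpa using LinearMap.congr_fun (DGVect.sgn_comp (K.inc_graded n)) x
  refine TensorProduct.ext' fun x b => ?_
  simp only [LinearMap.comp_apply, LinearMap.add_apply, LinearMap.rTensor_tmul,
    TensorProduct.map_tmul, totD_inc, TensorProduct.add_tmul, map_add, LinearMap.id_apply, h]
  abel

/-- The total bicomodule. -/
abbrev tot : Bicomod A B where
  toDGVect := K.totDG
  lco := K.totLco
  rco := K.totRco
  lco_hom :=
    { mem := K.mem_of_inc fun n m x hx => by
        have h := (DGVect.IsHom.id A.toDGVect).graded.map (K.inc_graded n) m _
          ((K.obj n).lco_hom.mem m x hx)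
        rw [add_zero, add_zero] at h
        rw [← LinearMap.comp_apply, totLco_inc]
        exact h
      comm := K.sum_hom_ext fun n => by
        rw [LinearMap.comp_assoc, totD_comp_inc, LinearMap.comp_add, ← LinearMap.comp_assoc,
          ← LinearMap.comp_assoc, totLco_inc, totLco_inc, LinearMap.comp_assoc,
          LinearMap.comp_assoc, LinearMap.comp_assoc, totLco_inc, ← LinearMap.comp_assoc,
          ← LinearMap.comp_assoc, ← LinearMap.comp_assoc, tensor_d_inc, LinearMap.add_comp,
          LinearMap.comp_assoc, LinearMap.comp_assoc, LinearMap.comp_assoc, LinearMap.comp_assoc,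
          (K.obj n).lco_hom.comm, (K.isOdd n).lco] }
  rco_hom :=
    { mem := K.mem_of_inc fun n m x hx => by
        have h := (K.inc_graded n).map (DGVect.IsHom.id B.toDGVect).graded m _
          ((K.obj n).rco_hom.mem m x hx)
        rw [add_zero, add_zero] at h
        rw [← LinearMap.comp_apply, totRco_inc]
        exact h
      comm := K.sum_hom_ext fun n => by
        rw [LinearMap.comp_assoc, totD_comp_inc, LinearMap.comp_add, ← LinearMap.comp_assoc,
          ← LinearMap.comp_assoc, totRco_inc, totRco_inc, LinearMap.comp_assoc,
          LinearMap.comp_assoc, LinearMap.comp_assoc, totRco_inc, ← LinearMap.comp_assoc,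
          ← LinearMap.comp_assoc, ← LinearMap.comp_assoc, inc_tensor_d, LinearMap.add_comp,
          LinearMap.comp_assoc, LinearMap.comp_assoc, LinearMap.comp_assoc, LinearMap.comp_assoc,
          (K.obj n).rco_hom.comm, (K.isOdd n).rco] }
  lco_coassoc := K.sum_hom_ext fun n => push_lco_coassoc (K.totLco_inc n) (K.obj n).lco_coassoc
  rco_coassoc := K.sum_hom_ext fun n => push_rco_coassoc (K.totRco_inc n) (K.obj n).rco_coassoc
  lco_counit := K.sum_hom_ext fun n => push_lco_counit (K.totLco_inc n) (K.obj n).lco_counit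
  rco_counit := K.sum_hom_ext fun n => push_rco_counit (K.totRco_inc n) (K.obj n).rco_counit
  lco_rco := K.sum_hom_ext fun n =>
    push_lco_rco (K.totLco_inc n) (K.totRco_inc n) (K.obj n).lco_rco

lemma totLco_pr (n : ℕ) :
    (K.pr n).lTensor A.carrier ∘ₗ K.totLco = (K.obj n).lco ∘ₗ K.pr n := by
  refine K.sum_hom_ext fun m => ?_
  rw [LinearMap.comp_assoc, totLco_inc, ← LinearMap.comp_assoc, ← LinearMap.lTensor_comp,
    LinearMap.comp_assoc]
  by_cases h : n = m
  · subst h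
    rw [LinearMap.ext (f := K.pr n ∘ₗ K.inc n) (g := LinearMap.id) (K.pr_inc_same n),
      LinearMap.lTensor_id]
    rfl
  · rw [LinearMap.ext (f := K.pr n ∘ₗ K.inc m) (g := 0) (K.pr_inc_ne h),
      LinearMap.lTensor_zero, LinearMap.zero_comp, LinearMap.comp_zero]

lemma totRco_pr (n : ℕ) :
    (K.pr n).rTensor B.carrier ∘ₗ K.totRco = (K.obj n).rco ∘ₗ K.pr n := by
  refine K.sum_hom_ext fun m => ?_
  rw [LinearMap.comp_assoc, totRco_inc, ← LinearMap.comp_assoc, ← LinearMap.rTensor_comp,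
    LinearMap.comp_assoc]
  by_cases h : n = m
  · subst h
    rw [LinearMap.ext (f := K.pr n ∘ₗ K.inc n) (g := LinearMap.id) (K.pr_inc_same n),
      LinearMap.rTensor_id]
    rfl
  · rw [LinearMap.ext (f := K.pr n ∘ₗ K.inc m) (g := 0) (K.pr_inc_ne h),
      LinearMap.rTensor_zero, LinearMap.zero_comp, LinearMap.comp_zero]

lemma exists_bound (x : K.Sum) : ∃ N, ∀ n, N ≤ n → K.pr n x = 0 := by
  classical
  induction x using DirectSum.induction_on with
  | zero => exact ⟨0, fun n _ => map_zero _⟩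
  | of m y => exact ⟨m + 1, fun n hn => K.pr_inc_ne (by omega) y⟩
  | add x y hx hy =>
    obtain ⟨N, hN⟩ := hx
    obtain ⟨N', hN'⟩ := hy
    exact ⟨max N N', fun n hn => by
      rw [map_add, hN n (by omega), hN' n (by omega), add_zero]⟩

lemma sum_inc_pr {N : ℕ} {x : K.Sum} (h : ∀ n, N ≤ n → K.pr n x = 0) :
    ∑ n ∈ Finset.range N, K.inc n (K.pr n x) = x := by
  refine K.sum_ext fun m => ?_
  rw [map_sum]
  by_cases hm : m < N
  · rw [Finset.sum_eq_single_of_mem m (Finset.mem_range.2 hm)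
      fun n _ hn => K.pr_inc_ne (Ne.symm hn) _, pr_inc_same]
  · rw [h m (by omega)]
    exact Finset.sum_eq_zero fun n hn =>
      K.pr_inc_ne (by rw [Finset.mem_range] at hn; omega) _

/-- A tensor involves only finitely many summands, so the projections remain jointly injective after
tensoring, whatever the dimension of `V`. Colinearity of maps into the total object can therefore be
checked componentwise. -/
lemma lTensor_ext {V : Type*} [AddCommGroup V] [Module k V] {z z' : V ⊗[k] K.Sum}
    (h : ∀ n, (K.pr n).lTensor V z = (K.pr n).lTensor V z') : z = z' := by
  have key : ∀ z : V ⊗[k] K.Sum, ∃ N, ∀ N', N ≤ N' →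
      ∑ n ∈ Finset.range N', (K.inc n).lTensor V ((K.pr n).lTensor V z) = z := by
    intro z
    induction z using TensorProduct.induction_on with
    | zero => exact ⟨0, by simp⟩
    | tmul v x =>
      obtain ⟨N, hN⟩ := K.exists_bound x
      refine ⟨N, fun N' h' => ?_⟩
      simp only [LinearMap.lTensor_tmul]
      rw [← TensorProduct.tmul_sum, K.sum_inc_pr fun n hn => hN n (by omega)]
    | add x y hx hy =>
      obtain ⟨N, hN⟩ := hx
      obtain ⟨N', hN'⟩ := hy
      refine ⟨max N N', fun n hn => ?_⟩
      simp only [map_add]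
      rw [Finset.sum_add_distrib, hN n (by omega), hN' n (by omega)]
  obtain ⟨N, hN⟩ := key z
  obtain ⟨N', hN'⟩ := key z'
  rw [← hN (max N N') (by omega), ← hN' (max N N') (by omega)]
  exact Finset.sum_congr rfl fun n _ => by rw [h]

lemma rTensor_ext {V : Type*} [AddCommGroup V] [Module k V] {z z' : K.Sum ⊗[k] V}
    (h : ∀ n, (K.pr n).rTensor V z = (K.pr n).rTensor V z') : z = z' := by
  refine (TensorProduct.comm k K.Sum V).injective (K.lTensor_ext fun n => ?_)
  have h1 : ∀ z, (K.pr n).lTensor V (TensorProduct.comm k K.Sum V z) =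
      TensorProduct.comm k _ V ((K.pr n).rTensor V z) := fun z =>
    LinearMap.congr_fun (f := (K.pr n).lTensor V ∘ₗ (TensorProduct.comm k K.Sum V).toLinearMap)
      (g := (TensorProduct.comm k _ V).toLinearMap ∘ₗ (K.pr n).rTensor V)
      (TensorProduct.ext' fun x v => by simp) z
  rw [h1, h1, h]

end OddComplex

/-! ### Null-homotopies of maps into a total bicomodule -/

namespace Bicomod

variable {k : Type u} [Field k] {A B E : DGCoalg k}

/-- The Koszul signs of two odd maps cancel, so the composite is strictly colinear. -/
lemma IsOdd.lco_comp {M N P : Bicomod A B} {e e' : ℤ} {h : M.carrier →ₗ[k] N.carrier}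
    {h' : N.carrier →ₗ[k] P.carrier} (hh : IsOdd M N e h) (hh' : IsOdd N P e' h') :
    P.lco ∘ₗ h' ∘ₗ h = (h' ∘ₗ h).lTensor A.carrier ∘ₗ M.lco := by
  rw [← LinearMap.comp_assoc, hh'.lco, LinearMap.comp_assoc, hh.lco, ← LinearMap.comp_assoc,
    ← TensorProduct.map_comp, A.sgn_sgn]
  rfl

lemma IsOdd.rco_comp {M N P : Bicomod A B} {e e' : ℤ} {h : M.carrier →ₗ[k] N.carrier}
    {h' : N.carrier →ₗ[k] P.carrier} (hh : IsOdd M N e h) (hh' : IsOdd N P e' h') :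
    P.rco ∘ₗ h' ∘ₗ h = (h' ∘ₗ h).rTensor B.carrier ∘ₗ M.rco := by
  rw [← LinearMap.comp_assoc, hh'.rco, LinearMap.comp_assoc, hh.rco, LinearMap.rTensor_comp,
    LinearMap.comp_assoc]

end Bicomod

namespace OddComplex

variable {k : Type u} [Field k] {A B : DGCoalg k} (K : OddComplex A B)

/-- The `n`-th component of a morphism to the total bicomodule. -/
def comp {X : Bicomod A B} (f : X ⟶ K.tot) (n : ℕ) : X.carrier →ₗ[k] (K.obj n).carrier :=
  K.pr n ∘ₗ f.toLin

/-- The terms of the complex are uniformly left bounded. -/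
def IsBounded (a : ℤ) : Prop := ∀ (n : ℕ) (m : ℤ), m < a + n → (K.obj n).gr m = ⊥

variable {K}

lemma comp_mem {X : Bicomod A B} (f : X ⟶ K.tot) (n : ℕ) (m : ℤ) (x : X.carrier)
    (hx : x ∈ X.gr m) : K.comp f n x ∈ (K.obj n).gr m :=
  K.mem_totDG.1 (f.isHom.mem m x hx) n

lemma comp_lco {X : Bicomod A B} (f : X ⟶ K.tot) (n : ℕ) :
    (K.obj n).lco ∘ₗ K.comp f n = (K.comp f n).lTensor A.carrier ∘ₗ X.lco := by
  have h := f.lco_comp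
  change K.totLco ∘ₗ f.toLin = _ at h
  rw [comp, ← LinearMap.comp_assoc, ← totLco_pr, LinearMap.comp_assoc, h, ← LinearMap.comp_assoc,
    ← LinearMap.lTensor_comp]

lemma comp_rco {X : Bicomod A B} (f : X ⟶ K.tot) (n : ℕ) :
    (K.obj n).rco ∘ₗ K.comp f n = (K.comp f n).rTensor B.carrier ∘ₗ X.rco := by
  have h := f.rco_comp
  change K.totRco ∘ₗ f.toLin = _ at h
  rw [comp, ← LinearMap.comp_assoc, ← totRco_pr, LinearMap.comp_assoc, h, ← LinearMap.comp_assoc,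
    ← LinearMap.rTensor_comp]

lemma comp_zero_d {X : Bicomod A B} (f : X ⟶ K.tot) (x : X.carrier) :
    K.comp f 0 (X.d x) = (K.obj 0).d (K.comp f 0 x) :=
  (congrArg (K.pr 0) (f.isHom.comm_apply x)).trans (K.pr_zero_totD _)

lemma comp_succ_d {X : Bicomod A B} (f : X ⟶ K.tot) (n : ℕ) (x : X.carrier) :
    K.comp f (n + 1) (X.d x) = (K.obj (n + 1)).d (K.comp f (n + 1) x) + K.δ n (K.comp f n x) :=
  (congrArg (K.pr (n + 1)) (f.isHom.comm_apply x)).trans (K.pr_succ_totD n _)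

open Bicomod in
-- The inductive step in building a null-homotopy by components. The equation for component `n + 1`
-- asks to contract `f_{n+1} - δ h`, and `hδ` says precisely that this difference commutes with the
-- differentials; locality of the next term does the rest.
lemma exists_odd_succ (hK : ∀ n, (K.obj n).IsLocal) {X : Bicomod A B} (hX : X.IsAcyclic)
    (f : X ⟶ K.tot) (n : ℕ) {h : X.carrier →ₗ[k] (K.obj n).carrier}
    (hh : IsOdd X (K.obj n) (-1) h)
    (hδ : ∀ x, K.δ n (K.comp f n x - h (X.d x) - (K.obj n).d (h x)) = 0) :
    ∃ h', IsOdd X (K.obj (n + 1)) (-1) h' ∧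
      ∀ x, K.comp f (n + 1) x - K.δ n (h x) = h' (X.d x) + (K.obj (n + 1)).d (h' x) :=
  hK (n + 1) X hX
    { toLin := K.comp f (n + 1) - K.δ n ∘ₗ h
      isHom :=
        { mem := fun m x hx => by
            have := (K.isOdd n).graded _ _ (hh.graded m x hx)
            rw [neg_add_cancel_right] at this
            exact sub_mem (comp_mem f _ m x hx) this
          comm := by
            ext x
            have h1 := hδ x
            simp only [map_sub, K.δ_d, sub_neg_eq_add] at h1
            simp only [LinearMap.comp_apply, LinearMap.sub_apply, map_sub]
            rw [comp_succ_d, ← sub_eq_zero, ← h1]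
            abel }
      lco_comp := by
        rw [LinearMap.comp_sub, comp_lco, hh.lco_comp (K.isOdd n), LinearMap.lTensor_sub,
          LinearMap.sub_comp]
      rco_comp := by
        rw [LinearMap.comp_sub, comp_rco, hh.rco_comp (K.isOdd n), LinearMap.rTensor_sub,
          LinearMap.sub_comp] }

open Bicomod in
lemma exists_odd_zero (hK : ∀ n, (K.obj n).IsLocal) {X : Bicomod A B} (hX : X.IsAcyclic)
    (f : X ⟶ K.tot) : ∃ h, IsOdd X (K.obj 0) (-1) h ∧
      ∀ x, K.comp f 0 x = h (X.d x) + (K.obj 0).d (h x) :=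
  hK 0 X hX
    { toLin := K.comp f 0
      isHom := ⟨comp_mem f 0, LinearMap.ext (comp_zero_d f)⟩
      lco_comp := comp_lco f 0
      rco_comp := comp_rco f 0 }

open Bicomod in
/-- A locally finite family of odd maps to the terms defines an odd map to the total bicomodule. -/
lemma exists_odd_glue {a : ℤ} (ha : K.IsBounded a) {X : Bicomod A B}
    (h : ∀ n, X.carrier →ₗ[k] (K.obj n).carrier) (hh : ∀ n, IsOdd X (K.obj n) (-1) (h n)) :
    ∃ H, IsOdd X K.tot (-1) H ∧ ∀ n x, K.pr n (H x) = h n x := by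
  -- On elements of degree `m` the map `h n` lands in degree `m - 1` of the `n`-th term, which is
  -- zero once `m - 1 < a + n`. So finitely many components matter in each degree, and the values
  -- lie in the direct sum.
  let H : X.carrier →ₗ[k] K.Sum := X.gradedLift fun m =>
    ∑ n ∈ Finset.range (m - a).toNat, K.inc n ∘ₗ h n
  have hH : ∀ n, K.pr n ∘ₗ H = h n := by
    refine fun n => X.toDGVect.hom_ext fun m x hx => ?_
    rw [LinearMap.comp_apply, X.gradedLift_apply _ hx, LinearMap.sum_apply, map_sum]
    simp only [LinearMap.comp_apply]
    by_cases hn : n < (m - a).toNat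
    · rw [Finset.sum_eq_single_of_mem n (Finset.mem_range.2 hn)
        fun j _ hj => K.pr_inc_ne (Ne.symm hj) _, pr_inc_same]
    · have h0 := (hh n).graded m x hx
      rw [ha n _ (by omega), Submodule.mem_bot] at h0
      rw [h0]
      exact Finset.sum_eq_zero fun j hj =>
        K.pr_inc_ne (by rw [Finset.mem_range] at hj; omega) _
  refine ⟨H, ⟨fun m x hx => K.mem_totDG.2 fun n => ?_, LinearMap.ext fun x => ?_,
    LinearMap.ext fun x => ?_⟩, fun n => LinearMap.congr_fun (hH n)⟩
  · rw [← LinearMap.comp_apply, hH]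
    exact (hh n).graded m x hx
  · refine K.lTensor_ext fun n => ?_
    change ((K.pr n).lTensor A.carrier ∘ₗ K.totLco) (H x) =
      ((K.pr n).lTensor A.carrier ∘ₗ TensorProduct.map A.sgn H) (X.lco x)
    rw [totLco_pr, LinearMap.lTensor_comp_map, hH, LinearMap.comp_apply, ← LinearMap.comp_apply (K.pr n), hH]
    exact LinearMap.congr_fun (hh n).lco x
  · refine K.rTensor_ext fun n => ?_
    change ((K.pr n).rTensor B.carrier ∘ₗ K.totRco) (H x) =
      ((K.pr n).rTensor B.carrier ∘ₗ H.rTensor B.carrier) (X.rco x)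
    rw [totRco_pr, ← LinearMap.rTensor_comp, hH, LinearMap.comp_apply, ← LinearMap.comp_apply (K.pr n), hH]
    exact LinearMap.congr_fun (hh n).rco x

open Bicomod in
lemma tot_isLocal (hK : ∀ n, (K.obj n).IsLocal) {a : ℤ} (ha : K.IsBounded a) :
    K.tot.IsLocal := by
  intro X hX f
  -- The invariant carried along is weaker than being a null-homotopy of the `n`-th component: only
  -- its defect has to be killed by `δ n`. After a step the defect is `δ` of the previous homotopy,
  -- so `δ ∘ δ = 0` restores the invariant.
  let S : ℕ → Type u := fun n => {h : X.carrier →ₗ[k] (K.obj n).carrier //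
    IsOdd X (K.obj n) (-1) h ∧ ∀ x, K.δ n (K.comp f n x - h (X.d x) - (K.obj n).d (h x)) = 0}
  obtain ⟨h0, hh0, e0⟩ := exists_odd_zero hK hX f
  have step : ∀ n (s : S n), ∃ s' : S (n + 1), ∀ x, K.comp f (n + 1) x - K.δ n (s.1 x) =
      s'.1 (X.d x) + (K.obj (n + 1)).d (s'.1 x) := by
    intro n s
    obtain ⟨h', hh', e'⟩ := exists_odd_succ hK hX f n s.2.1 s.2.2
    refine ⟨⟨h', hh', fun x => ?_⟩, e'⟩
    rw [sub_sub, ← e', sub_sub_cancel, K.δ_δ]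
  choose next hnext using step
  let s : ∀ n, S n := fun n => Nat.rec ⟨h0, hh0, fun x => by
    rw [sub_sub, ← e0, sub_self, map_zero]⟩ next n
  obtain ⟨H, hH, e⟩ := exists_odd_glue ha (fun n => (s n).1) fun n => (s n).2.1
  refine ⟨H, hH, fun x => K.sum_ext fun n => ?_⟩
  cases n with
  | zero =>
    refine (e0 x).trans ?_
    rw [map_add, e]
    refine congrArg₂ _ rfl ?_
    refine Eq.trans ?_ (K.pr_zero_totD (H x)).symm
    rw [e]
    rfl
  | succ n =>
    refine (sub_eq_iff_eq_add.1 (hnext n (s n) x)).trans ?_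
    rw [map_add, e, add_assoc]
    refine congrArg₂ _ rfl ?_
    refine Eq.trans ?_ (K.pr_succ_totD n (H x)).symm
    rw [e, e]

end OddComplex

/-! ### Cofree resolutions of left bounded bicomodules -/

namespace Bicomod

variable {k : Type u} [Field k] {A B E : DGCoalg k}

/-- The shifted cokernel of a morphism. -/
lemma exists_odd_cokernel {Y P : Bicomod B E} (i : Y ⟶ P) :
    ∃ (S : Bicomod B E) (p : P.carrier →ₗ[k] S.carrier), IsOdd P S 1 p ∧
      (∀ x, p (P.d x) = -S.d (p x)) ∧ Function.Surjective p ∧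
      (∀ x, p x = 0 ↔ ∃ y, i.toLin y = x) ∧
      ∀ a, (∀ n, n < a → P.gr n = ⊥) → ∀ n, n < a + 1 → S.gr n = ⊥ :=
  ⟨(coker i).unshift, (cokerπ i).toLin, (isOdd_unshift _).comp_hom (cokerπ i),
    fun x => ((cokerπ i).isHom.comm_apply x).trans (neg_neg _).symm, Submodule.mkQ_surjective _,
    fun _ => Submodule.Quotient.mk_eq_zero _, fun _ ha n hn =>
      (congrArg (Submodule.map _) (ha (n - 1) (by omega))).trans (Submodule.map_bot _)⟩

end Bicomod

/-- A resolution of a bicomodule by cofree bicomodules. -/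
structure CofreeResolution {k : Type u} [Field k] {B E : DGCoalg k} (Y : Bicomod B E) where
  K : OddComplex B E
  aug : Y ⟶ K.obj 0
  cofree : ∀ n, ∃ W : Bicomod B E, K.obj n = W.cofree
  aug_injective : Function.Injective aug.toLin
  δ_aug : ∀ y, K.δ 0 (aug.toLin y) = 0
  exact_zero : ∀ x, K.δ 0 x = 0 → ∃ y, aug.toLin y = x
  exact_succ : ∀ n x, K.δ (n + 1) x = 0 → ∃ y, K.δ n y = x

namespace Bicomod

variable {k : Type u} [Field k] {A B E : DGCoalg k}

lemma tensor_gr_eq_bot {M N : DGVect k} {a b : ℤ} (ha : ∀ n, n < a → M.gr n = ⊥)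
    (hb : ∀ n, n < b → N.gr n = ⊥) (n : ℤ) (hn : n < a + b) : (M.tensor N).gr n = ⊥ := by
  rw [eq_bot_iff]
  refine DGVect.tensorGr_le fun p q hpq x hx y hy => ?_
  rcases lt_or_ge p a with h | h
  · rw [ha p h, Submodule.mem_bot] at hx
    rw [hx, TensorProduct.zero_tmul]
    exact zero_mem _
  · rw [hb q (by omega), Submodule.mem_bot] at hy
    rw [hy, TensorProduct.tmul_zero]
    exact zero_mem _

/-- Here positivity of the coalgebras enters: tensoring with them does not lower the bound. -/
lemma cofree_gr_eq_bot (hB : B.IsPositive) (hE : E.IsPositive) {Y : Bicomod B E} {a : ℤ}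
    (ha : ∀ n, n < a → Y.gr n = ⊥) (n : ℤ) (hn : n < a) : Y.cofree.gr n = ⊥ :=
  tensor_gr_eq_bot (M := B.toDGVect) (N := Y.toDGVect.tensor E.toDGVect) hB
    (tensor_gr_eq_bot ha hE) n (by omega)

/-- Embed `Y` in its cofree bicomodule, take the cokernel, and repeat. Moving each cokernel up by
one degree makes the connecting maps odd of degree `1`, so that the terms are already placed as the
total complex requires. -/
lemma exists_cofreeResolution (hB : B.IsPositive) (hE : E.IsPositive) {Y : Bicomod B E} {a : ℤ}
    (ha : ∀ n, n < a → Y.gr n = ⊥) : ∃ R : CofreeResolution Y, R.K.IsBounded a := by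
  choose S p hp hpd hps hpe hpb using fun Y : Bicomod B E => exists_odd_cokernel Y.toCofree
  -- `Z n` is the `n`-th shifted cosyzygy, with `Z 0 = Y`. Each cokernel step raises the lower bound
  -- by one and the cofree step keeps it, which yields the growing bound `a + n`.
  let Z : ℕ → Bicomod B E := fun n => Nat.rec Y (fun _ => S) n
  have hZ : ∀ (m : ℕ) (n : ℤ), n < a + m → (Z m).gr n = ⊥ := by
    intro m
    induction m with
    | zero => exact fun n hn => ha n (by simpa using hn)
    | succ m ih =>
      exact fun n hn => hpb (Z m) (a + m) (cofree_gr_eq_bot hB hE ih) n (by push_cast at hn; omega)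
  refine ⟨{
    K := {
      obj := fun n => (Z n).cofree
      δ := fun n => (S (Z n)).toCofree.toLin ∘ₗ p (Z n)
      isOdd := fun n => (hp (Z n)).hom_comp (S (Z n)).toCofree
      δ_d := fun n x => ?_
      δ_δ := fun n x => ?_ }
    aug := Y.toCofree
    cofree := fun n => ⟨Z n, rfl⟩
    aug_injective := Y.toCofree_injective
    δ_aug := fun y => ?_
    exact_zero := fun x hx => ?_
    exact_succ := fun n x hx => ?_ }, fun n m hm => cofree_gr_eq_bot hB hE (hZ n) m hm⟩
  · refine (congrArg (S (Z n)).toCofree.toLin (hpd (Z n) x)).trans ?_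
    rw [map_neg]
    exact congrArg Neg.neg ((S (Z n)).toCofree.isHom.comm_apply _)
  · exact (congrArg (S (S (Z n))).toCofree.toLin ((hpe (S (Z n)) _).2 ⟨_, rfl⟩)).trans (map_zero _)
  · exact (congrArg (S Y).toCofree.toLin ((hpe Y _).2 ⟨_, rfl⟩)).trans (map_zero _)
  · exact (hpe Y x).1 ((S Y).toCofree_injective (hx.trans (map_zero _).symm))
  · obtain ⟨z, hz⟩ := (hpe (S (Z n)) x).1
      ((S (S (Z n))).toCofree_injective (hx.trans (map_zero _).symm))
    obtain ⟨w, hw⟩ := hps (Z n) z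
    exact ⟨w, (congrArg (S (Z n)).toCofree.toLin hw).trans hz⟩

end Bicomod

namespace CofreeResolution

variable {k : Type u} [Field k] {B E : DGCoalg k} {Y : Bicomod B E} (R : CofreeResolution Y)

/-- The augmentation to the total bicomodule. -/
def toTot : Y ⟶ R.K.tot where
  toLin := R.K.inc 0 ∘ₗ R.aug.toLin
  isHom :=
    { mem := fun n x hx => R.K.inc_mem (R.aug.isHom.mem n x hx)
      comm := LinearMap.ext fun x => by
        simp only [LinearMap.comp_apply]
        rw [R.K.totD_inc, R.δ_aug, map_zero, add_zero, R.aug.isHom.comm_apply] }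
  lco_comp := by
    rw [← LinearMap.comp_assoc, OddComplex.totLco_inc, LinearMap.lTensor_comp,
      LinearMap.comp_assoc, LinearMap.comp_assoc, ← R.aug.lco_comp]
  rco_comp := by
    rw [← LinearMap.comp_assoc, OddComplex.totRco_inc, LinearMap.rTensor_comp,
      LinearMap.comp_assoc, LinearMap.comp_assoc, ← R.aug.rco_comp]

lemma toTot_apply (y : Y.carrier) : R.toTot.toLin y = R.K.inc 0 (R.aug.toLin y) := rfl

lemma toTot_injective : Function.Injective R.toTot.toLin :=
  fun x y h => R.aug_injective (by
    have := congrArg (R.K.pr 0) h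
    rwa [toTot_apply, toTot_apply, OddComplex.pr_inc_same, OddComplex.pr_inc_same] at this)

/-- Remove the top component repeatedly: it is killed by `δ`, hence it is `δ w`, and subtracting the
total differential of `w` moves everything one place down; at place zero exactness produces an
element of `Y`. Only the components of the differential of `y` in positive position must vanish, so
that the lemma covers both cycles and elements whose differential comes from `Y`. -/
lemma exists_sub_d_eq_toTot (N : ℕ) (y : R.K.Sum) (hN : ∀ n, N < n → R.K.pr n y = 0)
    (hy : ∀ n, R.K.pr (n + 1) (R.K.totD y) = 0) :
    ∃ w z, y - R.K.totD w = R.toTot.toLin z := by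
  induction N generalizing y with
  | zero =>
    have h1 := hy 0
    rw [OddComplex.pr_succ_totD, hN (0 + 1) Nat.one_pos, map_zero] at h1
    obtain ⟨z, hz⟩ := R.exact_zero _ ((zero_add _).symm.trans h1)
    refine ⟨0, z, R.K.sum_ext fun n => ?_⟩
    rw [map_zero, sub_zero, toTot_apply]
    cases n with
    | zero => rw [OddComplex.pr_inc_same]; exact hz.symm
    | succ n => rw [hN _ (Nat.succ_pos n), OddComplex.pr_inc_ne _ (Nat.succ_ne_zero n)]
  | succ N ih =>
    have h1 := hy (N + 1)
    rw [OddComplex.pr_succ_totD, hN (N + 1 + 1) (by omega), map_zero, zero_add] at h1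
    obtain ⟨w, hw⟩ := R.exact_succ _ _ h1
    obtain ⟨w', z', h'⟩ := ih (y - R.K.totD (R.K.inc N w))
      (fun n hn => by
        rw [OddComplex.totD_inc, map_sub, map_add, OddComplex.pr_inc_ne _ (by omega), zero_add]
        by_cases h : n = N + 1
        · subst h; rw [OddComplex.pr_inc_same, hw, sub_self]
        · rw [OddComplex.pr_inc_ne _ h, hN n (by omega), sub_zero])
      (fun n => by
        rw [map_sub, R.K.totDG.d_d, sub_zero, hy n])
    exact ⟨R.K.inc N w + w', z', by rw [← h', map_add, sub_sub]⟩

/-- Elements of a direct sum have a top component, so the preceding reduction always applies.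
Applied to a cycle it gives surjectivity on cohomology; applied to a primitive of the image of `x`
it gives injectivity. -/
lemma toTot_isQuasiIso : DGVect.IsQuasiIso R.toTot.isHom := by
  have key : ∀ y : R.K.Sum, (∀ n, R.K.pr (n + 1) (R.K.totD y) = 0) →
      ∃ w z, y - R.K.totD w = R.toTot.toLin z := fun y hy => by
    obtain ⟨N, hN⟩ := R.K.exists_bound y
    exact R.exists_sub_d_eq_toTot N y (fun n hn => hN n hn.le) hy
  rw [DGVect.isQuasiIso_iff]
  refine ⟨fun x hx hy => ?_, fun y hy => ?_⟩
  · obtain ⟨y, hy⟩ := hy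
    obtain ⟨w, z, h⟩ := key y fun n => by
      rw [hy, toTot_apply, OddComplex.pr_inc_ne _ (Nat.succ_ne_zero n)]
    refine ⟨z, R.toTot_injective ?_⟩
    rw [R.toTot.isHom.comm_apply, ← h, map_sub, hy, R.K.totDG.d_d, sub_zero]
  · obtain ⟨w, z, h⟩ := key y fun n => by rw [hy, map_zero]
    refine ⟨z, R.toTot_injective ?_, -w, ?_⟩
    · rw [R.toTot.isHom.comm_apply, ← h, map_sub, hy, R.K.totDG.d_d, sub_zero, map_zero]
    · rw [← h, map_neg, sub_sub_cancel_left]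

end CofreeResolution

lemma OddComplex.tot_isBoundedBelow {k : Type u} [Field k] {A B : DGCoalg k} {K : OddComplex A B}
    {a : ℤ} (ha : K.IsBounded a) : K.tot.IsBoundedBelow := by
  refine ⟨a, fun n hn => (Submodule.eq_bot_iff _).2 fun x hx => K.sum_ext fun m => ?_⟩
  have h := K.mem_totDG.1 hx m
  rw [ha m n (by omega), Submodule.mem_bot] at h
  rw [h, map_zero]

/-! ### Homotopy classes of maps into local bicomodules -/

namespace Bicomod

variable {k : Type u} [Field k] {A B E : DGCoalg k}

lemma cone_isAcyclic {X Y : Bicomod A B} (s : X ⟶ Y) (hs : DGVect.IsQuasiIso s.isHom) :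
    (cone s).IsAcyclic :=
  (DGVect.isQuasiIso_iff_isAcyclic_cone s.isHom).1 hs

lemma unshift_isAcyclic {X : Bicomod A B} (hX : X.IsAcyclic) : X.unshift.IsAcyclic := fun x hx => by
  obtain ⟨y, hy⟩ := hX x (neg_eq_zero.1 hx)
  exact ⟨-y, (congrArg Neg.neg (map_neg X.d y)).trans ((neg_neg _).trans hy)⟩

/-- The morphism from the cone of `s` given by a null-homotopy of `s ≫ g - s ≫ g'`. -/
def coneDesc {X Y I : Bicomod A B} (s : X ⟶ Y) (g g' : Y ⟶ I) (h : X.carrier →ₗ[k] I.carrier)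
    (hh : IsOdd X I (-1) h)
    (he : (s ≫ g).toLin - (s ≫ g').toLin = h ∘ₗ X.d + I.d ∘ₗ h) : cone s ⟶ I where
  toLin := LinearMap.coprod h (g.toLin - g'.toLin)
  isHom :=
    { mem := fun n x hx => by
        have h1 := hh.graded (n + 1) x.1 hx.1
        rw [add_neg_cancel_right] at h1
        exact add_mem h1 (sub_mem (g.isHom.mem n _ hx.2) (g'.isHom.mem n _ hx.2))
      comm := by
        refine LinearMap.ext fun ⟨x, y⟩ => ?_
        have h1 : g.toLin (s.toLin x) - g'.toLin (s.toLin x) = h (X.d x) + I.d (h x) :=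
          LinearMap.congr_fun he x
        change h (-X.d x) + (g.toLin (s.toLin x + Y.d y) - g'.toLin (s.toLin x + Y.d y)) =
          I.d (h x + (g.toLin y - g'.toLin y))
        rw [map_add, map_add, add_sub_add_comm, h1, g.isHom.comm_apply, g'.isHom.comm_apply,
          map_neg, map_add, map_sub]
        abel }
  lco_comp := by
    refine LinearMap.prod_ext ?_ ?_
    · change I.lco ∘ₗ LinearMap.coprod h (g.toLin - g'.toLin) ∘ₗ LinearMap.inl k _ _ =
        LinearMap.lTensor A.carrier (LinearMap.coprod h (g.toLin - g'.toLin)) ∘ₗ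
          prodL (A.sgn.rTensor X.carrier ∘ₗ X.lco) Y.lco ∘ₗ LinearMap.inl k _ _
      rw [prodL_inl, LinearMap.coprod_inl, hh.lco, ← LinearMap.comp_assoc, ← LinearMap.lTensor_comp,
        LinearMap.coprod_inl, ← LinearMap.comp_assoc, LinearMap.lTensor_comp_rTensor]
    · change I.lco ∘ₗ LinearMap.coprod h (g.toLin - g'.toLin) ∘ₗ LinearMap.inr k _ _ =
        LinearMap.lTensor A.carrier (LinearMap.coprod h (g.toLin - g'.toLin)) ∘ₗ
          prodL (A.sgn.rTensor X.carrier ∘ₗ X.lco) Y.lco ∘ₗ LinearMap.inr k _ _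
      rw [prodL_inr, LinearMap.coprod_inr, ← LinearMap.comp_assoc, ← LinearMap.lTensor_comp,
        LinearMap.coprod_inr, LinearMap.comp_sub, LinearMap.lTensor_sub, LinearMap.sub_comp,
        g.lco_comp, g'.lco_comp]
  rco_comp := by
    refine LinearMap.prod_ext ?_ ?_
    · change I.rco ∘ₗ LinearMap.coprod h (g.toLin - g'.toLin) ∘ₗ LinearMap.inl k _ _ =
        LinearMap.rTensor B.carrier (LinearMap.coprod h (g.toLin - g'.toLin)) ∘ₗ
          prodR X.rco Y.rco ∘ₗ LinearMap.inl k _ _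
      rw [prodR_inl, LinearMap.coprod_inl, hh.rco, ← LinearMap.comp_assoc, ← LinearMap.rTensor_comp,
        LinearMap.coprod_inl]
    · change I.rco ∘ₗ LinearMap.coprod h (g.toLin - g'.toLin) ∘ₗ LinearMap.inr k _ _ =
        LinearMap.rTensor B.carrier (LinearMap.coprod h (g.toLin - g'.toLin)) ∘ₗ
          prodR X.rco Y.rco ∘ₗ LinearMap.inr k _ _
      rw [prodR_inr, LinearMap.coprod_inr, ← LinearMap.comp_assoc, ← LinearMap.rTensor_comp,
        LinearMap.coprod_inr, LinearMap.comp_sub, LinearMap.rTensor_sub, LinearMap.sub_comp,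
        g.rco_comp, g'.rco_comp]

/-- A homotopy between `s ≫ g` and `s ≫ g'` extends `g - g'` to a map from the cone of `s`. The cone
is acyclic, so that map is null-homotopic; restrict the null-homotopy to `Y`. -/
lemma IsLocal.homotopic_of_comp {I : Bicomod A B} (hI : I.IsLocal) {X Y : Bicomod A B} (s : X ⟶ Y)
    (hs : DGVect.IsQuasiIso s.isHom) {g g' : Y ⟶ I} (h : Homotopic (s ≫ g) (s ≫ g')) :
    Homotopic g g' := by
  obtain ⟨h, hh, he⟩ := homotopic_iff.1 h
  obtain ⟨H, hH, hHe⟩ := hI _ (cone_isAcyclic s hs) (coneDesc s g g' h hh he)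
  refine homotopic_iff.2 ⟨H ∘ₗ (coneIn s).toLin, hH.comp_hom _, LinearMap.ext fun y => ?_⟩
  have h1 : h 0 + (g.toLin y - g'.toLin y) =
    H ((cone s).d ((coneIn s).toLin y)) + I.d (H ((coneIn s).toLin y)) := hHe (0, y)
  rw [map_zero, zero_add, ← (coneIn s).isHom.comm_apply] at h1
  exact h1

/-- The projection from the desuspended cone to the source. -/
def unshiftConeFst {X Y : Bicomod A B} (s : X ⟶ Y) : (cone s).unshift ⟶ X where
  toLin := LinearMap.fst k X.carrier Y.carrier
  isHom :=
    { mem := fun n x hx => by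
        have h1 : x.1 ∈ X.gr (n - 1 + 1) := hx.1
        rw [sub_add_cancel] at h1
        exact h1
      comm := LinearMap.ext fun ⟨x, y⟩ => neg_neg (X.d x) }
  lco_comp := by
    have h1 : (A.sgn.rTensor X.carrier ∘ₗ X.lco) ∘ₗ LinearMap.fst k X.carrier Y.carrier =
      (LinearMap.fst k X.carrier Y.carrier).lTensor A.carrier ∘ₗ
        prodL (A.sgn.rTensor X.carrier ∘ₗ X.lco) Y.lco := prodL_fst _ _
    change X.lco ∘ₗ LinearMap.fst k X.carrier Y.carrier =
      (LinearMap.fst k X.carrier Y.carrier).lTensor A.carrier ∘ₗ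
        A.sgn.rTensor (X.carrier × Y.carrier) ∘ₗ prodL (A.sgn.rTensor X.carrier ∘ₗ X.lco) Y.lco
    rw [← LinearMap.comp_assoc, LinearMap.lTensor_comp_rTensor, ← LinearMap.rTensor_comp_lTensor,
      LinearMap.comp_assoc, ← h1, ← LinearMap.comp_assoc, ← LinearMap.comp_assoc,
      ← LinearMap.rTensor_comp, A.sgn_sgn, LinearMap.rTensor_id, LinearMap.id_comp]
  rco_comp := prodR_fst _ _

/-- Pull `f` back to the desuspended cone of `s`, which is acyclic. A null-homotopy `H` there has
two restrictions: the one to `Y` is, up to sign, the required `g`, and the one to `X` is, up to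
sign, the homotopy between `s ≫ g` and `f`. -/
lemma IsLocal.exists_comp_homotopic {I : Bicomod A B} (hI : I.IsLocal) {X Y : Bicomod A B}
    (s : X ⟶ Y) (hs : DGVect.IsQuasiIso s.isHom) (f : X ⟶ I) :
    ∃ g : Y ⟶ I, Homotopic (s ≫ g) f := by
  obtain ⟨H, hH, hHe⟩ := hI _ (unshift_isAcyclic (cone_isAcyclic s hs)) (unshiftConeFst s ≫ f)
  let H' : X.carrier × Y.carrier →ₗ[k] I.carrier := H
  have he : ∀ x y, f.toLin x = H' (X.d x, -(s.toLin x + Y.d y)) + I.d (H' (x, y)) := fun x y => by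
    have h1 : f.toLin x = H' (-(-X.d x, s.toLin x + Y.d y)) + I.d (H' (x, y)) := hHe (x, y)
    rwa [Prod.neg_mk, neg_neg] at h1
  -- The inclusion of `Y` in the desuspended cone is odd and so is `H`; their composite has degree
  -- zero and satisfies the unsigned colinearity.
  have hin := (isOdd_unshift (cone s)).comp_hom (coneIn s)
  let g : Y ⟶ I :=
    { toLin := -(H' ∘ₗ LinearMap.inr k X.carrier Y.carrier)
      isHom :=
        { mem := fun n x hx => by
            have h1 := hH.graded _ _ (hin.graded n x hx)
            rw [add_neg_cancel_right] at h1
            exact neg_mem h1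
          comm := LinearMap.ext fun y => by
            have h1 := he 0 y
            rw [map_zero, map_zero, map_zero, zero_add, ← sub_eq_zero] at h1
            change -H' (0, Y.d y) = I.d (-H' (0, y))
            rw [map_neg]
            have h2 : H' (0, -Y.d y) = - H' (0, Y.d y) := by
              rw [← map_neg H', Prod.neg_mk, neg_zero]
            rw [h2, zero_sub, neg_eq_zero] at h1
            exact eq_neg_of_add_eq_zero_left h1 }
      lco_comp := by
        rw [LinearMap.comp_neg, LinearMap.lTensor_neg, LinearMap.neg_comp]
        exact congrArg Neg.neg (hin.lco_comp hH)
      rco_comp := by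
        rw [LinearMap.comp_neg, LinearMap.rTensor_neg, LinearMap.neg_comp]
        exact congrArg Neg.neg (hin.rco_comp hH) }
  refine ⟨g, homotopic_iff.2 ⟨-(H' ∘ₗ LinearMap.inl k X.carrier Y.carrier), IsOdd.neg
    ⟨fun n x hx => hH.graded n _ ?_, ?_, ?_⟩, LinearMap.ext fun x => ?_⟩⟩
  · exact ⟨by rwa [sub_add_cancel], zero_mem _⟩
  · have h1 : I.lco ∘ₗ H' = TensorProduct.map A.sgn H' ∘ₗ
      A.sgn.rTensor _ ∘ₗ prodL (A.sgn.rTensor X.carrier ∘ₗ X.lco) Y.lco := hH.lco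
    have h2 : ∀ a, A.sgn (A.sgn a) = a := LinearMap.congr_fun A.sgn_sgn
    have h3 : TensorProduct.map A.sgn H' ∘ₗ A.sgn.rTensor _ ∘ₗ
        (LinearMap.inl k X.carrier Y.carrier).lTensor A.carrier ∘ₗ A.sgn.rTensor _ =
        TensorProduct.map A.sgn (H' ∘ₗ LinearMap.inl k X.carrier Y.carrier) :=
      TensorProduct.ext' fun a x => by simp [h2]
    rw [← LinearMap.comp_assoc, h1, LinearMap.comp_assoc, LinearMap.comp_assoc, prodL_inl, ← h3]
    rfl
  · have h1 : I.rco ∘ₗ H' = H'.rTensor B.carrier ∘ₗ prodR X.rco Y.rco := hH.rco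
    rw [← LinearMap.comp_assoc, h1, LinearMap.comp_assoc, prodR_inl, LinearMap.rTensor_comp,
      LinearMap.comp_assoc]
  · change -H' (0, s.toLin x) - f.toLin x = -H' (X.d x, 0) + I.d (-H' (x, 0))
    have h1 : H' (X.d x, -(s.toLin x + Y.d 0)) = H' (X.d x, 0) - H' (0, s.toLin x) := by
      rw [← map_sub, Prod.mk_sub_mk, sub_zero, map_zero, add_zero, zero_sub]
    rw [he x 0, h1, map_neg]
    abel

lemma Homotopic.comp {M N P : Bicomod A B} {f f' : M ⟶ N} {g g' : N ⟶ P} (h : Homotopic f f')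
    (h' : Homotopic g g') : Homotopic (f ≫ g) (f' ≫ g') := by
  obtain ⟨s, hs, he⟩ := homotopic_iff.1 h
  obtain ⟨t, ht, he'⟩ := homotopic_iff.1 h'
  refine homotopic_iff.2 ⟨g.toLin ∘ₗ s + t ∘ₗ f'.toLin, (hs.hom_comp g).add (ht.comp_hom f'),
    LinearMap.ext fun x => ?_⟩
  have h1 : f.toLin x - f'.toLin x = s (M.d x) + N.d (s x) := LinearMap.congr_fun he x
  have h2 : g.toLin (f'.toLin x) - g'.toLin (f'.toLin x) =
    t (N.d (f'.toLin x)) + P.d (t (f'.toLin x)) := LinearMap.congr_fun he' (f'.toLin x)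
  change g.toLin (f.toLin x) - g'.toLin (f'.toLin x) = (g.toLin (s (M.d x)) + t (f'.toLin (M.d x))) +
    P.d (g.toLin (s x) + t (f'.toLin x))
  rw [← sub_add_sub_cancel _ (g.toLin (f'.toLin x)), h2, ← map_sub, h1, map_add, map_add,
    g.isHom.comm_apply, f'.isHom.comm_apply]
  abel

lemma homotopic_refl {M N : Bicomod A B} (f : M ⟶ N) : Homotopic f f :=
  homotopic_iff.2 ⟨0, IsOdd.zero _ _ _, by simp⟩

/-- A quotient category is formed by the congruence which a relation generates. As homotopy already
is a congruence, two morphisms become equal in the quotient only if they are homotopic. -/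
instance : Congruence (Homotopic (A := A) (B := B)) where
  comp_left f _ _ h := (homotopic_refl f).comp h
  comp_right g h := h.comp (homotopic_refl g)
  equivalence :=
    { refl := homotopic_refl
      symm := fun h => by
        obtain ⟨s, hs, he⟩ := homotopic_iff.1 h
        refine homotopic_iff.2 ⟨-s, hs.neg, ?_⟩
        rw [← neg_sub, he, LinearMap.neg_comp, LinearMap.comp_neg, neg_add]
      trans := fun h h' => by
        obtain ⟨s, hs, he⟩ := homotopic_iff.1 h
        obtain ⟨t, ht, he'⟩ := homotopic_iff.1 h'
        refine homotopic_iff.2 ⟨s + t, hs.add ht, ?_⟩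
        rw [← sub_add_sub_cancel, he, he', LinearMap.add_comp, LinearMap.comp_add]
        abel }

end Bicomod

/-! ### Localization at local objects, and Kan extension along left adjoints -/

namespace CategoryTheory

section

universe v₁ v₂ u₁ u₂

open Opposite

variable {C : Type u₁} [Category.{v₁} C] {D : Type u₂} [Category.{v₂} D] (L : C ⥤ D)
  (W : MorphismProperty C) [L.IsLocalization W]

/-- If precomposition with the morphisms in `W` is bijective on the morphisms to `I`, then a
localization functor for `W` is bijective on the morphisms to `I`. -/
lemma Localization.map_bijective_of_isLocal {I : C}
    (hI : ∀ ⦃X Y : C⦄ (s : X ⟶ Y), W s → Function.Bijective fun g : Y ⟶ I => s ≫ g) (X : C) :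
    Function.Bijective fun g : X ⟶ I => L.map g := by
  let F : Cᵒᵖ ⥤ Type max v₁ v₂ := yoneda.obj I ⋙ uliftFunctor.{v₂}
  -- The hypothesis says that the functor represented by `I` inverts `W`, so it descends to a
  -- functor `F'` on the localization. What remains is a Yoneda argument that `F'` is represented by
  -- the image of `I`.
  have hF : W.op.IsInvertedBy F := fun X Y s hs => by
    rw [isIso_iff_bijective]
    obtain ⟨h1, h2⟩ := hI s.unop hs
    refine ⟨fun a b h => ULift.ext _ _ (h1 (congrArg ULift.down h)), fun b => ?_⟩
    obtain ⟨a, ha⟩ := h2 b.down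
    exact ⟨⟨a⟩, ULift.ext _ _ ha⟩
  let F' := Localization.lift F hF L.op
  let e : L.op ⋙ F' ≅ F := Localization.fac F hF L.op
  let G : Dᵒᵖ ⥤ Type max v₁ v₂ := yoneda.obj (L.obj I) ⋙ uliftFunctor.{v₁}
  let τ : F ⟶ L.op ⋙ G :=
    { app := fun X => ↾ fun g => ⟨L.map g.down⟩
      naturality := fun X Y f => by
        ext g
        exact ULift.ext _ _ (L.map_comp _ _) }
  let _ : Localization.Lifting L.op W.op F F' := ⟨e⟩
  let τ' : F' ⟶ G := Localization.liftNatTrans L.op W.op F (L.op ⋙ G) F' G τ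
  have hτ : ∀ Y : C, τ'.app (op (L.obj Y)) = e.hom.app (op Y) ≫ τ.app (op Y) := fun Y => by
    refine (Localization.liftNatTrans_app L.op W.op F (L.op ⋙ G) F' G τ (op Y)).trans ?_
    have h : (Localization.Lifting.iso L.op W.op (L.op ⋙ G) G).inv.app (op Y) = 𝟙 _ := rfl
    rw [h, Category.comp_id]
    rfl
  -- Injectivity: `F` factors through `L`, so `L.map g = L.map g'` forces the same action on the
  -- identity of `I`.
  constructor
  · intro g g' h
    have h1 : F.map g.op = F.map g'.op := by
      have h2 : (L.op ⋙ F').map g.op = (L.op ⋙ F').map g'.op := by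
        change F'.map (L.map g).op = F'.map (L.map g').op
        exact congrArg (fun z : L.obj X ⟶ L.obj I => F'.map z.op) h
      rw [← cancel_epi (e.hom.app (op I)), ← e.hom.naturality, ← e.hom.naturality, h2]
    have h3 := congrArg (fun z => (z (⟨𝟙 I⟩ : F.obj (op I))).down) h1
    change g ≫ 𝟙 I = g' ≫ 𝟙 I at h3
    rwa [Category.comp_id, Category.comp_id] at h3
  · intro φ
    -- The universal element. Transporting it along `φ` gives an element of `F' (L X)`, which is a
    -- morphism `X ⟶ I`; naturality of `τ'` shows that its image is `φ`.
    let x : F'.obj (op (L.obj I)) := e.inv.app (op I) (⟨𝟙 I⟩ : F.obj (op I))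
    refine ⟨(e.hom.app (op X) (F'.map φ.op x)).down, ?_⟩
    have h1 := ConcreteCategory.congr_hom (τ'.naturality φ.op) x
    have h2 : τ'.app (op (L.obj X)) (F'.map φ.op x) = G.map φ.op (τ'.app (op (L.obj I)) x) := h1
    rw [hτ, hτ] at h2
    have h3 : e.hom.app (op I) x = (⟨𝟙 I⟩ : F.obj (op I)) :=
      ConcreteCategory.congr_hom (e.inv_hom_id_app (op I)) _
    have h4 : τ.app (op X) (e.hom.app (op X) (F'.map φ.op x)) =
      G.map φ.op (τ.app (op I) (e.hom.app (op I) x)) := h2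
    rw [h3] at h4
    refine (congrArg ULift.down h4).trans ?_
    change φ ≫ L.map (𝟙 I) = φ
    rw [L.map_id, Category.comp_id]

end

section

variable {C D H : Type*} [Category* C] [Category* D] [Category* H] {L : C ⥤ D} {r : D ⥤ C}

/-- The natural transformation `r ⋙ F ⟶ G` which corresponds to `F ⟶ L ⋙ G`. -/
def Adjunction.lanDesc (adj : L ⊣ r) {F : C ⥤ H} {G : D ⥤ H} (β : F ⟶ L ⋙ G) : r ⋙ F ⟶ G where
  app X := β.app (r.obj X) ≫ G.map (adj.counit.app X)
  naturality X X' f := by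
    have h := β.naturality (r.map f)
    dsimp at h ⊢
    rw [← Category.assoc, h, Category.assoc, Category.assoc, ← G.map_comp, ← G.map_comp,
      adj.counit_naturality]

/-- The natural transformation `F ⟶ L ⋙ r ⋙ F` given by the unit. -/
def Adjunction.lanUnit (adj : L ⊣ r) (F : C ⥤ H) : F ⟶ L ⋙ r ⋙ F where
  app X := F.map (adj.unit.app X)
  naturality X Y f := by
    dsimp
    rw [← F.map_comp, ← F.map_comp, ← adj.unit_naturality]

lemma Adjunction.lanUnit_desc (adj : L ⊣ r) {F : C ⥤ H} {G : D ⥤ H} (β : F ⟶ L ⋙ G) :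
    adj.lanUnit F ≫ Functor.whiskerLeft L (adj.lanDesc β) = β := by
  ext X
  have h := β.naturality (adj.unit.app X)
  dsimp at h
  dsimp [lanUnit, lanDesc]
  rw [← Category.assoc, h, Category.assoc, ← G.map_comp, adj.left_triangle_components, G.map_id,
    Category.comp_id]

lemma Adjunction.eq_lanDesc (adj : L ⊣ r) {F : C ⥤ H} {G : D ⥤ H} {β : F ⟶ L ⋙ G}
    (m : r ⋙ F ⟶ G) (hm : adj.lanUnit F ≫ Functor.whiskerLeft L m = β) : m = adj.lanDesc β := by
  subst hm
  ext X
  have h := m.naturality (adj.counit.app X)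
  dsimp at h
  dsimp [lanUnit, lanDesc]
  rw [Category.assoc, ← h, ← Category.assoc, ← F.map_comp,
    adj.right_triangle_components, F.map_id, Category.id_comp]

/-- If `L` is left adjoint to `r`, then `r ⋙ F` is the left Kan extension of `F` along `L`. -/
lemma Adjunction.isLeftKanExtension (adj : L ⊣ r) (F : C ⥤ H) :
    (r ⋙ F).IsLeftKanExtension (L := L) (F := F) (adj.lanUnit F) :=
  ⟨⟨Limits.IsInitial.ofUniqueHom
    (fun Y => StructuredArrow.homMk (adj.lanDesc Y.hom) (adj.lanUnit_desc _))
    fun _ m => StructuredArrow.hom_ext _ _ (adj.eq_lanDesc m.right (StructuredArrow.w m))⟩⟩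

lemma Adjunction.adjunctionOfEquivRight_counit {G_obj : D → C}
    (e : ∀ X Y, (L.obj X ⟶ Y) ≃ (X ⟶ G_obj Y))
    (he : ∀ X' X Y f g, e X' Y (L.map f ≫ g) = f ≫ e X Y g) (Y : D) :
    (Adjunction.adjunctionOfEquivRight e he).counit.app Y = (e (G_obj Y) Y).symm (𝟙 _) := by
  simp

/-- By a triangle identity this map is a one-sided inverse of an invertible counit. -/
lemma Adjunction.isIso_map_unit_app (adj : L ⊣ r) (X : C) [IsIso (adj.counit.app (L.obj X))] :
    IsIso (L.map (adj.unit.app X)) := by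
  rw [show L.map (adj.unit.app X) = inv (adj.counit.app (L.obj X)) from
    IsIso.eq_inv_of_inv_hom_id (adj.left_triangle_components X)]
  infer_instance

end

end CategoryTheory

/-! ### The resolution functor and derived cotensor products -/

namespace Bicomod

variable {k : Type u} [Field k] {A B E : DGCoalg k}

lemma isIso_toD_map {M N : Bicomod A B} (f : M ⟶ N) (hf : DGVect.IsQuasiIso f.isHom) :
    IsIso ((toD A B).map f) :=
  MorphismProperty.Q_inverts _ _ ⟨f, rfl, hf⟩

/-- The cohomology of a bicomodule. -/
def homologyFunctor (A B : DGCoalg k) : Bicomod A B ⥤ Type u where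
  obj M := M.toDGVect.homology
  map f := ↾ fun x => DGVect.homologyMap f.isHom x
  map_id M := by
    ext x
    exact DGVect.homologyMap_id M.toDGVect x
  map_comp f g := by
    ext x
    exact DGVect.homologyMap_comp f.isHom g.isHom x

lemma homologyMap_eq_of_homotopic {M N : Bicomod A B} {f g : M ⟶ N} (h : Homotopic f g)
    (x : M.toDGVect.homology) : DGVect.homologyMap f.isHom x = DGVect.homologyMap g.isHom x := by
  obtain ⟨h, -, he⟩ := homotopic_iff.1 h
  obtain ⟨x, rfl⟩ := Submodule.Quotient.mk_surjective _ x
  rw [DGVect.homologyMap, DGVect.homologyMap, Submodule.mapQ_apply, Submodule.mapQ_apply,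
    Submodule.Quotient.eq]
  refine ⟨h x.1, ?_⟩
  have h1 : f.toLin x.1 - g.toLin x.1 = h (M.d x.1) + N.d (h x.1) := LinearMap.congr_fun he x.1
  rw [show M.d x.1 = 0 from x.2, map_zero, zero_add] at h1
  exact h1.symm

/-- The cohomology functor on the homotopy category. -/
def homologyH (A B : DGCoalg k) : HCat A B ⥤ Type u :=
  CategoryTheory.Quotient.lift _ (homologyFunctor A B) fun _ _ _ _ h => by
    ext x
    exact homologyMap_eq_of_homotopic h x

lemma homologyH_inverts (A B : DGCoalg k) : (quasiIso A B).IsInvertedBy (homologyH A B) := by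
  rintro M N _ ⟨f, rfl, hf⟩
  rw [isIso_iff_bijective]
  exact hf

/-- Cohomology is homotopy invariant and inverts quasi-isomorphisms, so it factors through the
derived category. Hence nothing besides quasi-isomorphisms becomes invertible there. -/
lemma isQuasiIso_of_isIso_toD_map {M N : Bicomod A B} (f : M ⟶ N) (h : IsIso ((toD A B).map f)) :
    DGVect.IsQuasiIso f.isHom := by
  let e := Localization.fac (homologyH A B) (homologyH_inverts A B) (HtoD A B)
  have h1 : IsIso ((HtoD A B ⋙ Localization.lift (homologyH A B) (homologyH_inverts A B)
      (HtoD A B)).map ((toH A B).map f)) := by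
    have : IsIso ((HtoD A B).map ((toH A B).map f)) := h
    rw [Functor.comp_map]
    infer_instance
  rw [NatIso.isIso_map_iff e, isIso_iff_bijective] at h1
  exact h1

/-- The two cone arguments for local objects say that precomposition with a quasi-isomorphism is
injective and surjective on homotopy classes. -/
lemma IsLocal.toD_map_bijective {I : Bicomod A B} (hI : I.IsLocal) (X : HCat A B) :
    Function.Bijective fun g : X ⟶ (toH A B).obj I => (HtoD A B).map g := by
  refine Localization.map_bijective_of_isLocal (HtoD A B) (quasiIso A B) ?_ X
  rintro X Y _ ⟨s, rfl, hs⟩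
  constructor
  · intro g g' h
    obtain ⟨g, rfl⟩ := (toH A B).map_surjective g
    obtain ⟨g', rfl⟩ := (toH A B).map_surjective g'
    have h1 : (toH A B).map (s ≫ g) = (toH A B).map (s ≫ g') := by
      rw [Functor.map_comp, Functor.map_comp]
      exact h
    rw [CategoryTheory.Quotient.functor_map_eq_iff] at h1 ⊢
    exact hI.homotopic_of_comp s hs h1
  · intro f
    obtain ⟨f, rfl⟩ := (toH A B).map_surjective f
    obtain ⟨g, hg⟩ := hI.exists_comp_homotopic s hs f
    refine ⟨(toH A B).map g, ?_⟩
    change (toH A B).map s ≫ (toH A B).map g = _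
    rw [← Functor.map_comp]
    exact CategoryTheory.Quotient.sound _ hg

end Bicomod

/-- A left bounded complex of cofree bicomodules. -/
structure CofreeComplex {k : Type u} [Field k] (B E : DGCoalg k) extends OddComplex B E where
  cofree : ∀ n, ∃ W : Bicomod B E, obj n = W.cofree
  bound : ℤ
  isBounded : toOddComplex.IsBounded bound

lemma CofreeComplex.tot_isLocal {k : Type u} [Field k] {B E : DGCoalg k} (K : CofreeComplex B E) :
    K.tot.IsLocal := by
  refine OddComplex.tot_isLocal (fun n => ?_) K.isBounded
  obtain ⟨W, hW⟩ := K.cofree n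
  rw [hW]
  exact W.cofree_isLocal

namespace Bicomod

variable {k : Type u} [Field k] {A B E : DGCoalg k}

lemma exists_cofreeComplex (hB : B.IsPositive) (hE : E.IsPositive) (Y : DPlus B E) :
    ∃ K : CofreeComplex B E, Nonempty ((toD B E).obj K.tot ≅ Y.obj) := by
  obtain ⟨M, ⟨a, ha⟩, ⟨e⟩⟩ := Y.2
  obtain ⟨R, hR⟩ := exists_cofreeResolution hB hE ha
  have := isIso_toD_map R.toTot R.toTot_isQuasiIso
  exact ⟨⟨R.K, R.cofree, a, hR⟩, ⟨(e ≪≫ asIso ((toD B E).map R.toTot)).symm⟩⟩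

variable (hB : B.IsPositive) (hE : E.IsPositive)

/-- A complex of cofree bicomodules which resolves an object of the derived category. -/
def resolution (Y : DPlus B E) : CofreeComplex B E := (exists_cofreeComplex hB hE Y).choose

/-- The total bicomodule of the resolution, in the homotopy category. -/
def resolutionH (Y : DPlus B E) : HPlus B E :=
  ⟨(toH B E).obj (resolution hB hE Y).tot, _,
    OddComplex.tot_isBoundedBelow (resolution hB hE Y).isBounded, ⟨Iso.refl _⟩⟩

/-- An object of the derived category is isomorphic to its resolution. -/
def resolutionIso (Y : DPlus B E) : (HtoDPlus B E).obj (resolutionH hB hE Y) ≅ Y :=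
  ObjectProperty.isoMk _ (exists_cofreeComplex hB hE Y).choose_spec.some

/-- The representability which makes choosing a resolution into a right adjoint. Nothing new happens
for the bounded categories, because they are full subcategories and the resolution is left bounded.
-/
lemma resolution_bijective (X : HPlus B E) (Y : DPlus B E) : Function.Bijective
    fun g : X ⟶ resolutionH hB hE Y => (HtoDPlus B E).map g ≫ (resolutionIso hB hE Y).hom := by
  obtain ⟨h1, h2⟩ := (resolution hB hE Y).tot_isLocal.toD_map_bijective X.obj
  constructor
  · intro g g' h
    have h3 := (cancel_mono _).1 h
    exact ObjectProperty.hom_ext _ (h1 (congrArg (fun z => z.hom) h3))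
  · intro φ
    obtain ⟨g, hg⟩ := h2 (φ ≫ (resolutionIso hB hE Y).inv).hom
    refine ⟨ObjectProperty.homMk g, ?_⟩
    have h3 : (HtoDPlus B E).map (X := X) (Y := resolutionH hB hE Y) (ObjectProperty.homMk g) =
        φ ≫ (resolutionIso hB hE Y).inv := ObjectProperty.hom_ext _ hg
    change (HtoDPlus B E).map (X := X) (Y := resolutionH hB hE Y) (ObjectProperty.homMk g) ≫ _ = φ
    rw [h3, Category.assoc, Iso.inv_hom_id, Category.comp_id]

/-- The bijection between the morphisms in the derived category and the morphisms to a resolution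
in the homotopy category. -/
def resolutionEquiv (X : HPlus B E) (Y : DPlus B E) :
    ((HtoDPlus B E).obj X ⟶ Y) ≃ (X ⟶ resolutionH hB hE Y) :=
  (Equiv.ofBijective _ (resolution_bijective hB hE X Y)).symm

lemma resolutionEquiv_symm (X : HPlus B E) (Y : DPlus B E) (g : X ⟶ resolutionH hB hE Y) :
    (resolutionEquiv hB hE X Y).symm g =
      (HtoDPlus B E).map g ≫ (resolutionIso hB hE Y).hom := rfl

lemma resolutionEquiv_comp (X' X : HPlus B E) (Y : DPlus B E) (f : X' ⟶ X)
    (g : (HtoDPlus B E).obj X ⟶ Y) : resolutionEquiv hB hE X' Y ((HtoDPlus B E).map f ≫ g) =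
      f ≫ resolutionEquiv hB hE X Y g := by
  rw [← Equiv.eq_symm_apply, resolutionEquiv_symm, Functor.map_comp, Category.assoc,
    ← resolutionEquiv_symm, Equiv.symm_apply_apply]

/-- The resolution functor. -/
def resolve : DPlus B E ⥤ HPlus B E :=
  Adjunction.rightAdjointOfEquiv _ (resolutionEquiv_comp hB hE)

/-- The resolution functor is right adjoint to the localization functor. -/
def resolveAdj : HtoDPlus B E ⊣ resolve hB hE :=
  Adjunction.adjunctionOfEquivRight _ (resolutionEquiv_comp hB hE)

lemma resolveAdj_counit_app (Y : DPlus B E) :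
    (resolveAdj hB hE).counit.app Y = (resolutionIso hB hE Y).hom := by
  refine (Adjunction.adjunctionOfEquivRight_counit _ (resolutionEquiv_comp hB hE) Y).trans ?_
  rw [resolutionEquiv_symm, CategoryTheory.Functor.map_id, Category.id_comp]

instance (Y : DPlus B E) : IsIso ((resolveAdj hB hE).counit.app Y) :=
  (resolveAdj_counit_app hB hE Y) ▸ (resolutionIso hB hE Y).isIso_hom

instance : IsIso (resolveAdj hB hE).counit := NatIso.isIso_of_isIso_app _

/-- Left Kan extension along a left adjoint is precomposition with its right adjoint, here with the
choice of resolutions. -/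
lemma isDerivedCotensor_resolve {X : Bicomod A B} (hX : X.IsBoundedBelow) :
    X.IsDerivedCotensor hX (resolve hB hE ⋙ X.cotensorHPlus hX E ⋙ HtoDPlus A E) :=
  ⟨_, (resolveAdj hB hE).isLeftKanExtension _⟩

include hB hE in
-- `D⁺` is defined as a full subcategory of `D`, not as a localization of `H⁺`. It is one
-- nevertheless: the invertible counit makes the right adjoint `resolve` fully faithful, so that its
-- left adjoint is a localization.
lemma isLocalization_HtoDPlus : (HtoDPlus B E).IsLocalization
    ((MorphismProperty.isomorphisms (DPlus B E)).inverseImage (HtoDPlus B E)) := by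
  have := (resolveAdj hB hE).fullyFaithfulROfIsIsoCounit.full
  have := (resolveAdj hB hE).fullyFaithfulROfIsIsoCounit.faithful
  exact (resolveAdj hB hE).isLocalization

include hB hE in
-- A functor which already factors through the localization is its own derived functor.
lemma isDerivedCotensor_of_iso {X : Bicomod A B} (hX : X.IsBoundedBelow)
    {R : DPlus B E ⥤ DPlus A E}
    (e : HtoDPlus B E ⋙ R ≅ X.cotensorHPlus hX E ⋙ HtoDPlus A E) : X.IsDerivedCotensor hX R := by
  have := isLocalization_HtoDPlus hB hE
  have := Functor.isRightDerivedFunctor_of_inverts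
    ((MorphismProperty.isomorphisms (DPlus B E)).inverseImage (HtoDPlus B E)) R e
  exact ⟨e.inv, this.isLeftKanExtension⟩

end Bicomod

/-! ### Corestriction and coinduction along `f` -/

section TensorLemmas

variable {k : Type*} [Field k] {A K P M : Type*} [AddCommGroup A] [Module k A] [AddCommGroup K]
  [Module k K] [AddCommGroup P] [Module k P] [AddCommGroup M] [Module k M]

lemma colinear_left_of_comp {i : K →ₗ[k] P} (inj : Function.Injective i) {h : M →ₗ[k] K}
    {ρ : P →ₗ[k] A ⊗[k] P} {σ : K →ₗ[k] A ⊗[k] K} {τ : M →ₗ[k] A ⊗[k] M}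
    (hs : ρ ∘ₗ i = i.lTensor A ∘ₗ σ) (hh : ρ ∘ₗ i ∘ₗ h = (i ∘ₗ h).lTensor A ∘ₗ τ) :
    σ ∘ₗ h = h.lTensor A ∘ₗ τ := by
  refine (LinearMap.cancel_left
    (Module.Flat.lTensor_preserves_injective_linearMap (M := A) i inj)).1 ?_
  rw [← LinearMap.comp_assoc, ← hs, LinearMap.comp_assoc, hh, LinearMap.lTensor_comp,
    LinearMap.comp_assoc]

lemma colinear_right_of_comp {i : K →ₗ[k] P} (inj : Function.Injective i) {h : M →ₗ[k] K}
    {ρ : P →ₗ[k] P ⊗[k] A} {σ : K →ₗ[k] K ⊗[k] A} {τ : M →ₗ[k] M ⊗[k] A}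
    (hs : ρ ∘ₗ i = i.rTensor A ∘ₗ σ) (hh : ρ ∘ₗ i ∘ₗ h = (i ∘ₗ h).rTensor A ∘ₗ τ) :
    σ ∘ₗ h = h.rTensor A ∘ₗ τ := by
  refine (LinearMap.cancel_left
    (Module.Flat.rTensor_preserves_injective_linearMap (M := A) i inj)).1 ?_
  rw [← LinearMap.comp_assoc, ← hs, LinearMap.comp_assoc, hh, LinearMap.rTensor_comp,
    LinearMap.comp_assoc]

end TensorLemmas

namespace Bicomod

variable {k : Type u} [Field k] {A B E C D : DGCoalg k}

/-- A bijective morphism of bicomodules is an isomorphism. -/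
def isoOfBijective {M N : Bicomod A B} (f : M ⟶ N) (hf : Function.Bijective f.toLin) : M ≅ N :=
  have h1 : f.toLin ∘ₗ (LinearEquiv.ofBijective f.toLin hf).symm.toLinearMap = LinearMap.id :=
    LinearMap.ext (LinearEquiv.ofBijective f.toLin hf).apply_symm_apply
  have h2 : (LinearEquiv.ofBijective f.toLin hf).symm.toLinearMap ∘ₗ f.toLin = LinearMap.id :=
    LinearMap.ext (LinearEquiv.ofBijective f.toLin hf).symm_apply_apply
  { hom := f
    inv :=
      { toLin := (LinearEquiv.ofBijective f.toLin hf).symm.toLinearMap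
        isHom := DGVect.IsHom.symm (LinearEquiv.ofBijective f.toLin hf) f.isHom
        lco_comp := by
          rw [← LinearMap.cancel_right hf.2, LinearMap.comp_assoc, h2, LinearMap.comp_assoc,
            f.lco_comp, ← LinearMap.comp_assoc, ← LinearMap.lTensor_comp, h2, LinearMap.lTensor_id]
          rfl
        rco_comp := by
          rw [← LinearMap.cancel_right hf.2, LinearMap.comp_assoc, h2, LinearMap.comp_assoc,
            f.rco_comp, ← LinearMap.comp_assoc, ← LinearMap.rTensor_comp, h2, LinearMap.rTensor_id]
          rfl }
    hom_inv_id := hom_ext h2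
    inv_hom_id := hom_ext h1 }

/-- The morphism to an equalizer. -/
def equalizerLift {M P Q : Bicomod A E} (f g : P ⟶ Q) (h : M ⟶ P)
    (hh : ∀ x, f.toLin (h.toLin x) = g.toLin (h.toLin x)) : M ⟶ equalizer f g where
  toLin := h.toLin.codRestrict (LinearMap.eqLocus f.toLin g.toLin) hh
  isHom := DGVect.IsHom.of_comp (equalizerι f g).isHom (equalizerι_injective f g) h.isHom
  lco_comp := colinear_left_of_comp (equalizerι_injective f g) (equalizerι f g).lco_comp h.lco_comp
  rco_comp := colinear_right_of_comp (equalizerι_injective f g) (equalizerι f g).rco_comp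
    h.rco_comp

/-- The corestriction functor along a morphism of coalgebras. -/
def cor (f : C.Hom D) (E : DGCoalg k) : Bicomod C E ⥤ Bicomod D E where
  obj M := M.corestrictLeft f
  map {M N} g :=
    { toLin := g.toLin
      isHom := g.isHom
      lco_comp := by
        change (f.toHom.toLinearMap.rTensor N.carrier ∘ₗ N.lco) ∘ₗ g.toLin =
          g.toLin.lTensor D.carrier ∘ₗ f.toHom.toLinearMap.rTensor M.carrier ∘ₗ M.lco
        rw [LinearMap.comp_assoc, g.lco_comp, ← LinearMap.comp_assoc, ← LinearMap.comp_assoc,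
          LinearMap.lTensor_comp_rTensor, LinearMap.rTensor_comp_lTensor]
      rco_comp := g.rco_comp }

variable (f : C.Hom D)

/-- The Koszul sign survives because `f` has degree zero and so commutes with the sign involutions.
-/
lemma cor_isOdd {M N : Bicomod C E} {e : ℤ} {h : M.carrier →ₗ[k] N.carrier} (hh : IsOdd M N e h) :
    IsOdd ((cor f E).obj M) ((cor f E).obj N) e h where
  graded := hh.graded
  lco := by
    change (f.toHom.toLinearMap.rTensor N.carrier ∘ₗ N.lco) ∘ₗ h =
      TensorProduct.map D.sgn h ∘ₗ f.toHom.toLinearMap.rTensor M.carrier ∘ₗ M.lco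
    rw [LinearMap.comp_assoc, hh.lco, ← LinearMap.comp_assoc, ← LinearMap.comp_assoc]
    congr 1
    have h1 : ∀ c, D.sgn (f.toHom c) = f.toHom (C.sgn c) := LinearMap.congr_fun f.isHom.sgn
    ext; simp [h1]
  rco := hh.rco

lemma cor_homotopic {M N : Bicomod C E} {g g' : M ⟶ N} (h : Homotopic g g') :
    Homotopic ((cor f E).map g) ((cor f E).map g') := by
  obtain ⟨h, hh, he⟩ := homotopic_iff.1 h
  exact homotopic_iff.2 ⟨h, cor_isOdd f hh, he⟩

end Bicomod

section TensorLemmas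

variable {k : Type*} [Field k] {C D M E K : Type*} [AddCommGroup C] [Module k C] [AddCommGroup D]
  [Module k D] [AddCommGroup M] [Module k M] [AddCommGroup E] [Module k E] [AddCommGroup K]
  [Module k K]

lemma rTensor_tensor_lco (φ : C →ₗ[k] D) (δ : C →ₗ[k] C ⊗[k] C) :
    (TensorProduct.assoc k D C M).toLinearMap ∘ₗ (φ.rTensor C ∘ₗ δ).rTensor M =
      φ.rTensor (C ⊗[k] M) ∘ₗ (TensorProduct.assoc k C C M).toLinearMap ∘ₗ δ.rTensor M := by
  rw [LinearMap.rTensor_comp, ← LinearMap.comp_assoc, ← LinearMap.comp_assoc]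
  congr 1
  refine TensorProduct.ext_threefold fun a b c => by simp

lemma assoc_lTensor_rTensor (φ : C →ₗ[k] D) (δ : C →ₗ[k] C ⊗[k] C) :
    (TensorProduct.assoc k C D M).toLinearMap ∘ₗ (φ.lTensor C ∘ₗ δ).rTensor M =
      (φ.rTensor M).lTensor C ∘ₗ (TensorProduct.assoc k C C M).toLinearMap ∘ₗ δ.rTensor M := by
  rw [LinearMap.rTensor_comp, ← LinearMap.comp_assoc, ← LinearMap.comp_assoc]
  congr 1
  refine TensorProduct.ext_threefold fun a b c => by simp

lemma contractL_assoc_rTensor {ε : C →ₗ[k] k} {δ : C →ₗ[k] C ⊗[k] C}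
    (h : ε.rTensor C ∘ₗ δ = TensorProduct.mk k k C 1) :
    contractL (C ⊗[k] M) ε ∘ₗ (TensorProduct.assoc k C C M).toLinearMap ∘ₗ δ.rTensor M =
      LinearMap.id := by
  have h1 : contractL (C ⊗[k] M) ε ∘ₗ (TensorProduct.assoc k C C M).toLinearMap =
      (contractL C ε).rTensor M := by
    refine TensorProduct.ext_threefold fun a b c => ?_
    simp [TensorProduct.smul_tmul']
  rw [← LinearMap.comp_assoc, h1, ← LinearMap.rTensor_comp, contractL_comp h, LinearMap.rTensor_id]

/-- The equation `hz` is membership in `C □_C M`. Contracting the first tensor factor in it shows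
that such an element is the coaction of its own contraction. -/
lemma lco_contractL {ε : C →ₗ[k] k} {δ : C →ₗ[k] C ⊗[k] C}
    (h : ε.rTensor C ∘ₗ δ = TensorProduct.mk k k C 1) {ρ : M →ₗ[k] C ⊗[k] M} {z : C ⊗[k] M}
    (hz : (TensorProduct.assoc k C C M).toLinearMap (δ.rTensor M z) = ρ.lTensor C z) :
    ρ (contractL M ε z) = z := by
  have h1 := LinearMap.congr_fun (contractL_assoc_rTensor (M := M) h) z
  rw [LinearMap.comp_apply, LinearMap.comp_apply, hz] at h1
  exact (LinearMap.congr_fun (comp_contractL ε ρ) z).trans h1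

/-- The same contraction when the middle factor has been pushed to `D`: instead of `z` one gets back
its image under `φ`. This ties the counit of coinduction to `f`. -/
lemma lco_contractL_map {ε : C →ₗ[k] k} {δ : C →ₗ[k] C ⊗[k] C}
    (h : ε.rTensor C ∘ₗ δ = TensorProduct.mk k k C 1) (φ : C →ₗ[k] D) {ρ : M →ₗ[k] D ⊗[k] M}
    {z : C ⊗[k] M} (hz : (TensorProduct.assoc k C D M).toLinearMap
      ((φ.lTensor C ∘ₗ δ).rTensor M z) = ρ.lTensor C z) :
    ρ (contractL M ε z) = φ.rTensor M z := by
  have h1 := LinearMap.congr_fun (contractL_assoc_rTensor (M := M) h) z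
  have h2 := LinearMap.congr_fun (assoc_lTensor_rTensor (M := M) φ δ) z
  have h3 := LinearMap.congr_fun (comp_contractL ε (φ.rTensor M))
    ((TensorProduct.assoc k C C M).toLinearMap (δ.rTensor M z))
  simp only [LinearMap.comp_apply] at h1 h2 h3
  rw [h1] at h3
  refine (LinearMap.congr_fun (comp_contractL ε ρ) z).trans ?_
  rw [LinearMap.comp_apply, ← hz, h2, ← h3]
  rfl

lemma colinear_contractL {ε : C →ₗ[k] k} {δ : C →ₗ[k] C ⊗[k] C}
    (h : ε.lTensor C ∘ₗ δ = (TensorProduct.mk k C k).flip 1) (φ : C →ₗ[k] D) {i : K →ₗ[k] C ⊗[k] M}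
    {σ : K →ₗ[k] C ⊗[k] K}
    (hi : ((TensorProduct.assoc k C C M).toLinearMap ∘ₗ δ.rTensor M) ∘ₗ i = i.lTensor C ∘ₗ σ) :
    φ.rTensor M ∘ₗ i = (contractL M ε ∘ₗ i).lTensor D ∘ₗ φ.rTensor K ∘ₗ σ := by
  rw [← LinearMap.comp_assoc, LinearMap.lTensor_comp_rTensor, ← LinearMap.rTensor_comp_lTensor,
    LinearMap.comp_assoc, LinearMap.lTensor_comp, LinearMap.comp_assoc, ← hi,
    ← LinearMap.comp_assoc i, contractL_lTensor_comul h, LinearMap.id_comp]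

lemma colinear_right_contractL (ε : C →ₗ[k] k) {i : K →ₗ[k] C ⊗[k] M} {ρ : M →ₗ[k] M ⊗[k] E}
    {σ : K →ₗ[k] K ⊗[k] E}
    (hi : ((TensorProduct.assoc k C M E).symm.toLinearMap ∘ₗ ρ.lTensor C) ∘ₗ i =
      i.rTensor E ∘ₗ σ) :
    ρ ∘ₗ contractL M ε ∘ₗ i = (contractL M ε ∘ₗ i).rTensor E ∘ₗ σ := by
  have h2 : (contractL M ε).rTensor E ∘ₗ (TensorProduct.assoc k C M E).symm.toLinearMap =
      contractL (M ⊗[k] E) ε := by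
    refine TensorProduct.ext' fun b z => ?_
    induction z using TensorProduct.induction_on with
    | zero => simp
    | tmul x e => simp [TensorProduct.smul_tmul']
    | add x y hx hy => simp only [TensorProduct.tmul_add, map_add, hx, hy]
  rw [LinearMap.rTensor_comp, LinearMap.comp_assoc, ← hi, ← LinearMap.comp_assoc,
    ← LinearMap.comp_assoc, ← LinearMap.comp_assoc, h2, comp_contractL]

end TensorLemmas

namespace Bicomod

variable {k : Type u} [Field k] {A B E C D : DGCoalg k} (f : C.Hom D)

/-- The coaction as a morphism from the corestriction of `M` to `_fC ⊗ M`. -/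
def corTensor (M : Bicomod C E) : (cor f E).obj M ⟶ f.leftBicomod.tensor M where
  toLin := M.lco
  isHom := M.lco_hom
  lco_comp := by
    have h1 : (TensorProduct.assoc k D.carrier C.carrier M.carrier).toLinearMap ∘ₗ
        (f.toHom.toLinearMap.rTensor C.carrier ∘ₗ Coalgebra.comul (R := k)).rTensor M.carrier ∘ₗ
          M.lco = M.lco.lTensor D.carrier ∘ₗ f.toHom.toLinearMap.rTensor M.carrier ∘ₗ M.lco := by
      rw [← LinearMap.comp_assoc, rTensor_tensor_lco, LinearMap.comp_assoc, LinearMap.comp_assoc,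
        M.lco_coassoc, ← LinearMap.comp_assoc, ← LinearMap.comp_assoc,
        LinearMap.rTensor_comp_lTensor, LinearMap.lTensor_comp_rTensor]
    exact h1
  rco_comp := M.lcoHom.rco_comp

/-- The morphism from the corestriction of `M` to `_fC □_C M`. -/
def corToCotensor (M : Bicomod C E) : (cor f E).obj M ⟶ f.leftBicomod.cotensor M :=
  equalizerLift _ _ (corTensor f M) (LinearMap.congr_fun M.lco_coassoc)

lemma contractL_lco (M : Bicomod C E) (x : M.carrier) :
    contractL M.carrier (Coalgebra.counit (R := k) (A := C.carrier)) (M.lco x) = x :=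
  LinearMap.congr_fun (contractL_comp M.lco_counit) x

/-- The inverse of the coaction is contraction by the counit of `C`. Replacing the left coaction of
`C` by its corestriction plays no role, as the cotensor product only sees the right one. -/
lemma corToCotensor_bijective (M : Bicomod C E) :
    Function.Bijective (corToCotensor f M).toLin := by
  constructor
  · intro x y h
    have h1 : M.lco x = M.lco y := congrArg Subtype.val h
    exact (contractL_lco M x).symm.trans ((congrArg _ h1).trans (contractL_lco M y))
  · intro z
    refine ⟨contractL M.carrier (Coalgebra.counit (R := k) (A := C.carrier)) z.1, ?_⟩
    exact Subtype.ext (lco_contractL (M := M.carrier)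
      (Coalgebra.rTensor_counit_comp_comul (R := k) (A := C.carrier)) z.2)

/-- Corestriction is the cotensor product with `_fC`. -/
def corIsoCotensor (E : DGCoalg k) : cor f E ≅ f.leftBicomod.cotensorFunctor E :=
  NatIso.ofComponents (fun M => isoOfBijective _ (corToCotensor_bijective f M)) fun g =>
    hom_ext (LinearMap.ext fun x => Subtype.ext (LinearMap.congr_fun g.lco_comp x))

/-- The coaction as a morphism from `M` to the cotensor product of `C_f` with its corestriction. -/
def coindUnit (M : Bicomod C E) : M ⟶ f.rightBicomod.cotensor ((cor f E).obj M) :=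
  equalizerLift _ _
    ({ toLin := M.lco
       isHom := M.lco_hom
       lco_comp := M.lcoHom.lco_comp
       rco_comp := M.lcoHom.rco_comp } : M ⟶ f.rightBicomod.tensor ((cor f E).obj M)) <| by
    have h1 : (TensorProduct.assoc k C.carrier D.carrier M.carrier).toLinearMap ∘ₗ
        (f.toHom.toLinearMap.lTensor C.carrier ∘ₗ Coalgebra.comul (R := k)).rTensor M.carrier ∘ₗ
          M.lco = (f.toHom.toLinearMap.rTensor M.carrier ∘ₗ M.lco).lTensor C.carrier ∘ₗ M.lco := by
      rw [← LinearMap.comp_assoc, assoc_lTensor_rTensor, LinearMap.comp_assoc,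
        LinearMap.comp_assoc, M.lco_coassoc, ← LinearMap.comp_assoc, ← LinearMap.lTensor_comp]
    exact LinearMap.congr_fun h1

/-- The linear map `C_f □_D N → N` given by the counit of `C`. -/
def coindCounitLin (N : Bicomod D E) : (f.rightBicomod.cotensor N).carrier →ₗ[k] N.carrier :=
  contractL N.carrier (Coalgebra.counit (R := k) (A := C.carrier)) ∘ₗ
    (LinearMap.eqLocus (cotensorLeft f.rightBicomod N).toLin
      (cotensorRight f.rightBicomod N).toLin).subtype

lemma lco_coindCounitLin (N : Bicomod D E) (x : (f.rightBicomod.cotensor N).carrier) :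
    N.lco (coindCounitLin f N x) = f.toHom.toLinearMap.rTensor N.carrier x.1 :=
  lco_contractL_map (M := N.carrier)
    (Coalgebra.rTensor_counit_comp_comul (R := k) (A := C.carrier)) f.toHom.toLinearMap x.2

lemma isHom_coindCounitLin (N : Bicomod D E) :
    DGVect.IsHom (f.rightBicomod.cotensor N).toDGVect N.toDGVect (coindCounitLin f N) :=
  (C.isHom_contractL N.toDGVect).comp (equalizerι _ _).isHom

/-- The counit `C_f □_D N ⟶ N`. -/
def coindCounit (N : Bicomod D E) : (cor f E).obj (f.rightBicomod.cotensor N) ⟶ N where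
  toLin := coindCounitLin f N
  isHom := isHom_coindCounitLin f N
  lco_comp := (LinearMap.ext (lco_coindCounitLin f N)).trans
    (colinear_contractL (M := N.carrier)
      (Coalgebra.lTensor_counit_comp_comul (R := k) (A := C.carrier)) f.toHom.toLinearMap
      (equalizerι (cotensorLeft f.rightBicomod N) (cotensorRight f.rightBicomod N)).lco_comp)
  rco_comp := colinear_right_contractL (M := N.carrier) (C := C.carrier) _
      (equalizerι (cotensorLeft f.rightBicomod N) (cotensorRight f.rightBicomod N)).rco_comp

lemma coindCounit_naturality {N N' : Bicomod D E} (g : N ⟶ N') :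
    (cor f E).map (f.rightBicomod.cotensorMap g) ≫ coindCounit f N' = coindCounit f N ≫ g :=
  hom_ext (LinearMap.ext fun x => (LinearMap.congr_fun (comp_contractL _ g.toLin) x.1).symm)

/-- One triangle identity between corestriction and coinduction, an instance of the counit axiom of
`M`. The other one is never needed. -/
lemma cor_coindUnit_counit (M : Bicomod C E) :
    (cor f E).map (coindUnit f M) ≫ coindCounit f ((cor f E).obj M) = 𝟙 _ :=
  hom_ext (LinearMap.ext fun x => M.contractL_lco x)

end Bicomod

/-! ### Coinduction of cofree bicomodules -/

section TensorLemmas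

variable {k : Type*} [Field k] {X D V : Type*} [AddCommGroup X] [Module k X] [AddCommGroup D]
  [Module k D] [AddCommGroup V] [Module k V]

/-- First of three lemmas behind `X □_D (D ⊗ V) ≅ X ⊗ V`, where contraction of `D` and the coaction
of `X` are inverse to each other: an element of the cotensor product is recovered from its
contraction. -/
lemma cotensor_cofree_eq {σ : X →ₗ[k] X ⊗[k] D} {δ : D →ₗ[k] D ⊗[k] D} {ε : D →ₗ[k] k}
    (h : ε.lTensor D ∘ₗ δ = (TensorProduct.mk k D k).flip 1) {z : X ⊗[k] (D ⊗[k] V)}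
    (hz : (TensorProduct.assoc k X D (D ⊗[k] V)).toLinearMap (σ.rTensor (D ⊗[k] V) z) =
      ((TensorProduct.assoc k D D V).toLinearMap ∘ₗ δ.rTensor V).lTensor X z) :
    (TensorProduct.assoc k X D V).toLinearMap (σ.rTensor V ((contractL V ε).lTensor X z)) = z := by
  have h1 : ((contractL V ε).lTensor D).lTensor X ∘ₗ
      ((TensorProduct.assoc k D D V).toLinearMap ∘ₗ δ.rTensor V).lTensor X = LinearMap.id := by
    rw [← LinearMap.lTensor_comp, contractL_lTensor_comul h, LinearMap.lTensor_id]
  have h2 : ((contractL V ε).lTensor D).lTensor X ∘ₗ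
      (TensorProduct.assoc k X D (D ⊗[k] V)).toLinearMap ∘ₗ σ.rTensor (D ⊗[k] V) =
      (TensorProduct.assoc k X D V).toLinearMap ∘ₗ σ.rTensor V ∘ₗ (contractL V ε).lTensor X := by
    rw [LinearMap.rTensor_comp_lTensor, ← LinearMap.lTensor_comp_rTensor, ← LinearMap.comp_assoc,
      ← LinearMap.comp_assoc]
    congr 1
    ext; simp
  have h3 := LinearMap.congr_fun h2 z
  simp only [LinearMap.comp_apply] at h3
  rw [hz] at h3
  rw [← h3]
  exact LinearMap.congr_fun h1 z

/-- Coassociativity of `X` tensored with `V`: the candidate inverse does land in the cotensor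
product. -/
lemma cotensor_cofree_mem {σ : X →ₗ[k] X ⊗[k] D} {δ : D →ₗ[k] D ⊗[k] D}
    (h : (TensorProduct.assoc k X D D).toLinearMap ∘ₗ σ.rTensor D ∘ₗ σ = δ.lTensor X ∘ₗ σ)
    (w : X ⊗[k] V) :
    (TensorProduct.assoc k X D (D ⊗[k] V)).toLinearMap (σ.rTensor (D ⊗[k] V)
      ((TensorProduct.assoc k X D V).toLinearMap (σ.rTensor V w))) =
      ((TensorProduct.assoc k D D V).toLinearMap ∘ₗ δ.rTensor V).lTensor X
      ((TensorProduct.assoc k X D V).toLinearMap (σ.rTensor V w)) := by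
  have h1 : ((TensorProduct.assoc k X D (D ⊗[k] V)).toLinearMap ∘ₗ σ.rTensor (D ⊗[k] V)) ∘ₗ
      (TensorProduct.assoc k X D V).toLinearMap =
      ((TensorProduct.assoc k D D V).toLinearMap.lTensor X ∘ₗ
      (TensorProduct.assoc k X (D ⊗[k] D) V).toLinearMap) ∘ₗ
      ((TensorProduct.assoc k X D D).toLinearMap ∘ₗ σ.rTensor D).rTensor V := by
    refine TensorProduct.ext_threefold fun x d v => ?_
    simp only [LinearMap.comp_apply, LinearEquiv.coe_coe, TensorProduct.assoc_tmul,
      LinearMap.rTensor_tmul]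
    induction σ x using TensorProduct.induction_on with
    | zero => simp
    | tmul b c => simp
    | add b c hb hc => simp only [TensorProduct.add_tmul, map_add, hb, hc]
  have h2 : ((TensorProduct.assoc k D D V).toLinearMap ∘ₗ δ.rTensor V).lTensor X ∘ₗ
      (TensorProduct.assoc k X D V).toLinearMap =
      ((TensorProduct.assoc k D D V).toLinearMap.lTensor X ∘ₗ
      (TensorProduct.assoc k X (D ⊗[k] D) V).toLinearMap) ∘ₗ (δ.lTensor X).rTensor V := by
    ext; simp
  refine LinearMap.congr_fun (f := ((TensorProduct.assoc k X D (D ⊗[k] V)).toLinearMap ∘ₗ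
    σ.rTensor (D ⊗[k] V)) ∘ₗ (TensorProduct.assoc k X D V).toLinearMap ∘ₗ σ.rTensor V)
    (g := ((TensorProduct.assoc k D D V).toLinearMap ∘ₗ δ.rTensor V).lTensor X ∘ₗ
      (TensorProduct.assoc k X D V).toLinearMap ∘ₗ σ.rTensor V) ?_ w
  rw [← LinearMap.comp_assoc (σ.rTensor V), h1, LinearMap.comp_assoc, ← LinearMap.rTensor_comp,
    LinearMap.comp_assoc σ, h, ← LinearMap.comp_assoc (σ.rTensor V), h2, LinearMap.rTensor_comp]
  rfl

lemma cotensor_cofree_counit {σ : X →ₗ[k] X ⊗[k] D} {ε : D →ₗ[k] k}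
    (h : ε.lTensor X ∘ₗ σ = (TensorProduct.mk k X k).flip 1) (w : X ⊗[k] V) :
    (contractL V ε).lTensor X
      ((TensorProduct.assoc k X D V).toLinearMap (σ.rTensor V w)) = w := by
  have h1 : (contractL V ε).lTensor X ∘ₗ (TensorProduct.assoc k X D V).toLinearMap =
      (contractR X ε).rTensor V := by
    refine TensorProduct.ext_threefold fun b c w => ?_
    simp [TensorProduct.smul_tmul]
  refine LinearMap.congr_fun (f := ((contractL V ε).lTensor X ∘ₗ
    (TensorProduct.assoc k X D V).toLinearMap) ∘ₗ σ.rTensor V) (g := LinearMap.id) ?_ w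
  rw [h1, ← LinearMap.rTensor_comp, contractR_comp h, LinearMap.rTensor_id]

end TensorLemmas

namespace Bicomod

variable {k : Type u} [Field k] {A B E C D : DGCoalg k} (f : C.Hom D)

/-- The inclusion of `C_f □_D N` into `C ⊗ N`. -/
def coindι (N : Bicomod D E) :
    (f.rightBicomod.cotensor N).carrier →ₗ[k] C.carrier ⊗[k] N.carrier :=
  (LinearMap.eqLocus (cotensorLeft f.rightBicomod N).toLin
      (cotensorRight f.rightBicomod N).toLin).subtype

lemma coindι_injective (N : Bicomod D E) : Function.Injective (coindι f N) :=
  Submodule.injective_subtype _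

lemma isHom_coindι (N : Bicomod D E) : DGVect.IsHom (f.rightBicomod.cotensor N).toDGVect
    (C.toDGVect.tensor N.toDGVect) (coindι f N) :=
  (equalizerι (cotensorLeft f.rightBicomod N) (cotensorRight f.rightBicomod N)).isHom

lemma mem_cotensor_gr {N : Bicomod D E} {n : ℤ} {x : (f.rightBicomod.cotensor N).carrier}
    (hx : coindι f N x ∈ (C.toDGVect.tensor N.toDGVect).gr n) :
    x ∈ (f.rightBicomod.cotensor N).gr n := hx

lemma exists_coindι_eq {N : Bicomod D E} {z : C.carrier ⊗[k] N.carrier}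
    (hz : (TensorProduct.assoc k C.carrier D.carrier N.carrier).toLinearMap
      ((f.toHom.toLinearMap.lTensor C.carrier ∘ₗ Coalgebra.comul (R := k)).rTensor N.carrier z) =
      N.lco.lTensor C.carrier z) : ∃ x, coindι f N x = z := ⟨⟨z, hz⟩, rfl⟩

/-- The map `C_f □_D N → C_f □_D N'` induced by a left colinear map. -/
lemma exists_coindMap {N N' : Bicomod D E} (g : N.carrier →ₗ[k] N'.carrier)
    (hg : N'.lco ∘ₗ g = g.lTensor D.carrier ∘ₗ N.lco) (x : (f.rightBicomod.cotensor N).carrier) :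
    ∃ x', coindι f N' x' = g.lTensor C.carrier (coindι f N x) := by
  refine exists_coindι_eq f ?_
  have h1 : (TensorProduct.assoc k C.carrier D.carrier N.carrier).toLinearMap
      ((f.toHom.toLinearMap.lTensor C.carrier ∘ₗ Coalgebra.comul (R := k)).rTensor N.carrier
        (coindι f N x)) = N.lco.lTensor C.carrier (coindι f N x) := x.2
  have h2 := LinearMap.congr_fun (map_assoc_rTensor (s := LinearMap.id) g
    (comp_id_eq_map_id (f.toHom.toLinearMap.lTensor C.carrier ∘ₗ Coalgebra.comul (R := k))))
    (coindι f N x)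
  have h3 := LinearMap.congr_fun (map_lTensor (LinearMap.id (M := C.carrier)) hg) (coindι f N x)
  exact h2.trans ((congrArg _ h1).trans h3.symm)

lemma coindCounitLin_eq (N : Bicomod D E) (x : (f.rightBicomod.cotensor N).carrier) :
    coindCounitLin f N x =
      contractL N.carrier (Coalgebra.counit (R := k) (A := C.carrier)) (coindι f N x) := rfl

/-- The only place in the analysis of the counit where the hypothesis on `f` itself is used. With `V
= W ⊗ E`, the isomorphism `ψ` of `C_f □_D (D ⊗ V)` with `C ⊗ V` turns the counit into `f ⊗ V`. -/
lemma coindCounitLin_cofree_isQuasiIso (hf : f.IsQuasiIso) (W : Bicomod D E) :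
    DGVect.IsQuasiIso (isHom_coindCounitLin f W.cofree) := by
  let V : DGVect k := W.toDGVect.tensor E.toDGVect
  let ψ : (f.rightBicomod.cotensor W.cofree).carrier →ₗ[k] C.carrier ⊗[k] V.carrier :=
    (contractL V.carrier (Coalgebra.counit (R := k) (A := D.carrier))).lTensor C.carrier ∘ₗ
      coindι f W.cofree
  have hψ : DGVect.IsHom (f.rightBicomod.cotensor W.cofree).toDGVect (C.toDGVect.tensor V) ψ :=
    ((D.isHom_contractL V).lTensor C.toDGVect).comp (isHom_coindι f W.cofree)
  have hθ : ∀ x, (TensorProduct.assoc k C.carrier D.carrier V.carrier).toLinearMap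
      ((f.toHom.toLinearMap.lTensor C.carrier ∘ₗ Coalgebra.comul (R := k)).rTensor V.carrier (ψ x)) =
      coindι f W.cofree x := fun x =>
    cotensor_cofree_eq (Coalgebra.lTensor_counit_comp_comul (R := k) (A := D.carrier)) x.2
  have hbij : Function.Bijective ψ := by
    refine ⟨fun x y h => coindι_injective f _ ?_, fun w => ?_⟩
    · rw [← hθ, h, hθ]
    · obtain ⟨x, hx⟩ := exists_coindι_eq f (N := W.cofree)
        (cotensor_cofree_mem (V := V.carrier) f.rightBicomod.rco_coassoc w)
      exact ⟨x, (congrArg _ hx).trans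
        (cotensor_cofree_counit (V := V.carrier) f.rightBicomod.rco_counit w)⟩
  have hq := (DGVect.isQuasiIso_of_bijective hψ hbij).comp (hf.rTensor V)
  -- The coaction of the counit's value is `f` applied to the first factor; contracting the copy of
  -- `D` in the cofree module undoes that coaction, and the two operations act on different factors.
  have he : f.toHom.toLinearMap.rTensor V ∘ₗ ψ = coindCounitLin f W.cofree := by
    refine LinearMap.ext fun x => ?_
    have h1 : (contractL V.carrier (Coalgebra.counit (R := k) (A := D.carrier))).lTensor D.carrier
        (W.cofree.lco (coindCounitLin f W.cofree x)) = coindCounitLin f W.cofree x :=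
      LinearMap.congr_fun (contractL_lTensor_comul (W := V.carrier)
        (Coalgebra.lTensor_counit_comp_comul (R := k) (A := D.carrier))) _
    refine Eq.trans ?_ ((congrArg _ (lco_coindCounitLin f W.cofree x)).symm.trans h1)
    exact LinearMap.congr_fun ((LinearMap.rTensor_comp_lTensor ..).trans
      (LinearMap.lTensor_comp_rTensor ..).symm) (coindι f W.cofree x)
  -- The map is generalized so that the equality can be substituted although the proof that it is a
  -- morphism depends on it.
  have key : ∀ (g : (f.rightBicomod.cotensor W.cofree).carrier →ₗ[k] D.carrier ⊗[k] V.carrier)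
      (hg : DGVect.IsHom _ (D.toDGVect.tensor V) g), f.toHom.toLinearMap.rTensor V ∘ₗ ψ = g →
      DGVect.IsQuasiIso hg := by
    rintro _ _ rfl
    exact hq
  exact key _ _ he

end Bicomod

/-! ### Coinduction of total bicomodules, by filtration -/

namespace OddComplex

variable {k : Type u} [Field k] {A B : DGCoalg k} (K : OddComplex A B)

/-- The part of the total differential which enters place `n` from elsewhere comes from place `n -
1`. Where all earlier components vanish, the projection therefore commutes with the differentials;
this identifies the graded pieces of the filtration. -/
lemma pr_totD {n : ℕ} {x : K.Sum} (h : ∀ j, j < n → K.pr j x = 0) :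
    K.pr n (K.totD x) = (K.obj n).d (K.pr n x) := by
  cases n with
  | zero => exact K.pr_zero_totD x
  | succ n => rw [pr_succ_totD, h n (by omega), map_zero, add_zero]

lemma lTensor_pr_d (V : DGVect k) {n : ℕ} {x : V.carrier ⊗[k] K.Sum}
    (h : ∀ j, j < n → (K.pr j).lTensor V.carrier x = 0) :
    (K.pr n).lTensor V.carrier ((V.tensor K.totDG).d x) =
      (V.tensor (K.obj n).toDGVect).d ((K.pr n).lTensor V.carrier x) := by
  cases n with
  | zero =>
    refine LinearMap.congr_fun (f := (K.pr 0).lTensor V.carrier ∘ₗ (V.tensor K.totDG).d)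
      (g := (V.tensor (K.obj 0).toDGVect).d ∘ₗ (K.pr 0).lTensor V.carrier)
      (TensorProduct.ext' fun v x => ?_) x
    simp [K.pr_zero_totD]
  | succ n =>
    have h1 : (K.pr (n + 1)).lTensor V.carrier ∘ₗ (V.tensor K.totDG).d =
        (V.tensor (K.obj (n + 1)).toDGVect).d ∘ₗ (K.pr (n + 1)).lTensor V.carrier +
        TensorProduct.map V.sgn (K.δ n) ∘ₗ (K.pr n).lTensor V.carrier := by
      refine TensorProduct.ext' fun v x => ?_
      simp [K.pr_succ_totD, TensorProduct.tmul_add, add_assoc]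
    refine (LinearMap.congr_fun h1 x).trans ?_
    have h2 : TensorProduct.map V.sgn (K.δ n) ((K.pr n).lTensor V.carrier x) = 0 := by
      rw [h n (by omega), map_zero]
    exact (congrArg _ h2).trans (add_zero _)

lemma lTensor_pr_inc_same {V : Type*} [AddCommGroup V] [Module k V] (n : ℕ)
    (z : V ⊗[k] (K.obj n).carrier) : (K.pr n).lTensor V ((K.inc n).lTensor V z) = z := by
  rw [← LinearMap.lTensor_comp_apply, LinearMap.ext (f := K.pr n ∘ₗ K.inc n) (g := LinearMap.id)
    (K.pr_inc_same n), LinearMap.lTensor_id, LinearMap.id_apply]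

lemma lTensor_pr_inc_ne {V : Type*} [AddCommGroup V] [Module k V] {m n : ℕ} (h : m ≠ n)
    (z : V ⊗[k] (K.obj n).carrier) : (K.pr m).lTensor V ((K.inc n).lTensor V z) = 0 := by
  rw [← LinearMap.lTensor_comp_apply, LinearMap.ext (f := K.pr m ∘ₗ K.inc n) (g := 0)
    (K.pr_inc_ne h), LinearMap.lTensor_zero, LinearMap.zero_apply]

lemma lTensor_pr_mem (V : DGVect k) (n : ℕ) {m : ℤ} {x : V.carrier ⊗[k] K.Sum}
    (hx : x ∈ (V.tensor K.totDG).gr m) :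
    (K.pr n).lTensor V.carrier x ∈ (V.tensor (K.obj n).toDGVect).gr m := by
  have h := (DGVect.IsHom.id V).graded.map (N := K.totDG) (N' := (K.obj n).toDGVect) (e' := 0)
    (g := K.pr n) (fun i y hy => by rw [add_zero]; exact K.mem_totDG.1 hy n) m x hx
  rwa [add_zero, add_zero] at h

lemma lTensor_inc_mem (V : DGVect k) (n : ℕ) {m : ℤ} {x : V.carrier ⊗[k] (K.obj n).carrier}
    (hx : x ∈ (V.tensor (K.obj n).toDGVect).gr m) :
    (K.inc n).lTensor V.carrier x ∈ (V.tensor K.totDG).gr m := by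
  have h := (DGVect.IsHom.id V).graded.map (K.inc_graded n) m x hx
  rwa [add_zero, add_zero] at h

end OddComplex

namespace Bicomod

variable {k : Type u} [Field k] {E C D : DGCoalg k} (f : C.Hom D)

/-- The part of the cone of the counit of `C_f □_D J` in filtration degree at least `n`, for the
total bicomodule `J` of a complex. -/
def coneFiltration (K : OddComplex D E) (n : ℕ) :
    Submodule k ((f.rightBicomod.cotensor K.tot).carrier × K.Sum) :=
  ⨅ j : Fin n, (LinearMap.ker ((K.pr j).lTensor C.carrier ∘ₗ coindι f K.tot)).prod
    (LinearMap.ker (K.pr j))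

lemma mem_coneFiltration {K : OddComplex D E} {n : ℕ}
    {z : (f.rightBicomod.cotensor K.tot).carrier × K.Sum} : z ∈ coneFiltration f K n ↔
      ∀ j, j < n → (K.pr j).lTensor C.carrier (coindι f K.tot z.1) = 0 ∧ K.pr j z.2 = 0 := by
  rw [coneFiltration, Submodule.mem_iInf]
  exact ⟨fun h j hj => h ⟨j, hj⟩, fun h j => h j j.2⟩

/-- For a cycle of the cone in filtration step `n`, the `n`-th component is a cycle in the cone of
the counit for the single term `K.obj n`. That cone is acyclic, and a primitive there, included at
place `n`, pushes the given cycle into step `n + 1`. -/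
lemma exists_sub_mem_coneFiltration {K : OddComplex D E} {n : ℕ}
    (hK : DGVect.IsQuasiIso (isHom_coindCounitLin f (K.obj n))) {m : ℤ}
    {x : (f.rightBicomod.cotensor K.tot).carrier} {y : K.Sum}
    (hx : x ∈ (f.rightBicomod.cotensor K.tot).gr (m + 1 + 1)) (hy : y ∈ K.totDG.gr (m + 1))
    (hxy : ∀ j, j < n → (K.pr j).lTensor C.carrier (coindι f K.tot x) = 0 ∧ K.pr j y = 0)
    (hdx : (f.rightBicomod.cotensor K.tot).d x = 0)
    (hdy : coindCounitLin f K.tot x + K.totD y = 0) :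
    ∃ u ∈ (f.rightBicomod.cotensor K.tot).gr (m + 1), ∃ v ∈ K.totDG.gr m, ∀ j, j < n + 1 →
      (K.pr j).lTensor C.carrier
        (coindι f K.tot (x + (f.rightBicomod.cotensor K.tot).d u)) = 0 ∧
      K.pr j (y - (coindCounitLin f K.tot u + K.totD v)) = 0 := by
  -- The projections and inclusions of a single term are colinear, but in general not both are maps
  -- of complexes; so they are carried through the cotensor product by colinearity alone, and
  -- compatibility with `d` is checked separately.
  obtain ⟨x', hx'⟩ := exists_coindMap f (N := K.tot) (N' := K.obj n) (K.pr n)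
    (K.totLco_pr n).symm x
  have hxe := isHom_coindι f K.tot
  have hne := isHom_coindι f (K.obj n)
  have hκ : coindCounitLin f (K.obj n) x' = K.pr n (coindCounitLin f K.tot x) := by
    rw [coindCounitLin_eq, hx', coindCounitLin_eq]
    exact (LinearMap.congr_fun (comp_contractL _ (K.pr n)) _).symm
  have hd1 : (f.rightBicomod.cotensor (K.obj n)).d x' = 0 := by
    refine coindι_injective f _ ?_
    rw [hne.comm_apply, hx', ← K.lTensor_pr_d C.toDGVect fun j hj => (hxy j hj).1, map_zero]
    refine (congrArg _ (hxe.comm_apply x).symm).trans ?_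
    rw [hdx, map_zero, map_zero]
  have hd2 : coindCounitLin f (K.obj n) x' + (K.obj n).d (K.pr n y) = 0 := by
    rw [hκ, ← K.pr_totD fun j hj => (hxy j hj).2, ← map_add, hdy, map_zero]
  obtain ⟨⟨u', v'⟩, ⟨hu', hv'⟩, huv⟩ := ((DGVect.isQuasiIso_iff_isAcyclic_cone _).1
    hK).exists_homogeneous (n := m) (x := (x', K.pr n y))
    ⟨mem_cotensor_gr f (by rw [hx']; exact K.lTensor_pr_mem C.toDGVect n (hxe.mem _ _ hx)),
      K.mem_totDG.1 hy n⟩ (Prod.ext (neg_eq_zero.2 hd1) hd2)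
  have hu1 : -(f.rightBicomod.cotensor (K.obj n)).d u' = x' := congrArg Prod.fst huv
  have hv1 : coindCounitLin f (K.obj n) u' + (K.obj n).d v' = K.pr n y := congrArg Prod.snd huv
  obtain ⟨u, hu⟩ := exists_coindMap f (N := K.obj n) (N' := K.tot) (K.inc n) (K.totLco_inc n) u'
  have hκu : coindCounitLin f K.tot u = K.inc n (coindCounitLin f (K.obj n) u') := by
    rw [coindCounitLin_eq, hu, coindCounitLin_eq]
    exact (LinearMap.congr_fun (comp_contractL _ (K.inc n)) _).symm
  refine ⟨u, mem_cotensor_gr f (by rw [hu]; exact K.lTensor_inc_mem C.toDGVect n (hne.mem _ _ hu')),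
    K.inc n v', K.inc_mem hv', fun j hj => ⟨?_, ?_⟩⟩
  · rw [map_add, map_add, hxe.comm_apply, K.lTensor_pr_d C.toDGVect (fun i hi => by
      rw [hu, K.lTensor_pr_inc_ne (by omega)]), hu]
    rcases Nat.lt_succ_iff_lt_or_eq.1 hj with hj | rfl
    · rw [(hxy j hj).1, K.lTensor_pr_inc_ne (by omega), map_zero, add_zero]
    · rw [← hx', K.lTensor_pr_inc_same, ← hu1, map_neg, hne.comm_apply, neg_add_cancel]
  · rw [map_sub, map_add, hκu, K.pr_totD (fun i hi => K.pr_inc_ne (by omega) _)]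
    rcases Nat.lt_succ_iff_lt_or_eq.1 hj with hj | rfl
    · rw [(hxy j hj).2, K.pr_inc_ne (by omega), K.pr_inc_ne (by omega), map_zero, add_zero,
        sub_zero]
    · rw [K.pr_inc_same, K.pr_inc_same, hv1, sub_self]

/-- The key point. The cofree case handles each graded piece, and the growing lower bound of the
terms, together with positivity of `C`, makes the filtration of the cone finite in each degree. -/
lemma coindCounitLin_tot_isQuasiIso (hC : C.IsPositive) (hf : f.IsQuasiIso)
    (K : CofreeComplex D E) :
    DGVect.IsQuasiIso (isHom_coindCounitLin f K.tot) := by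
  rw [DGVect.isQuasiIso_iff_isAcyclic_cone]
  refine DGVect.isAcyclic_of_filtration (coneFiltration f K.toOddComplex) ?_ (fun m => ?_) ?_
  · exact (Submodule.eq_top_iff').2 fun z => (mem_coneFiltration f).2 fun j hj =>
      absurd hj (Nat.not_lt_zero j)
  -- In degree `m` of the cone, `x` has degree `m + 1`. As `C` is positive, its component at place
  -- `j` vanishes when `m + 1 < K.bound + j`, that is for `j ≥ m + 2 - K.bound`; this bound also
  -- suffices for `y`, of degree `m`.
  · refine ⟨(m + 2 - K.bound).toNat, ?_⟩
    rintro ⟨x, y⟩ ⟨hx, hy⟩ h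
    rw [mem_coneFiltration] at h
    refine Prod.ext (coindι_injective f _ (K.lTensor_ext fun j => ?_)) (K.sum_ext fun j => ?_)
    · refine Eq.trans ?_ ((map_zero _).symm.trans (congrArg _ (map_zero (coindι f K.tot)).symm))
      rcases lt_or_ge j (m + 2 - K.bound).toNat with hj | hj
      · exact (h j hj).1
      · have h1 := K.lTensor_pr_mem C.toDGVect j ((isHom_coindι f K.tot).mem _ _ hx)
        rw [tensor_gr_eq_bot hC (K.isBounded j) _ (by omega), Submodule.mem_bot] at h1
        exact h1
    · refine Eq.trans ?_ (map_zero _).symm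
      rcases lt_or_ge j (m + 2 - K.bound).toNat with hj | hj
      · exact (h j hj).2
      · have h1 := K.mem_totDG.1 hy j
        rw [K.isBounded j _ (by omega), Submodule.mem_bot] at h1
        exact h1
  · rintro n m ⟨x, y⟩ ⟨hx, hy⟩ h hd
    rw [mem_coneFiltration] at h
    obtain ⟨W, hW⟩ := K.cofree n
    have hn : DGVect.IsQuasiIso (isHom_coindCounitLin f (K.obj n)) := by
      rw [hW]
      exact coindCounitLin_cofree_isQuasiIso f hf W
    obtain ⟨u, hu, v, hv, huv⟩ := exists_sub_mem_coneFiltration f hn hx hy h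
      (neg_eq_zero.1 (congrArg Prod.fst hd)) (congrArg Prod.snd hd)
    refine ⟨(u, v), ⟨hu, hv⟩, (mem_coneFiltration f).2 fun j hj => ⟨?_, (huv j hj).2⟩⟩
    refine Eq.trans ?_ (huv j hj).1
    exact congrArg (fun z => (K.pr j).lTensor C.carrier (coindι f K.tot z)) (sub_neg_eq_add x _)

end Bicomod

/-! ### Derived corestriction and coinduction are mutually inverse -/

namespace CategoryTheory

/-- Functors to a full subcategory are isomorphic if they become so in the ambient category. -/
def ObjectProperty.isoOfCompι {C D : Type*} [Category* C] [Category* D] {P : ObjectProperty D}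
    {F G : C ⥤ P.FullSubcategory} (e : F ⋙ P.ι ≅ G ⋙ P.ι) : F ≅ G :=
  NatIso.ofComponents (fun X => P.isoMk (e.app X))
    fun g => ObjectProperty.hom_ext _ (e.hom.naturality g)

end CategoryTheory

namespace Bicomod

variable {k : Type u} [Field k] {C D : DGCoalg k} (f : C.Hom D) (E : DGCoalg k)

/-- Corestriction on the homotopy category. -/
def corH : HCat C E ⥤ HCat D E :=
  CategoryTheory.Quotient.lift _ (cor f E ⋙ toH D E) fun _ _ _ _ h =>
    CategoryTheory.Quotient.sound _ (cor_homotopic f h)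

lemma corH_inverts : (quasiIso C E).IsInvertedBy (corH f E ⋙ HtoD D E) := by
  rintro M N φ ⟨g, rfl, hg⟩
  exact MorphismProperty.Q_inverts _ _ ⟨(cor f E).map g, rfl, hg⟩

/-- Corestriction on the derived category. -/
def corD : DCat C E ⥤ DCat D E :=
  Localization.lift (corH f E ⋙ HtoD D E) (corH_inverts f E) (HtoD C E)

/-- Corestriction on the derived category is induced by corestriction on the homotopy category. -/
def corDFac : HtoD C E ⋙ corD f E ≅ corH f E ⋙ HtoD D E :=
  Localization.fac (corH f E ⋙ HtoD D E) (corH_inverts f E) (HtoD C E)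

/-- Corestriction on `H⁺`. -/
def corHPlus : HPlus C E ⥤ HPlus D E :=
  (isPlusH D E).lift ((isPlusH C E).ι ⋙ corH f E) fun X => by
    obtain ⟨M, hM, ⟨e⟩⟩ := X.2
    exact ⟨(cor f E).obj M, hM, ⟨(corH f E).mapIso e⟩⟩

/-- Corestriction on `D⁺`. -/
def corDPlus : DPlus C E ⥤ DPlus D E :=
  (isPlusD D E).lift ((isPlusD C E).ι ⋙ corD f E) fun X => by
    obtain ⟨M, hM, ⟨e⟩⟩ := X.2
    exact ⟨(cor f E).obj M, hM, ⟨(corD f E).mapIso e ≪≫ (corDFac f E).app _⟩⟩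

/-- Corestriction on `D⁺` is induced by corestriction on `H⁺`. -/
def corDPlusFac : HtoDPlus C E ⋙ corDPlus f E ≅ corHPlus f E ⋙ HtoDPlus D E :=
  ObjectProperty.isoOfCompι (Functor.isoWhiskerLeft (isPlusH C E).ι (corDFac f E))

/-- Corestriction on the homotopy category is the cotensor product with `_fC`. -/
def corHIso : corH f E ≅ f.leftBicomod.cotensorH E :=
  CategoryTheory.Quotient.natIsoLift _ (Functor.isoWhiskerRight (corIsoCotensor f E) (toH D E))

variable {E}

/-- Corestriction descends to the derived category as it stands, and it is isomorphic to cotensoring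
with `_fC`. Positivity of `C` and `E` provides the localization property of `D⁺`. -/
lemma isDerivedCotensor_corDPlus (hC : C.IsPositive) (hE : E.IsPositive) :
    f.leftBicomod.IsDerivedCotensor (f.leftBicomod_isBoundedBelow hC) (corDPlus f E) :=
  isDerivedCotensor_of_iso hC hE _ (ObjectProperty.isoOfCompι
    (Functor.isoWhiskerLeft (isPlusH C E).ι
      (corDFac f E ≪≫ Functor.isoWhiskerRight (corHIso f E) (HtoD D E))))

variable (E)

/-- The unit `𝟭 ⟶ C_f □_D -` on the homotopy category. -/
def coindUnitH : 𝟭 (HCat C E) ⟶ corH f E ⋙ f.rightBicomod.cotensorH E where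
  app X := (toH C E).map (coindUnit f X.as)
  naturality X Y g := by
    obtain ⟨g, rfl⟩ := (toH C E).map_surjective g
    refine ((toH C E).map_comp g (coindUnit f Y.as)).symm.trans (Eq.trans ?_
      ((toH C E).map_comp (coindUnit f X.as) (f.rightBicomod.cotensorMap ((cor f E).map g))))
    exact congrArg _ (hom_ext (LinearMap.ext fun x =>
      Subtype.ext (LinearMap.congr_fun g.lco_comp x)))

/-- The counit `C_f □_D - ⟶ 𝟭` on the homotopy category. -/
def coindCounitH : f.rightBicomod.cotensorH E ⋙ corH f E ⟶ 𝟭 (HCat D E) where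
  app X := (toH D E).map (coindCounit f X.as)
  naturality X Y g := by
    obtain ⟨g, rfl⟩ := (toH D E).map_surjective g
    refine ((toH D E).map_comp ((cor f E).map (f.rightBicomod.cotensorMap g))
      (coindCounit f Y.as)).symm.trans (Eq.trans ?_
      ((toH D E).map_comp (coindCounit f X.as) g))
    exact congrArg _ (coindCounit_naturality f g)

variable (hC : C.IsPositive) (hD : D.IsPositive) {E} (hE : E.IsPositive)

/-- The derived functor of `C_f □_D -`. -/
def coindDPlus : DPlus D E ⥤ DPlus C E :=
  resolve hD hE ⋙ f.rightBicomod.cotensorHPlus (f.rightBicomod_isBoundedBelow hC) E ⋙ HtoDPlus C E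

/-- The morphism `C_f □_D J ⟶ J` for a resolution `J`, in the derived category. -/
def coindCounitPlus (Y : DPlus D E) : (HtoDPlus D E).obj ((corHPlus f E).obj
    ((f.rightBicomod.cotensorHPlus (f.rightBicomod_isBoundedBelow hC) E).obj
      ((resolve hD hE).obj Y))) ⟶ (HtoDPlus D E).obj ((resolve hD hE).obj Y) :=
  ObjectProperty.homMk ((HtoD D E).map ((coindCounitH f E).app ((resolve hD hE).obj Y).obj))

lemma isIso_coindCounitPlus (hf : f.IsQuasiIso) (Y : DPlus D E) :
    IsIso (coindCounitPlus f hC hD hE Y) :=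
  (ObjectProperty.isIso_hom_iff _).1 (isIso_toD_map
    (coindCounit f (resolution hD hE Y).tot)
    (coindCounitLin_tot_isQuasiIso f hC hf (resolution hD hE Y)))

/-- `C_f □_D^R -` followed by corestriction is the identity. -/
def coindCorIso (hf : f.IsQuasiIso) : coindDPlus f hC hD hE ⋙ corDPlus f E ≅ 𝟭 (DPlus D E) :=
  Functor.isoWhiskerLeft (resolve hD hE ⋙
      f.rightBicomod.cotensorHPlus (f.rightBicomod_isBoundedBelow hC) E) (corDPlusFac f E) ≪≫
    NatIso.ofComponents
      (fun Y => @asIso _ _ _ _ _ (isIso_coindCounitPlus f hC hD hE hf Y) :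
        ∀ Y, _ ≅ (resolve hD hE ⋙ HtoDPlus D E).obj Y)
      (fun g => ObjectProperty.hom_ext _ (by
        have h := (coindCounitH f E).naturality ((resolve hD hE).map g).hom
        exact ((HtoD D E).map_comp _ _).symm.trans
          ((congrArg (HtoD D E).map h).trans ((HtoD D E).map_comp _ _)))) ≪≫
    asIso (resolveAdj hD hE).counit

/-- The unit `𝟭 ⟶ C_f □_D -` on `H⁺`. -/
def coindUnitHPlus : 𝟭 (HPlus C E) ⟶ corHPlus f E ⋙
    f.rightBicomod.cotensorHPlus (f.rightBicomod_isBoundedBelow hC) E where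
  app X := ⟨(coindUnitH f E).app X.obj⟩
  naturality _ _ g := ObjectProperty.hom_ext _ ((coindUnitH f E).naturality g.hom)

/-- The morphism from `M` to the derived cotensor product of `C_f` with its corestriction. -/
def corCoindUnit : 𝟭 (HPlus C E) ⟶ corHPlus f E ⋙ HtoDPlus D E ⋙ resolve hD hE ⋙
    f.rightBicomod.cotensorHPlus (f.rightBicomod_isBoundedBelow hC) E :=
  coindUnitHPlus f hC ≫ Functor.whiskerLeft (corHPlus f E) (Functor.whiskerRight
    (resolveAdj hD hE).unit (f.rightBicomod.cotensorHPlus (f.rightBicomod_isBoundedBelow hC) E))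

/-- Two out of three: the corestriction of `z`, followed by the counit, is the resolution map `y`.
Both `y` and the counit are quasi-isomorphisms, hence so is the corestriction of `z`, and that has
the same underlying map as `z`. -/
lemma isIso_corCoindUnit (hf : f.IsQuasiIso) (X : HPlus C E) :
    IsIso ((HtoDPlus C E).map ((corCoindUnit f hC hD hE).app X)) := by
  rw [← ObjectProperty.isIso_hom_iff]
  let K := resolution hD hE ((HtoDPlus D E).obj ((corHPlus f E).obj X))
  let M : Bicomod C E := X.obj.as
  -- The adjunction unit lives in the homotopy category; a representing morphism of bicomodules is
  -- needed in order to speak of quasi-isomorphisms.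
  obtain ⟨y, hy⟩ := (toH D E).map_surjective (X := (cor f E).obj M) (Y := K.tot)
    ((resolveAdj hD hE).unit.app ((corHPlus f E).obj X)).hom
  have hyq : DGVect.IsQuasiIso y.isHom := by
    refine isQuasiIso_of_isIso_toD_map y ?_
    have := (resolveAdj hD hE).isIso_map_unit_app ((corHPlus f E).obj X)
    rw [← ObjectProperty.isIso_hom_iff] at this
    rw [Functor.comp_map, hy]
    exact this
  let z : M ⟶ f.rightBicomod.cotensor K.tot := coindUnit f M ≫ f.rightBicomod.cotensorMap y
  have hz : (cor f E).map z ≫ coindCounit f K.tot = y := by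
    rw [Functor.map_comp, Category.assoc, coindCounit_naturality, ← Category.assoc,
      cor_coindUnit_counit, Category.id_comp]
  have hzq : DGVect.IsQuasiIso ((cor f E).map z).isHom := by
    refine DGVect.IsQuasiIso.of_comp_left (coindCounitLin_tot_isQuasiIso f hC hf K) (?_ :
      DGVect.IsQuasiIso ((cor f E).map z ≫ coindCounit f K.tot).isHom)
    rw [hz]
    exact hyq
  have := isIso_toD_map z hzq
  have he : ((HtoDPlus C E).map ((corCoindUnit f hC hD hE).app X)).hom = (toD C E).map z := by
    refine congrArg (HtoD C E).map ?_
    refine Eq.trans ?_ ((toH C E).map_comp _ _).symm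
    exact congrArg (fun t => (toH C E).map (coindUnit f M) ≫ (f.rightBicomod.cotensorH E).map t)
      hy.symm
  rw [he]
  exact this

/-- Corestriction followed by `C_f □_D^R -` is the identity. -/
def corCoindIso (hf : f.IsQuasiIso) : corDPlus f E ⋙ coindDPlus f hC hD hE ≅ 𝟭 (DPlus C E) :=
  -- As `D⁺` is a localization of `H⁺`, natural isomorphisms can be constructed on left bounded
  -- bicomodules and then descend.
  have := isLocalization_HtoDPlus hC hE
  Iso.symm <| Localization.liftNatIso (HtoDPlus C E)
    ((MorphismProperty.isomorphisms (DPlus C E)).inverseImage (HtoDPlus C E))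
    (HtoDPlus C E ⋙ 𝟭 _) (HtoDPlus C E ⋙ corDPlus f E ⋙ coindDPlus f hC hD hE) _ _
    (NatIso.ofComponents
      (fun X => @asIso _ _ _ _ _ (isIso_corCoindUnit f hC hD hE hf X) :
        ∀ X, _ ≅ ((corHPlus f E ⋙ HtoDPlus D E) ⋙ coindDPlus f hC hD hE).obj X)
      (fun g => (Functor.whiskerRight (corCoindUnit f hC hD hE) (HtoDPlus C E)).naturality g) ≪≫
      Functor.isoWhiskerRight (corDPlusFac f E).symm (coindDPlus f hC hD hE))

/-! ### Compatibility of corestriction with shifts and distinguished triangles -/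

/-- Corestriction commutes with the shift. -/
def corShiftIso (M : Bicomod C E) : (cor f E).obj M.shift ≅ ((cor f E).obj M).shift :=
  isoOfBijective
    { toLin := LinearMap.id
      isHom := DGVect.IsHom.id _
      lco_comp := by
        change (D.sgn.rTensor M.carrier ∘ₗ f.toHom.toLinearMap.rTensor M.carrier ∘ₗ M.lco) ∘ₗ
          LinearMap.id = LinearMap.lTensor D.carrier LinearMap.id ∘ₗ
            f.toHom.toLinearMap.rTensor M.carrier ∘ₗ C.sgn.rTensor M.carrier ∘ₗ M.lco
        rw [LinearMap.lTensor_id, LinearMap.id_comp, LinearMap.comp_id, ← LinearMap.comp_assoc,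
          ← LinearMap.comp_assoc, ← LinearMap.rTensor_comp, ← LinearMap.rTensor_comp, f.isHom.sgn]
      rco_comp := comp_id_eq_map_id _ } Function.bijective_id

/-- Corestriction commutes with the cone. -/
def corConeIso {M N : Bicomod C E} (u : M ⟶ N) :
    (cor f E).obj (cone u) ≅ cone ((cor f E).map u) :=
  isoOfBijective
    { toLin := LinearMap.id
      isHom := DGVect.IsHom.id _
      lco_comp := by
        have h : f.toHom.toLinearMap.rTensor (M.carrier × N.carrier) ∘ₗ
            prodL (C.sgn.rTensor M.carrier ∘ₗ M.lco) N.lco =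
            prodL (D.sgn.rTensor M.carrier ∘ₗ f.toHom.toLinearMap.rTensor M.carrier ∘ₗ M.lco)
              (f.toHom.toLinearMap.rTensor N.carrier ∘ₗ N.lco) := by
          have hs : f.toHom.toLinearMap.rTensor M.carrier ∘ₗ C.sgn.rTensor M.carrier =
              D.sgn.rTensor M.carrier ∘ₗ f.toHom.toLinearMap.rTensor M.carrier := by
            rw [← LinearMap.rTensor_comp, ← LinearMap.rTensor_comp, f.isHom.sgn]
          refine LinearMap.prod_ext ?_ ?_
          · rw [LinearMap.comp_assoc, prodL_inl, prodL_inl, ← LinearMap.comp_assoc,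
              LinearMap.rTensor_comp_lTensor, ← LinearMap.lTensor_comp_rTensor,
              LinearMap.comp_assoc, ← LinearMap.comp_assoc M.lco (C.sgn.rTensor _), hs,
              LinearMap.comp_assoc]
          · rw [LinearMap.comp_assoc, prodL_inr, prodL_inr, ← LinearMap.comp_assoc,
              LinearMap.rTensor_comp_lTensor, ← LinearMap.lTensor_comp_rTensor,
              LinearMap.comp_assoc]
        refine Eq.trans ?_ (congrArg (fun t => LinearMap.lTensor D.carrier LinearMap.id ∘ₗ t) h.symm)
        exact comp_id_eq_map_id _
      rco_comp := comp_id_eq_map_id _ } Function.bijective_id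

variable (E)

/-- Corestriction commutes with the shift on the homotopy category. -/
def corHShiftIso : shiftH C E ⋙ corH f E ≅ corH f E ⋙ shiftH D E :=
  CategoryTheory.Quotient.natIsoLift _ (NatIso.ofComponents
    (fun M => (toH D E).mapIso (corShiftIso f M)) fun {M N} g =>
      ((toH D E).map_comp ((cor f E).map ((shiftFunctor C E).map g)) (corShiftIso f N).hom).symm.trans
        ((toH D E).map_comp (corShiftIso f M).hom ((shiftFunctor D E).map ((cor f E).map g))))

/-- The shift on the derived category is induced by the shift on the homotopy category. -/
def shiftDFac : HtoD C E ⋙ shiftD C E ≅ shiftH C E ⋙ HtoD C E :=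
  Localization.fac (shiftH C E ⋙ HtoD C E) (shiftH_inverts C E) (HtoD C E)

/-- Corestriction commutes with the shift, after localization. -/
def corShiftIsoAux : HtoD C E ⋙ shiftD C E ⋙ corD f E ≅ HtoD C E ⋙ corD f E ⋙ shiftD D E :=
  Functor.isoWhiskerRight (shiftDFac E) (corD f E) ≪≫
    Functor.isoWhiskerLeft (shiftH C E) (corDFac f E) ≪≫
    Functor.isoWhiskerRight (corHShiftIso f E) (HtoD D E) ≪≫
    Functor.isoWhiskerLeft (corH f E) (shiftDFac E).symm ≪≫
    Functor.isoWhiskerRight (corDFac f E).symm (shiftD D E)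

/-- Corestriction commutes with the shift on the derived category. -/
def corDShiftIso : shiftD C E ⋙ corD f E ≅ corD f E ⋙ shiftD D E :=
  Localization.liftNatIso (HtoD C E) (quasiIso C E) _ _ _ _ (corShiftIsoAux f E)

variable {E}

lemma corDShiftIso_app (X : HCat C E) : (corDShiftIso f E).hom.app ((HtoD C E).obj X) =
    (corShiftIsoAux f E).hom.app X := by
  refine (Localization.liftNatTrans_app (HtoD C E) (quasiIso C E) _ _ _ _
    (corShiftIsoAux f E).hom X).trans ?_
  exact (Category.id_comp _).trans (Category.comp_id _)

/-- Corestriction of a bicomodule, in the derived category. -/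
def corDIso (M : Bicomod C E) : (corD f E).obj ((toD C E).obj M) ≅ (toD D E).obj ((cor f E).obj M) :=
  (corDFac f E).app ((toH C E).obj M)

lemma corDIso_naturality {M N : Bicomod C E} (g : M ⟶ N) :
    (corD f E).map ((toD C E).map g) ≫ (corDIso f N).hom =
      (corDIso f M).hom ≫ (toD D E).map ((cor f E).map g) :=
  (corDFac f E).hom.naturality ((toH C E).map g)

lemma corDIso_naturality_assoc {M N : Bicomod C E} (g : M ⟶ N) {Z : DCat D E}
    (t : (toD D E).obj ((cor f E).obj N) ⟶ Z) :
    (corD f E).map ((toD C E).map g) ≫ (corDIso f N).hom ≫ t =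
      (corDIso f M).hom ≫ (toD D E).map ((cor f E).map g) ≫ t := by
  rw [← Category.assoc, corDIso_naturality, Category.assoc]

/-- On actual bicomodules the abstract comparison of shifts is the concrete identification
`corShiftIso`. The square at the connecting morphism of a triangle rests on this. -/
lemma corDShiftIso_comp (M : Bicomod C E) : (corDShiftIso f E).hom.app ((toD C E).obj M) ≫
    (shiftD D E).map (corDIso f M).hom ≫ (shiftDIso ((cor f E).obj M)).hom =
    (corD f E).map (shiftDIso M).hom ≫ (corDIso f M.shift).hom ≫
      (toD D E).map (corShiftIso f M).hom := by
  have key : ∀ {X₁ X₂ X₃ X₄ X₅ X₆ : DCat D E} (a : X₁ ⟶ X₂) (b : X₂ ⟶ X₃) (c : X₃ ⟶ X₄)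
      (s : X₅ ≅ X₄) (t : X₆ ≅ X₅), (a ≫ b ≫ c ≫ s.inv ≫ t.inv) ≫ t.hom ≫ s.hom = a ≫ b ≫ c := by
    intros
    simp
  refine (congrArg (fun z => z ≫ (shiftD D E).map (corDIso f M).hom ≫
    (shiftDIso ((cor f E).obj M)).hom) (corDShiftIso_app f ((toH C E).obj M))).trans ?_
  exact key _ _ _ (shiftDIso ((cor f E).obj M)) ((shiftD D E).mapIso (corDIso f M))

/-- Corestriction carries the standard triangle of `u` to the standard triangle of its
corestriction, by the identity on elements. The rest moves the chosen isomorphisms through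
naturality squares. -/
lemma corD_isDistinguished {X Y Z : DCat C E} {g : X ⟶ Y} {g' : Y ⟶ Z}
    {h : Z ⟶ (shiftD C E).obj X} (hd : IsDistinguished g g' h) :
    IsDistinguished ((corD f E).map g) ((corD f E).map g')
      ((corD f E).map h ≫ (corDShiftIso f E).hom.app X) := by
  obtain ⟨M, N, u, a, b, c, h1, h2, h3⟩ := hd
  refine ⟨(cor f E).obj M, (cor f E).obj N, (cor f E).map u, (corD f E).mapIso a ≪≫ corDIso f M,
    (corD f E).mapIso b ≪≫ corDIso f N,
    (corD f E).mapIso c ≪≫ corDIso f (cone u) ≪≫ (toD D E).mapIso (corConeIso f u), ?_, ?_, ?_⟩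
  · simp only [Iso.trans_hom, Functor.mapIso_hom, Category.assoc]
    rw [← corDIso_naturality, ← Functor.map_comp_assoc, ← Functor.map_comp_assoc, h1]
  · simp only [Iso.trans_hom, Functor.mapIso_hom, Category.assoc]
    have h4 : (cor f E).map (coneIn u) ≫ (corConeIso f u).hom = coneIn ((cor f E).map u) := rfl
    rw [← h4, Functor.map_comp (toD D E), ← Functor.map_comp_assoc (corD f E), h2,
      Functor.map_comp_assoc (corD f E), corDIso_naturality_assoc]
  · simp only [Iso.trans_hom, Functor.mapIso_hom, Category.assoc]
    have h4 : (corConeIso f u).hom ≫ coneOut ((cor f E).map u) =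
      (cor f E).map (coneOut u) ≫ (corShiftIso f M).hom := rfl
    have h5 := (corDShiftIso f E).hom.naturality a.hom
    rw [← Functor.map_comp (toD D E), h4, Functor.map_comp (toD D E),
      ← corDIso_naturality_assoc, ← Functor.map_comp_assoc (corD f E), ← h3,
      Functor.map_comp (shiftD D E), Category.assoc]
    have h6 : ∀ {W : DCat D E} (t : (shiftD D E).obj ((corD f E).obj ((toD C E).obj M)) ⟶ W),
        (corDShiftIso f E).hom.app X ≫ (shiftD D E).map ((corD f E).map a.hom) ≫ t =
        (corD f E).map ((shiftD C E).map a.hom) ≫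
          (corDShiftIso f E).hom.app ((toD C E).obj M) ≫ t := fun t =>
      (Category.assoc _ _ _).symm.trans ((congrArg (· ≫ t) h5.symm).trans (Category.assoc _ _ _))
    rw [h6, corDShiftIso_comp, Functor.map_comp_assoc (corD f E),
      Functor.map_comp_assoc (corD f E)]

/-- Corestriction is a triangulated functor. -/
lemma isTriangulated_corDPlus : IsTriangulated (corDPlus f E) :=
  ⟨ObjectProperty.isoOfCompι (Functor.isoWhiskerLeft (isPlusD C E).ι (corDShiftIso f E)),
    fun _ _ _ _ _ _ h => corD_isDistinguished f h⟩

/-- The morphism `C → D` as a morphism of `D`-`D`-bicomodules. -/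
def corRightBicomodToReg : (cor f D).obj f.rightBicomod ⟶ D.reg where
  toLin := f.toHom.toLinearMap
  isHom := f.isHom
  lco_comp := by
    have h : Coalgebra.comul (R := k) ∘ₗ f.toHom.toLinearMap =
        f.toHom.toLinearMap.lTensor D.carrier ∘ₗ f.toHom.toLinearMap.rTensor C.carrier ∘ₗ
          Coalgebra.comul (R := k) := by
      rw [← LinearMap.comp_assoc, LinearMap.lTensor_comp_rTensor]
      exact f.toHom.map_comp_comul.symm
    exact h
  rco_comp := by
    have h : Coalgebra.comul (R := k) ∘ₗ f.toHom.toLinearMap =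
        f.toHom.toLinearMap.rTensor D.carrier ∘ₗ f.toHom.toLinearMap.lTensor C.carrier ∘ₗ
          Coalgebra.comul (R := k) := by
      rw [← LinearMap.comp_assoc, LinearMap.rTensor_comp_lTensor]
      exact f.toHom.map_comp_comul.symm
    exact h

end Bicomod

lemma DGCoalg.unit_isPositive (k : Type u) [Field k] : (DGCoalg.unit k).IsPositive := fun _ hn =>
  if_neg hn.ne

end

theorem mainTheorem4 {k : Type u} [Field k] {C D : DGCoalg k} (hC : C.IsPositive)
    (hD : D.IsPositive) (f : C.Hom D) (hf : f.IsQuasiIso) :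
    (∃ R : Bicomod.DPlus C D ⥤ Bicomod.DPlus D D,
      f.leftBicomod.IsDerivedCotensor (f.leftBicomod_isBoundedBelow hC) R ∧
      Nonempty ((R.obj (f.rightBicomod.toDPlus (f.rightBicomod_isBoundedBelow hC))).obj ≅
        (Bicomod.toD D D).obj D.reg)) ∧
    (∃ R : Bicomod.DPlus D C ⥤ Bicomod.DPlus C C,
      f.rightBicomod.IsDerivedCotensor (f.rightBicomod_isBoundedBelow hC) R ∧
      Nonempty ((R.obj (f.leftBicomod.toDPlus (f.leftBicomod_isBoundedBelow hC))).obj ≅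
        (Bicomod.toD C C).obj C.reg)) ∧
    (∃ (F : DerivedPlus C ⥤ DerivedPlus D) (G : DerivedPlus D ⥤ DerivedPlus C),
      f.leftBicomod.IsDerivedCotensor (f.leftBicomod_isBoundedBelow hC) F ∧
      f.rightBicomod.IsDerivedCotensor (f.rightBicomod_isBoundedBelow hC) G ∧
      Bicomod.IsTriangulated F ∧
      Nonempty (F ⋙ G ≅ 𝟭 (DerivedPlus C)) ∧ Nonempty (G ⋙ F ≅ 𝟭 (DerivedPlus D))) := by
  have hk := DGCoalg.unit_isPositive k
  refine ⟨⟨Bicomod.corDPlus f D, Bicomod.isDerivedCotensor_corDPlus f hC hD, ?_⟩,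
    ⟨Bicomod.coindDPlus f hC hD hC, Bicomod.isDerivedCotensor_resolve hD hC _, ?_⟩,
    ⟨Bicomod.corDPlus f _, Bicomod.coindDPlus f hC hD hk,
      Bicomod.isDerivedCotensor_corDPlus f hC hk, Bicomod.isDerivedCotensor_resolve hD hk _,
      Bicomod.isTriangulated_corDPlus f, ⟨Bicomod.corCoindIso f hC hD hk hf⟩,
      ⟨Bicomod.coindCorIso f hC hD hk hf⟩⟩⟩
  -- The derived functor is corestriction, so its value on `C_f` is `C` with both coactions pushed
  -- to `D`; the map `f` from there to `D` is bicolinear and a quasi-isomorphism.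
  · have := Bicomod.isIso_toD_map (Bicomod.corRightBicomodToReg f) hf
    exact ⟨Bicomod.corDIso f f.rightBicomod ≪≫
      asIso ((Bicomod.toD D D).map (Bicomod.corRightBicomodToReg f))⟩
  -- By definition `_fC` is the corestriction of the regular bicomodule `C`, so derived coinduction
  -- takes it back to `C`.
  · have e : f.leftBicomod.toDPlus (f.leftBicomod_isBoundedBelow hC) ≅
        (Bicomod.corDPlus f C).obj (C.reg.toDPlus ⟨0, hC⟩) :=
      ObjectProperty.isoMk _ (Bicomod.corDIso f C.reg).symm
    exact ⟨(ObjectProperty.ι _).mapIso ((Bicomod.coindDPlus f hC hD hC).mapIso e ≪≫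
      (Bicomod.corCoindIso f hC hD hC hf).app (C.reg.toDPlus ⟨0, hC⟩))⟩
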